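/- Setting. Let $M$ be an $m$-dimensional manifold ($m\ge1$) with volume form $\omega_M$ and $\pi:E\to M$ a bundle with $\dim E=m+n$. Let $\Lambda^{m-1}T^*M$ be the bundle of $(m-1)$-covectors of $M$, $\mathcal M\pi=\Lambda^m_2T^*E$ the bundle of $m$-covectors of $E$ that vanish on any two $\pi$-vertical vectors, and $J^{1*}\pi=\mathcal M\pi/\pi^*\Lambda^mT^*M$. Put $$\mathcal P=J^1\pi\times_M\Lambda^{m-1}T^*M,\quad \widetilde{\mathcal P}=\mathcal M\pi\times_M\Lambda^{m-1}T^*M,\quad \mathcal P^*=J^{1*}\pi\times_M\Lambda^{m-1}T^*M,\quad \mathcal W=(J^1\pi\times_E\mathcal M\pi)\times_M\Lambda^{m-1}T^*M,$$ with natural coordinates $(x^\mu,y^A,y^A_\mu,s^\mu)$, $(x^\mu,y^A,p^\mu_A,p,s^\mu)$, $(x^\mu,y^A,p^\mu_A,s^\mu)$ and $(x^\mu,y^A,y^A_\mu,p^\mu_A,p,s^\mu)$, where $p^\mu_A,p$ are the components of $p^\mu_A\,dy^A\wedge d^{m-1}x_\mu+p\,d^mx$ and $s^\mu$ those of $s^\mu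 d^{m-1}x_\mu$, $d^{m-1}x_\mu=i(\partial/\partial x^\mu)d^mx$. Write $\omega$ for the pull-back of $\omega_M$. Let $L\in C^\infty(\mathcal P)$ be a Lagrangian, $\mathcal L=L\,\omega$; formulas below are in coordinates with $\omega_M=d^mx$. Assume that $L$ is regular, i.e. the Hessian $(\partial^2L/\partial y^A_\mu\partial y^B_\nu)$ is everywhere nonsingular; $L$ is hyperregular if moreover the Legendre map below is a global diffeomorphism. The extended and restricted Legendre maps $\widetilde{\mathcal{FL}}:\mathcal P\to\widetilde{\mathcal P}$ and $\mathcal{FL}:\mathcal P\to\mathcal P^*$ are given by $p^\mu_A=\partial L/\partial y^A_\mu$, $p=L-y^A_\mu\,\partial L/\partial y^A_\mu$, with the other coordinates unchanged. Let $\widetilde\Theta=-p^\mu_A\,dy^A\wedge d^{m-1}x_\mu-p\,d^mx+ds^\mu\wedge d^{m-1}x_\mu$ be the canonical form of $\widetilde{\mathcal P}$ and $\Theta_{\mathcal W}$ its pull-back to $\mathcal W$. Define: * $\Theta_{\mathcal L}=-i(\mathrm J)d\mathcal L-\mathcal L+d(s^\mu d^{m-1}x_\mu)$ on $\mathcal P$,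 where $\mathrm J$ is the canonical endomorphism; that is, $\Theta_{\mathcal L}=-\frac{\partial L}{\partial y^A_\mu}dy^A\wedge d^{m-1}x_\mu+\big(\frac{\partial L}{\partial y^A_\mu}y^A_\mu-L\big)d^mx+ds^\mu\wedge d^{m-1}x_\mu$; * $\Theta_{\mathcal H}=\mathbf h^*\widetilde\Theta$ with $\mathbf h=\widetilde{\mathcal{FL}}\circ\mathcal{FL}^{-1}$, on $\mathcal P^*$ if $L$ is hyperregular; if $L$ is only regular, this is done locally, on $\mathcal{FL}(U)$ with $\mathcal{FL}|_U^{-1}$, for open sets $U\subset\mathcal P$ on which $\mathcal{FL}$ is injective; * $\mathcal W_\circ=\{w\in\mathcal W\mid \mathcal L(w)=\mathcal C(w)\}$, where $\mathcal C=(p+p^\mu_Ay^A_\mu)\,d^mx$ is the coupling form, with projections $\mathrm{pr}_\circ:\mathcal W_\circ\to\mathcal P$ and $\overline{\mathrm{pr}}_\circ:\mathcal W_\circ\to\mathcal P^*$, and $\Theta_\circ=\Theta_{\mathcal W}|_{\mathcal W_\circ}$; * $\mathrm j_1:\mathcal W_1\hookrightarrow\mathcal W_\circ$, the set of points at which $i(X)d\Theta_\circ=0$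 for every $\overline{\mathrm{pr}}_\circ$-vertical $X$, and $\mathrm{pr}_1=\mathrm{pr}_\circ|_{\mathcal W_1}$. For $\Theta$ one of $\Theta_{\mathcal L},\Theta_{\mathcal H},\Theta_\circ$ put $\overline d\Theta=d\Theta+\sigma_\Theta\wedge\Theta$ (at the points of $\mathcal W_1$ in the case of $\Theta_\circ$), where the dissipation form $\sigma_\Theta$ is the unique 1-form with $\sigma_\Theta\wedge i(R)\Theta=i(R)d\Theta$ for all Reeb vectors $R$, i.e. all $R\in\ker\omega$ such that $i(Z)i(R)d\Theta=0$ for all $Z\in\ker\omega$. A section $\psi$ solves the field equations of $\Theta$ if $$\psi^*\Theta=0,\qquad \psi^*\,i(Y)\overline d\Theta=0\quad\text{for every vector field }Y.$$ These are the unified (premulticontact) equations for $\Theta_\circ$, the multicontact Lagrangian (Herglotz--Euler--Lagrange) equations for $\Theta_{\mathcal L}$, and the multicontact Hamilton--de Donder--Weyl equations for $\Theta_{\mathcal H}$. Theorem. Let $\psi_\circ:M\to\mathcal W_\circ$ be a section with image in $\mathcal W_1$ that solves the unified equations. Put $\psi_{\mathcal L}=\mathrm{pr}_\circ\circ\psi_\circ:M\to\mathcal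 P$ and $\psi_{\mathcal H}=\mathcal{FL}\circ\psi_{\mathcal L}:M\to\mathcal P^*$. These are sections, $\psi_{\mathcal H}=\overline{\mathrm{pr}}_\circ\circ\psi_\circ$, and: 1. $\psi_{\mathcal L}$ is the canonical lift to $\mathcal P$ of the projected section $\phi:M\to E$ of $\psi_{\mathcal L}$, i.e. $\psi_{\mathcal L}=(j^1\phi,s)$; so $\psi_{\mathcal L}$ is holonomic. 2. $\psi_{\mathcal L}$ solves the multicontact Lagrangian equations, and $\psi_{\mathcal H}$ solves the multicontact Hamilton--de Donder--Weyl equations (if $L$ is only regular: at each $x\in M$, for each local form $\Theta_{\mathcal H}$ defined by an open set $U\ni\psi_{\mathcal L}(x)$ on which $\mathcal{FL}$ is injective; such $U$ exist). Conversely, $\mathrm{pr}_1:\mathcal W_1\to\mathcal P$ is bijective, and for every section $\psi_{\mathcal L}:M\to\mathcal P$ that solves the multicontact Lagrangian equations, $\psi_\circ=\mathrm j_1\circ\mathrm{pr}_1^{-1}\circ\psi_{\mathcal L}:M\to\mathcal W_\circ$ is a section with image in $\mathcal W_1$ that solves the unified equations. -/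

import Mathlib

open scoped Manifold ContDiff

noncomputable section

namespace Multicontact

/-! ## Linear algebra and differential forms on a coordinate space -/

/-- Model of the base: `ℝ^m` with `m = k + 1 ≥ 1`. -/
abbrev XX (k : ℕ) := EuclideanSpace ℝ (Fin (k + 1))

/-- Model of the fibres of the configuration bundle. -/
abbrev YY (n : ℕ) := EuclideanSpace ℝ (Fin n)

/-- Arrays `(y^A_μ)`, respectively `(p^μ_A)`. -/
abbrev VV (k n : ℕ) := Fin n → Fin (k + 1) → ℝ

/-- Arrays `(s^μ)`. -/
abbrev SS (k : ℕ) := Fin (k + 1) → ℝ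

section Forms

variable {Z : Type*} [NormedAddCommGroup Z] [NormedSpace ℝ Z] {r : ℕ}

/-- The exterior product `σ ∧ β` of a covector and an `r`-covector:
`(σ ∧ β)(v₀, …, v_r) = ∑ i, (-1)^i σ(v_i) β(v₀, …, v̂_i, …, v_r)`. -/
def wedge (σ : Z →L[ℝ] ℝ) (β : Z [⋀^Fin r]→L[ℝ] ℝ) : Z [⋀^Fin (r + 1)]→L[ℝ] ℝ :=
  ContinuousAlternatingMap.alternatizeUncurryFin (σ.smulRight β)

/-- The Reeb space of `(Θ, vol)` at a point: the vectors `R ∈ ker vol` such that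
`i_R dΘ` is annihilated by `ker vol`. Here `Ω` is the value of `dΘ`. -/
def reeb (Ω : Z [⋀^Fin (r + 2)]→L[ℝ] ℝ) (vol : Z [⋀^Fin (r + 1)]→L[ℝ] ℝ) : Set Z :=
  {R | vol.curryLeft R = 0 ∧
    ∀ X : Z, vol.curryLeft X = 0 → (Ω.curryLeft R).curryLeft X = 0}

/-- The defining property of the dissipation form:
`σ ∧ i_R Θ = i_R dΘ` for every Reeb vector `R`. -/
def IsDissipation (Θ : Z [⋀^Fin (r + 1)]→L[ℝ] ℝ) (Ω : Z [⋀^Fin (r + 2)]→L[ℝ] ℝ)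
    (vol : Z [⋀^Fin (r + 1)]→L[ℝ] ℝ) (σ : Z →L[ℝ] ℝ) : Prop :=
  ∀ R ∈ reeb Ω vol, wedge σ (Θ.curryLeft R) = Ω.curryLeft R

open Classical in
/-- The dissipation form at a point: the unique covector with the defining property
(and `0` at the points where there is no such unique covector). -/
def dissipation (Θ : Z [⋀^Fin (r + 1)]→L[ℝ] ℝ) (Ω : Z [⋀^Fin (r + 2)]→L[ℝ] ℝ)
    (vol : Z [⋀^Fin (r + 1)]→L[ℝ] ℝ) : Z →L[ℝ] ℝ :=
  if h : ∃! σ, IsDissipation Θ Ω vol σ then h.choose else 0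

/-- `d̄Θ = dΘ + σ_Θ ∧ Θ`. -/
def barD (Θ vol : Z → Z [⋀^Fin (r + 1)]→L[ℝ] ℝ) (z : Z) : Z [⋀^Fin (r + 2)]→L[ℝ] ℝ :=
  extDeriv Θ z + wedge (dissipation (Θ z) (extDeriv Θ z) (vol z)) (Θ z)

/-- The pull-back `f^* β` at `ξ`. -/
def pullback {X : Type*} [NormedAddCommGroup X] [NormedSpace ℝ X]
    (f : X → Z) (β : Z → Z [⋀^Fin r]→L[ℝ] ℝ) (ξ : X) : X [⋀^Fin r]→L[ℝ] ℝ :=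
  (β (f ξ)).compContinuousLinearMap (fderiv ℝ f ξ)

/-- The field equations for sections, `f^* Θ = 0` and `f^* (i_Y d̄Θ) = 0` for every vector
field `Y`, at the point `ξ`. -/
def FieldEquationsAt {X : Type*} [NormedAddCommGroup X] [NormedSpace ℝ X]
    (Θ vol : Z → Z [⋀^Fin (r + 1)]→L[ℝ] ℝ) (f : X → Z) (ξ : X) : Prop :=
  pullback f Θ ξ = 0 ∧
    ∀ Y : Z → Z, ContDiff ℝ ∞ Y → pullback f (fun z => (barD Θ vol z).curryLeft (Y z)) ξ = 0

end Forms

/-- The form `d^m x = dx^1 ∧ ⋯ ∧ dx^m` on `ℝ^m`. -/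
def stdVol (k : ℕ) : XX k [⋀^Fin (k + 1)]→L[ℝ] ℝ :=
  { (Matrix.detRowAlternating (R := ℝ) (n := Fin (k + 1))).compLinearMap
      (EuclideanSpace.equiv (Fin (k + 1)) ℝ).toLinearMap with
    cont := by
      change Continuous fun v : Fin (k + 1) → XX k =>
        Matrix.det (Matrix.of fun i j => v i j)
      apply Continuous.matrix_det
      fun_prop }

/-- The coordinate vector `∂/∂x^μ` of `ℝ^m`. -/
def stdX {k : ℕ} (μ : Fin (k + 1)) : XX k := EuclideanSpace.single μ 1

/-- The coordinate vector `∂/∂y^A` of `ℝ^n`. -/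
def stdY {n : ℕ} (A : Fin n) : YY n := EuclideanSpace.single A 1

/-- The elementary array with entry `1` at `(A, μ)`. -/
def stdV {k n : ℕ} (A : Fin n) (μ : Fin (k + 1)) : VV k n := Pi.single A (Pi.single μ 1)

/-! ### Canonical forms on a coordinate space `Z` in which `q : Z → (x, y, s)` reads off the
coordinates `x^μ`, `y^A`, `s^μ` -/

section CanonicalForms

variable {Z : Type*} [NormedAddCommGroup Z] [NormedSpace ℝ Z] {k n : ℕ}
  (q : Z →L[ℝ] XX k × YY n × SS k)

/-- The `XX k`-valued form `(dx^μ)_μ`. -/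
def dX : Z →L[ℝ] XX k := (ContinuousLinearMap.fst ℝ _ _).comp q

/-- `dx^μ`. -/
def dx (μ : Fin (k + 1)) : Z →L[ℝ] ℝ := (EuclideanSpace.proj μ).comp (dX q)

/-- `dy^A`. -/
def dy (A : Fin n) : Z →L[ℝ] ℝ :=
  (EuclideanSpace.proj A).comp
    ((ContinuousLinearMap.fst ℝ _ _).comp ((ContinuousLinearMap.snd ℝ _ _).comp q))

/-- `d^m x`. -/
def dmx : Z [⋀^Fin (k + 1)]→L[ℝ] ℝ := (stdVol k).compContinuousLinearMap (dX q)

/-- `d^{m-1} x_μ = i(∂/∂x^μ) d^m x`. -/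
def dm1x (μ : Fin (k + 1)) : Z [⋀^Fin k]→L[ℝ] ℝ :=
  ((stdVol k).curryLeft (stdX μ)).compContinuousLinearMap (dX q)

/-- The canonical action form `S = s^μ d^{m-1} x_μ`. -/
def actionForm (z : Z) : Z [⋀^Fin k]→L[ℝ] ℝ := ∑ μ, (q z).2.2 μ • dm1x q μ

/-- The pull-back of the Liouville form `p^μ_A dy^A ∧ d^{m-1}x_μ + p d^m x`
to a space on which the momenta are the functions `P` and `p`. -/
def liouville (P : Z → VV k n) (p : Z → ℝ) (z : Z) : Z [⋀^Fin (k + 1)]→L[ℝ] ℝ :=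
  (∑ A, ∑ μ, P z A μ • wedge (dy q A) (dm1x q μ)) + p z • dmx q

/-- The pull-back of the canonical multicontact form `-Θ + d(s^μ d^{m-1}x_μ)`
to a space on which the momenta are the functions `P` and `p`. -/
def canonicalForm (P : Z → VV k n) (p : Z → ℝ) (z : Z) : Z [⋀^Fin (k + 1)]→L[ℝ] ℝ :=
  - liouville q P p z + extDeriv (actionForm q) z

end CanonicalForms

/-- Space of the coordinates `(x^μ, y^A, y^A_μ, s^μ)` or `(x^μ, y^A, p^μ_A, s^μ)`. -/
abbrev ZP (k n : ℕ) := XX k × YY n × VV k n × SS k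

/-- Space of the coordinates `(x^μ, y^A, y^A_μ, p^μ_A, s^μ)`. -/
abbrev ZW (k n : ℕ) := XX k × YY n × VV k n × VV k n × SS k

/-- `(x, y, v, s) ↦ (x, y, s)`. -/
def qP (k n : ℕ) : ZP k n →L[ℝ] XX k × YY n × SS k :=
  (ContinuousLinearMap.id ℝ (XX k)).prodMap
    ((ContinuousLinearMap.id ℝ (YY n)).prodMap (ContinuousLinearMap.snd ℝ (VV k n) (SS k)))

/-- `(x, y, v, p, s) ↦ (x, y, s)`. -/
def qW (k n : ℕ) : ZW k n →L[ℝ] XX k × YY n × SS k :=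
  (ContinuousLinearMap.id ℝ (XX k)).prodMap
    ((ContinuousLinearMap.id ℝ (YY n)).prodMap
      ((ContinuousLinearMap.snd ℝ (VV k n) (SS k)).comp
        (ContinuousLinearMap.snd ℝ (VV k n) (VV k n × SS k))))

/-! ## The bundles -/

section Bundles

variable {k n : ℕ}
variable {M : Type*} [TopologicalSpace M] [ChartedSpace (XX k) M]
variable {E : Type*} [TopologicalSpace E] [ChartedSpace (XX k × YY n) E]

/-- `T_x M`. -/
abbrev TM (x : M) := TangentSpace 𝓘(ℝ, XX k) x

/-- `T_y E`. -/
abbrev TE (y : E) := TangentSpace 𝓘(ℝ, XX k × YY n) y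

/-- `T_y π`. -/
abbrev dπ (π : E → M) (y : E) : TE (k := k) (n := n) y →L[ℝ] TM (k := k) (π y) :=
  mfderiv 𝓘(ℝ, XX k × YY n) 𝓘(ℝ, XX k) π y

/-- The fibre of `J¹π → E` at `y`: the right inverses of `T_y π`. -/
@[ext]
structure JetAt (π : E → M) (y : E) where
  lin : TM (k := k) (π y) →L[ℝ] TE (k := k) (n := n) y
  isSec : (dπ π y).comp lin = ContinuousLinearMap.id ℝ _

/-- The fibre of the extended multimomentum bundle `Mπ = Λ₂^m T^*E` at `y`: the `m`-covectors
that vanish whenever two of their arguments are `π`-vertical. -/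
def Mom (π : E → M) (y : E) :
    Submodule ℝ (TE (k := k) (n := n) y [⋀^Fin (k + 1)]→L[ℝ] ℝ) where
  carrier := {α | ∀ v : Fin (k + 1) → TE (k := k) (n := n) y, ∀ i j, i ≠ j →
    dπ π y (v i) = 0 → dπ π y (v j) = 0 → α v = 0}
  zero_mem' := fun _ _ _ _ _ _ => rfl
  add_mem' := by
    intro a b ha hb v i j hij hi hj
    rw [ContinuousAlternatingMap.add_apply, ha v i j hij hi hj, hb v i j hij hi hj, add_zero]
  smul_mem' := by
    intro t a ha v i j hij hi hj
    rw [ContinuousAlternatingMap.smul_apply, ha v i j hij hi hj, smul_zero]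

/-- Equality modulo `π`-basic `m`-covectors: `α - β` vanishes whenever one of its arguments is
`π`-vertical. -/
def basicSetoid (π : E → M) (y : E) : Setoid (Mom (k := k) (n := n) π y) where
  r α β := ∀ v : Fin (k + 1) → TE (k := k) (n := n) y, ∀ i,
    dπ π y (v i) = 0 → α.1 v - β.1 v = 0
  iseqv :=
    { refl := fun _ _ _ _ => sub_self _
      symm := fun h v i hi => by rw [← neg_sub, h v i hi, neg_zero]
      trans := fun h h' v i hi => by
        rw [← sub_add_sub_cancel, h v i hi, h' v i hi, add_zero] }

/-- The fibre of the restricted multimomentum bundle `J^{1*}π = Mπ / π^*Λ^m T^*M` at `y`. -/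
def RMom (π : E → M) (y : E) := Quotient (basicSetoid (k := k) (n := n) π y)

/-- The multivelocity phase bundle `P = J¹π ×_M Λ^{m-1}T^*M`. -/
structure P (π : E → M) where
  pt : E
  jet : JetAt (k := k) (n := n) π pt
  act : TM (k := k) (π pt) [⋀^Fin k]→L[ℝ] ℝ

/-- The extended multimomentum phase bundle `P̃ = Mπ ×_M Λ^{m-1}T^*M`. -/
structure PExt (π : E → M) where
  pt : E
  mom : Mom (k := k) (n := n) π pt
  act : TM (k := k) (π pt) [⋀^Fin k]→L[ℝ] ℝ

/-- The multimomentum phase bundle `P^* = J^{1*}π ×_M Λ^{m-1}T^*M`. -/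
structure PStar (π : E → M) where
  pt : E
  mom : RMom (k := k) (n := n) π pt
  act : TM (k := k) (π pt) [⋀^Fin k]→L[ℝ] ℝ

/-- The extended jet-multimomentum bundle `W = (J¹π ×_E Mπ) ×_M Λ^{m-1}T^*M`. -/
structure W (π : E → M) where
  pt : E
  jet : JetAt (k := k) (n := n) π pt
  mom : Mom (k := k) (n := n) π pt
  act : TM (k := k) (π pt) [⋀^Fin k]→L[ℝ] ℝ

variable {π : E → M}

/-- The projection `W → P`. -/
def W.toP (w : W (k := k) (n := n) π) : P (k := k) (n := n) π := ⟨w.pt, w.jet, w.act⟩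

/-- The projection `W → P^*`. -/
def W.toPStar (w : W (k := k) (n := n) π) : PStar (k := k) (n := n) π :=
  ⟨w.pt, Quotient.mk _ w.mom, w.act⟩

/-- A volume form on `M`: a nowhere vanishing smooth `m`-form. -/
structure IsVolumeForm (vol : ∀ x : M, TM (k := k) x [⋀^Fin (k + 1)]→L[ℝ] ℝ) : Prop where
  ne_zero : ∀ x, vol x ≠ 0
  smooth : ∀ e ∈ IsManifold.maximalAtlas 𝓘(ℝ, XX k) ∞ M,
    ContDiffOn ℝ ∞ (fun ξ => vol (e.symm ξ)
      (fun μ => (mfderiv 𝓘(ℝ, XX k) 𝓘(ℝ, XX k) e (e.symm ξ)).inverse (stdX μ))) e.target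

/-- The value at `w = (ȳ, 𝐩)` of the coupling form: `𝒞(w) = (T_xφ)^*𝐩` with `j¹φ(x) = ȳ`. -/
def coupling {y : E} (j : JetAt (k := k) (n := n) π y) (α : Mom (k := k) (n := n) π y) :
    TM (k := k) (π y) [⋀^Fin (k + 1)]→L[ℝ] ℝ :=
  α.1.compContinuousLinearMap j.lin

/-- The Lagrangian density `ℒ = L vol` at a point of `P`. -/
def density (vol : ∀ x : M, TM (k := k) x [⋀^Fin (k + 1)]→L[ℝ] ℝ)
    (L : P (k := k) (n := n) π → ℝ) (a : P (k := k) (n := n) π) :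
    TM (k := k) (π a.pt) [⋀^Fin (k + 1)]→L[ℝ] ℝ :=
  L a • vol (π a.pt)

/-- The Hamiltonian submanifold `W_∘ = {w ∈ W | ℒ(w) = 𝒞(w)}`. -/
def W0 (vol : ∀ x : M, TM (k := k) x [⋀^Fin (k + 1)]→L[ℝ] ℝ)
    (L : P (k := k) (n := n) π → ℝ) : Set (W (k := k) (n := n) π) :=
  {w | density vol L w.toP = coupling w.jet w.mom}

/-- The point `j + t (j' - j)` of the affine space of 1-jets at `y`. -/
def JetAt.line {y : E} (j j' : JetAt (k := k) (n := n) π y) (t : ℝ) :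
    JetAt (k := k) (n := n) π y where
  lin := j.lin + t • (j'.lin - j.lin)
  isSec := by
    rw [ContinuousLinearMap.comp_add, ContinuousLinearMap.comp_smul,
      ContinuousLinearMap.comp_sub, j.isSec, j'.isSec, sub_self, smul_zero, add_zero]

/-- `α` is the value at `a = (j, s)` of the extended Legendre map: `α ∈ Mπ`, seen through the
coupling as an affine function of the jet, is the first order Taylor polynomial at `j` of the
Lagrangian density restricted to the fibre of `J¹π → E` (with `s` fixed). In natural
coordinates, with `ℒ = Λ d^m x`: `p^μ_A = ∂Λ/∂y^A_μ` and `p = Λ - y^A_μ ∂Λ/∂y^A_μ`. -/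
def IsLegendre (vol : ∀ x : M, TM (k := k) x [⋀^Fin (k + 1)]→L[ℝ] ℝ)
    (L : P (k := k) (n := n) π → ℝ) (a : P (k := k) (n := n) π)
    (α : Mom (k := k) (n := n) π a.pt) : Prop :=
  ∀ j' : JetAt (k := k) (n := n) π a.pt,
    coupling j' α = (L a + deriv (fun t : ℝ => L ⟨a.pt, a.jet.line j' t, a.act⟩) 0) • vol (π a.pt)

open Classical in
/-- The extended Legendre map `P → P̃`. -/
def FLExt (vol : ∀ x : M, TM (k := k) x [⋀^Fin (k + 1)]→L[ℝ] ℝ)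
    (L : P (k := k) (n := n) π → ℝ) (a : P (k := k) (n := n) π) : PExt (k := k) (n := n) π :=
  ⟨a.pt, if h : ∃ α, IsLegendre vol L a α then h.choose else 0, a.act⟩

/-- The projection `P̃ → P^*`. -/
def PExt.toPStar (b : PExt (k := k) (n := n) π) : PStar (k := k) (n := n) π :=
  ⟨b.pt, Quotient.mk _ b.mom, b.act⟩

/-- The restricted Legendre map `ℱL : P → P^*`. -/
def FL (vol : ∀ x : M, TM (k := k) x [⋀^Fin (k + 1)]→L[ℝ] ℝ)
    (L : P (k := k) (n := n) π → ℝ) (a : P (k := k) (n := n) π) : PStar (k := k) (n := n) π :=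
  (FLExt vol L a).toPStar

/-- A representative in `Mπ` of a class in `J^{1*}π`. -/
def rep {y : E} (c : RMom (k := k) (n := n) π y) :
    Mom (k := k) (n := n) π y :=
  Quotient.out c

open Classical in
/-- The Hamiltonian section `𝐡 = ℱ̃L ∘ (ℱL|_U)⁻¹` on `ℱL(U)`, for a set `U ⊆ P` on which `ℱL` is
injective (the points outside `ℱL(U)` are sent to an arbitrary point above them). -/
def hamSection (vol : ∀ x : M, TM (k := k) x [⋀^Fin (k + 1)]→L[ℝ] ℝ)
    (L : P (k := k) (n := n) π → ℝ) (U : Set (P (k := k) (n := n) π))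
    (b : PStar (k := k) (n := n) π) : PExt (k := k) (n := n) π :=
  if h : ∃ a ∈ U, FL vol L a = b then FLExt vol L h.choose else ⟨b.pt, rep b.mom, b.act⟩

/-! ## Natural coordinates -/

/-- A pair of charts of `M` and `E` adapted to `π`: coordinates `(x^μ)` on `M` and
`(x^μ, y^A)` on `E`. -/
structure AdaptedChart (π : E → M) where
  e : OpenPartialHomeomorph M (XX k)
  e_mem : e ∈ IsManifold.maximalAtlas 𝓘(ℝ, XX k) ∞ M
  u : OpenPartialHomeomorph E (XX k × YY n)
  u_mem : u ∈ IsManifold.maximalAtlas 𝓘(ℝ, XX k × YY n) ∞ E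
  mapsTo : ∀ y ∈ u.source, π y ∈ e.source
  fst_eq : ∀ y ∈ u.source, (u y).1 = e (π y)

namespace AdaptedChart

variable (c : AdaptedChart (k := k) (n := n) π)

/-- `∂/∂x^μ ∈ T_x M`. -/
def frameM (x : M) (μ : Fin (k + 1)) : TM (k := k) x :=
  (mfderiv 𝓘(ℝ, XX k) 𝓘(ℝ, XX k) c.e x).inverse (stdX μ)

/-- `T_y u`. -/
def du (y : E) : TE (k := k) (n := n) y →L[ℝ] XX k × YY n :=
  mfderiv 𝓘(ℝ, XX k × YY n) 𝓘(ℝ, XX k × YY n) c.u y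

/-- `∂/∂x^μ ∈ T_y E`. -/
def frameX (y : E) (μ : Fin (k + 1)) : TE (k := k) (n := n) y := (c.du y).inverse (stdX μ, 0)

/-- `∂/∂y^A ∈ T_y E`. -/
def frameY (y : E) (A : Fin n) : TE (k := k) (n := n) y := (c.du y).inverse (0, stdY A)

/-- The coordinates `y^A_μ` of a jet. -/
def jetCoord {y : E} (j : JetAt (k := k) (n := n) π y) : VV k n :=
  fun A μ => (c.du y (j.lin (c.frameM (π y) μ))).2 A

/-- The coordinates `s^μ` of an `(m-1)`-covector `s^μ d^{m-1}x_μ`. -/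
def actCoord {x : M} (β : TM (k := k) x [⋀^Fin k]→L[ℝ] ℝ) : SS k :=
  fun μ => (-1) ^ (μ : ℕ) * β (fun i => c.frameM x (μ.succAbove i))

/-- The coordinates `p^μ_A` of `p^μ_A dy^A ∧ d^{m-1}x_μ + p d^m x`. -/
def momCoord {y : E} (α : Mom (k := k) (n := n) π y) : VV k n :=
  fun A μ => α.1 (Function.update (c.frameX y) μ (c.frameY y A))

/-- The coordinate `p` of `p^μ_A dy^A ∧ d^{m-1}x_μ + p d^m x`. -/
def pCoord {y : E} (α : Mom (k := k) (n := n) π y) : ℝ := α.1 (c.frameX y)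

/-- Natural coordinates `(x^μ, y^A, y^A_μ, s^μ)` on `P`. -/
def coordP (a : P (k := k) (n := n) π) : ZP k n :=
  ((c.u a.pt).1, (c.u a.pt).2, c.jetCoord a.jet, c.actCoord a.act)

/-- Natural coordinates `(x^μ, y^A, p^μ_A, s^μ)` on `P^*` (the `p^μ_A` do not depend on the
representative). -/
def coordPStar (b : PStar (k := k) (n := n) π) : ZP k n :=
  ((c.u b.pt).1, (c.u b.pt).2, c.momCoord (rep b.mom), c.actCoord b.act)

/-- Natural coordinates `(x^μ, y^A, y^A_μ, p^μ_A, s^μ)` on `W_∘`. -/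
def coordW (w : W (k := k) (n := n) π) : ZW k n :=
  ((c.u w.pt).1, (c.u w.pt).2, c.jetCoord w.jet, c.momCoord w.mom, c.actCoord w.act)

/-- The coordinate expression of a function `f` on a bundle `B → E`, in the chart of `B` with
domain the part of `B` above `c.u.source` and with coordinates `coord`
(and `0` outside the range of the chart). -/
def expr {B : Type*} (pt : B → E) {Z : Type*} (coord : B → Z) (f : B → ℝ) : Z → ℝ :=
  Function.extend (fun b : {b : B // pt b ∈ c.u.source} => coord b) (fun b => f b) 0

/-- The range of the natural coordinates of `P`. -/
def targetP : Set (ZP k n) := {z | (z.1, z.2.1) ∈ c.u.target}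

/-- The coordinate domain of a section whose projection to `E` is `φ`. -/
def dom (φ : M → E) : Set (XX k) := {ξ | ξ ∈ c.e.target ∧ φ (c.e.symm ξ) ∈ c.u.source}

/-- The coordinate expression of a section. -/
def sec {B : Type*} {Z : Type*} (coord : B → Z) (ψ : M → B) : XX k → Z :=
  fun ξ => coord (ψ (c.e.symm ξ))

/-- The coefficient of the volume form: `vol = (volCoeff) d^m x`. -/
def volCoeff (vol : ∀ x : M, TM (k := k) x [⋀^Fin (k + 1)]→L[ℝ] ℝ) (ξ : XX k) : ℝ :=
  vol (c.e.symm ξ) (c.frameM (c.e.symm ξ))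

variable (vol : ∀ x : M, TM (k := k) x [⋀^Fin (k + 1)]→L[ℝ] ℝ) (L : P (k := k) (n := n) π → ℝ)

/-- The coordinate expression `Λ` of the Lagrangian density `ℒ = Λ d^m x`.
(In charts with `vol = d^m x`, `Λ` is the coordinate expression of `L`.) -/
def lag : ZP k n → ℝ :=
  c.expr P.pt c.coordP (fun a => density vol L a (c.frameM (π a.pt)))

/-- `∂Λ/∂y^A_μ`. -/
def lagV (z : ZP k n) : VV k n :=
  fun A μ => fderiv ℝ (c.lag vol L) z (0, 0, stdV A μ, 0)

/-- The Hessian matrix `∂²Λ/∂y^A_μ∂y^B_ν`. -/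
def hessian (z : ZP k n) : Matrix (Fin n × Fin (k + 1)) (Fin n × Fin (k + 1)) ℝ :=
  Matrix.of fun i j => fderiv ℝ (fun z' => c.lagV vol L z' j.1 j.2) z (0, 0, stdV i.1 i.2, 0)

/-- The form `i(J)dℒ`, where `J = (dy^A - y^A_ν dx^ν) ⊗ ∂/∂y^A_μ ⊗ ∂/∂x^μ` is the canonical
endomorphism. -/
def iJdL (z : ZP k n) : ZP k n [⋀^Fin (k + 1)]→L[ℝ] ℝ :=
  ∑ A, ∑ μ, c.lagV vol L z A μ •
    wedge (dy (qP k n) A - ∑ ν, z.2.2.1 A ν • dx (qP k n) ν) (dm1x (qP k n) μ)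

/-- The Lagrangian form `Θ_ℒ = -i(J)dℒ - ℒ + dS`. -/
def thetaL (z : ZP k n) : ZP k n [⋀^Fin (k + 1)]→L[ℝ] ℝ :=
  - c.iJdL vol L z - c.lag vol L z • dmx (qP k n) + extDeriv (actionForm (qP k n)) z

/-- The form `τ^*vol` on `P`, or on `P^*`. -/
def omegaP (z : ZP k n) : ZP k n [⋀^Fin (k + 1)]→L[ℝ] ℝ := c.volCoeff vol z.1 • dmx (qP k n)

/-- The Hamiltonian form `Θ_ℋ = 𝐡^*Θ̃` of the Hamiltonian section `𝐡 = ℱ̃L ∘ (ℱL|_U)⁻¹`: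
the canonical form with `p` replaced by the function `p ∘ 𝐡 = -H` on `P^*`. -/
def thetaH (U : Set (P (k := k) (n := n) π)) (z : ZP k n) :
    ZP k n [⋀^Fin (k + 1)]→L[ℝ] ℝ :=
  canonicalForm (qP k n) (fun z => z.2.2.1)
    (c.expr PStar.pt c.coordPStar (fun b => c.pCoord (hamSection vol L U b).mom)) z

/-- The form `Θ_∘ = j_∘^*Θ_W` on `W_∘`: the canonical form with `p` replaced by the restriction
of this coordinate function to `W_∘`. -/
def theta0 (z : ZW k n) : ZW k n [⋀^Fin (k + 1)]→L[ℝ] ℝ :=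
  canonicalForm (qW k n) (fun z => z.2.2.2.1)
    (c.expr (fun w : W0 vol L => w.1.pt) (fun w => c.coordW w.1) (fun w => c.pCoord w.1.mom)) z

/-- The form `vol` on `W_∘`. -/
def omegaW (z : ZW k n) : ZW k n [⋀^Fin (k + 1)]→L[ℝ] ℝ := c.volCoeff vol z.1 • dmx (qW k n)

end AdaptedChart

/-! ## Lagrangians, sections and field equations -/

/-- Smooth functions on `P`. -/
def IsSmoothLagrangian (L : P (k := k) (n := n) π → ℝ) : Prop :=
  ∀ c : AdaptedChart (k := k) (n := n) π, ContDiffOn ℝ ∞ (c.expr P.pt c.coordP L) c.targetP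

/-- Regular Lagrangians: the Hessian matrix is regular everywhere. -/
def IsRegular (vol : ∀ x : M, TM (k := k) x [⋀^Fin (k + 1)]→L[ℝ] ℝ)
    (L : P (k := k) (n := n) π → ℝ) : Prop :=
  ∀ c : AdaptedChart (k := k) (n := n) π, ∀ z ∈ c.targetP, (c.hessian vol L z).det ≠ 0

/-- The submanifold `W_1` of `W_∘`: the points `w` with `(i_X dΘ_∘)(w) = 0` for every `X`
that is vertical for the projection `W_∘ → P^*`. -/
def W1 (vol : ∀ x : M, TM (k := k) x [⋀^Fin (k + 1)]→L[ℝ] ℝ)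
    (L : P (k := k) (n := n) π → ℝ) : Set (W0 vol L) :=
  {w | ∀ c : AdaptedChart (k := k) (n := n) π, w.1.pt ∈ c.u.source → ∀ h : VV k n,
    (extDeriv (c.theta0 vol L) (c.coordW w.1)).curryLeft (0, 0, h, 0, 0) = 0}

/-- Smooth sections `M → B` of a bundle `B → E → M`, where `pt : B → E` is the projection and
`coord` are the natural coordinates of `B`. -/
structure IsSection (π : E → M) {B : Type*} (pt : B → E) {Z : Type*} [NormedAddCommGroup Z]
    [NormedSpace ℝ Z] (coord : AdaptedChart (k := k) (n := n) π → B → Z) (ψ : M → B) :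
    Prop where
  proj : ∀ x, π (pt (ψ x)) = x
  smooth_pt : ContMDiff 𝓘(ℝ, XX k) 𝓘(ℝ, XX k × YY n) ∞ (fun x => pt (ψ x))
  smooth : ∀ c : AdaptedChart (k := k) (n := n) π,
    ContDiffOn ℝ ∞ (c.sec (coord c) ψ) (c.dom (fun x => pt (ψ x)))

/-- Smooth sections of `P → M`. -/
def IsSectionP (ψ : M → P (k := k) (n := n) π) : Prop :=
  IsSection π P.pt (fun c => c.coordP) ψ

/-- Smooth sections of `P^* → M`. -/
def IsSectionPStar (ψ : M → PStar (k := k) (n := n) π) : Prop :=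
  IsSection π PStar.pt (fun c => c.coordPStar) ψ

/-- Smooth sections of `W_∘ → M`. -/
def IsSectionW0 {vol : ∀ x : M, TM (k := k) x [⋀^Fin (k + 1)]→L[ℝ] ℝ}
    {L : P (k := k) (n := n) π → ℝ} (ψ : M → W0 vol L) : Prop :=
  IsSection π (fun w : W0 vol L => w.1.pt) (fun c w => c.coordW w.1) ψ

/-- `ψ : M → P` is the canonical lift of the section `φ : M → E`, that is `ψ = (j¹φ, s)`
for some `s`: the point `ψ(x)` lies above `φ(x)` and its jet is `T_xφ`. -/
def IsCanonicalLift (φ : M → E) (ψ : M → P (k := k) (n := n) π) : Prop :=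
  ∀ x, (ψ x).pt = φ x ∧ ∀ v : XX k, ((ψ x).jet.lin v : XX k × YY n) =
    mfderiv 𝓘(ℝ, XX k) 𝓘(ℝ, XX k × YY n) φ x v

/-- Holonomic sections of `P`: the canonical lifts of the smooth sections of `π`. -/
def IsHolonomic (ψ : M → P (k := k) (n := n) π) : Prop :=
  ∃ φ : M → E, (∀ x, π (φ x) = x) ∧ ContMDiff 𝓘(ℝ, XX k) 𝓘(ℝ, XX k × YY n) ∞ φ ∧
    IsCanonicalLift φ ψ

/-- The premulticontact equations for sections of `W_∘`:
`ψ^*Θ_∘ = 0` and `ψ^* i(Y) d̄Θ_∘ = 0` for every vector field `Y` on `W_∘`. -/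
def SolvesUnified (vol : ∀ x : M, TM (k := k) x [⋀^Fin (k + 1)]→L[ℝ] ℝ)
    (L : P (k := k) (n := n) π → ℝ) (ψ : M → W0 vol L) : Prop :=
  ∀ c : AdaptedChart (k := k) (n := n) π, ∀ ξ ∈ c.dom (fun x => (ψ x).1.pt),
    FieldEquationsAt (c.theta0 vol L) (c.omegaW vol) (c.sec (fun w : W0 vol L => c.coordW w.1) ψ) ξ

/-- The multicontact Lagrangian equations for sections of `P`:
`ψ^*Θ_ℒ = 0` and `ψ^* i(X) d̄Θ_ℒ = 0` for every vector field `X` on `P`. -/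
def SolvesLagrangian (vol : ∀ x : M, TM (k := k) x [⋀^Fin (k + 1)]→L[ℝ] ℝ)
    (L : P (k := k) (n := n) π → ℝ) (ψ : M → P (k := k) (n := n) π) : Prop :=
  ∀ c : AdaptedChart (k := k) (n := n) π, ∀ ξ ∈ c.dom (fun x => (ψ x).pt),
    FieldEquationsAt (c.thetaL vol L) (c.omegaP vol) (c.sec c.coordP ψ) ξ

/-- The multicontact Hamilton–de Donder–Weyl equations for a section of `P^*`, in the chart `c` at
the point with coordinates `ξ`, for the Hamiltonian section `ℱ̃L ∘ (ℱL|_U)⁻¹`: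
`ψ^*Θ_ℋ = 0` and `ψ^* i(Y) d̄Θ_ℋ = 0` for every vector field `Y` on `P^*`. -/
def SolvesHamiltonianAt (vol : ∀ x : M, TM (k := k) x [⋀^Fin (k + 1)]→L[ℝ] ℝ)
    (L : P (k := k) (n := n) π → ℝ) (U : Set (P (k := k) (n := n) π))
    (c : AdaptedChart (k := k) (n := n) π) (ψ : M → PStar (k := k) (n := n) π) (ξ : XX k) :
    Prop :=
  FieldEquationsAt (c.thetaH vol L U) (c.omegaP vol) (c.sec c.coordPStar ψ) ξ

/-- The Hamilton–de Donder–Weyl equations for a hyperregular Lagrangian, with the global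
Hamiltonian section `ℱ̃L ∘ ℱL⁻¹`. -/
def SolvesHamiltonian (vol : ∀ x : M, TM (k := k) x [⋀^Fin (k + 1)]→L[ℝ] ℝ)
    (L : P (k := k) (n := n) π → ℝ) (ψ : M → PStar (k := k) (n := n) π) : Prop :=
  ∀ c : AdaptedChart (k := k) (n := n) π, ∀ ξ ∈ c.dom (fun x => (ψ x).pt),
    SolvesHamiltonianAt vol L Set.univ c ψ ξ

/-- Sets on which `ℱL` is injective and whose part in the domain of the chart `c` is open;
if `L` is regular, then `ℱL` maps this part diffeomorphically onto an open set of `P^*`. -/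
def IsLegendreDomain (vol : ∀ x : M, TM (k := k) x [⋀^Fin (k + 1)]→L[ℝ] ℝ)
    (L : P (k := k) (n := n) π → ℝ) (c : AdaptedChart (k := k) (n := n) π)
    (U : Set (P (k := k) (n := n) π)) : Prop :=
  Set.InjOn (FL vol L) U ∧ IsOpen (c.coordP '' {a | a ∈ U ∧ a.pt ∈ c.u.source})

/-- The Hamilton–de Donder–Weyl equations for the section `ℱL ∘ ψ` of `P^*` and a regular
Lagrangian: around every point of `ψ` there are local Hamiltonian sections `ℱ̃L ∘ (ℱL|_U)⁻¹`, and
`ℱL ∘ ψ` solves the equations for each of them. -/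
def SolvesHamiltonianLocally (vol : ∀ x : M, TM (k := k) x [⋀^Fin (k + 1)]→L[ℝ] ℝ)
    (L : P (k := k) (n := n) π → ℝ) (ψ : M → P (k := k) (n := n) π) : Prop :=
  ∀ c : AdaptedChart (k := k) (n := n) π, ∀ ξ ∈ c.dom (fun x => (ψ x).pt),
    (∃ U, IsLegendreDomain vol L c U ∧ ψ (c.e.symm ξ) ∈ U) ∧
    ∀ U, IsLegendreDomain vol L c U → ψ (c.e.symm ξ) ∈ U →
      SolvesHamiltonianAt vol L U c (fun x => FL vol L (ψ x)) ξ

/-- Hyperregular Lagrangians: `ℱL` is a global diffeomorphism, that is, `L` is regular (so that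
`ℱL` is a local diffeomorphism) and `ℱL` is bijective. -/
def IsHyperregular (vol : ∀ x : M, TM (k := k) x [⋀^Fin (k + 1)]→L[ℝ] ℝ)
    (L : P (k := k) (n := n) π → ℝ) : Prop :=
  IsRegular vol L ∧ Function.Bijective (FL vol L)

/-- The projection `pr_∘ : W_∘ → P`. -/
def pr0 {vol : ∀ x : M, TM (k := k) x [⋀^Fin (k + 1)]→L[ℝ] ℝ} {L : P (k := k) (n := n) π → ℝ}
    (w : W0 vol L) : P (k := k) (n := n) π := w.1.toP

/-- The projection `W_∘ → P^*`. -/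
def prBar0 {vol : ∀ x : M, TM (k := k) x [⋀^Fin (k + 1)]→L[ℝ] ℝ}
    {L : P (k := k) (n := n) π → ℝ} (w : W0 vol L) : PStar (k := k) (n := n) π := w.1.toPStar

/-- The projection `pr_1 : W_1 → P`. -/
def pr1 {vol : ∀ x : M, TM (k := k) x [⋀^Fin (k + 1)]→L[ℝ] ℝ} {L : P (k := k) (n := n) π → ℝ}
    (w : W1 vol L) : P (k := k) (n := n) π := pr0 w.1

end Bundles

end Multicontact

end

/-! In natural coordinates all three forms are instances of `canonicalForm q P p`, that is -P^μ_A
dy^A ∧ d^{m-1}x_μ - p d^m x + ds^μ ∧ d^{m-1}x_μ, for different functions P and p. With ℒ = Λ d^m x,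
the pair (P, p) is (∂Λ/∂v, Λ - v·∂Λ/∂v) for Θ_ℒ. For Θ_∘ the momenta P are coordinates and p = Λ -
P·v. For Θ_ℋ the momenta P are coordinates and p is Λ - v·∂Λ/∂v composed with a local inverse of the
Legendre map.

In each case two facts hold at the relevant points. Modulo the dx^μ one has dp = ℓ_A dy^A + λ_μ ds^μ
- v^A_μ dP^μ_A with ℓ = ∂Λ/∂y and λ = ∂Λ/∂s, and dP is onto already on the vectors with dx = dy = ds
= 0. For Θ_∘ the first fact needs P = ∂Λ/∂v, which is the equation of W_1. For Θ_ℒ the second fact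
is the regularity of L. These facts alone determine the Reeb vectors (`mem_reeb_iff`), the
dissipation form -λ_μ dx^μ (`dissipation_eq`) and the field equations (`fieldEquationsAt_iff`),
which become ∂_μ s^μ = p + P^μ_A ∂_μ y^A, ∂_μ y^A = v^A_μ and ∂_μ P^μ_A = ℓ_A + λ_μ P^μ_A.

This system involves only x, y, v, s and the values of P and p along the section. It is therefore
the same system, `HerglotzEulerLagrange`, for a section f of P, for its lift (f, ∂Λ/∂v) to W_∘ and
for its Legendre image in P^* (`fieldEquationsAt_iff_herglotz`). The equivalences between the
unified and the Lagrangian equations and the step to the Hamiltonian equations follow, and ∂_μ y^A =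
v^A_μ is holonomy.

The condition defining W_1 says exactly P = ∂Λ/∂v, and W_∘ fixes p, so W_1 is the graph of the
extended Legendre map and pr_1 is bijective (`bijective_pr1`). The remaining work relates the
intrinsic bundles to coordinates: adapted charts exist because π is a submersion, jets and covectors
are determined by their coordinates, and the Legendre map, defined by a Taylor polynomial, is p^μ_A
= ∂Λ/∂y^A_μ. -/

noncomputable section

namespace Multicontact

set_option linter.unusedSectionVars false

open scoped Topology

/-! ### Exterior products with a covector, and their contractions. -/

section Wedge

variable {Z : Type*} [NormedAddCommGroup Z] [NormedSpace ℝ Z] {r : ℕ}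

theorem wedge_apply (σ : Z →L[ℝ] ℝ) (β : Z [⋀^Fin r]→L[ℝ] ℝ) (v : Fin (r + 1) → Z) :
    wedge σ β v = ∑ i : Fin (r + 1), (-1) ^ (i : ℕ) * (σ (v i) * β (i.removeNth v)) := by
  simp [wedge, ContinuousAlternatingMap.alternatizeUncurryFin_apply]

theorem wedge_smul (σ : Z →L[ℝ] ℝ) (a : ℝ) (β : Z [⋀^Fin r]→L[ℝ] ℝ) :
    wedge σ (a • β) = a • wedge σ β := by
  ext v
  simp only [wedge_apply, ContinuousAlternatingMap.smul_apply, smul_eq_mul, Finset.mul_sum]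
  exact Finset.sum_congr rfl fun i _ => by ring

theorem wedge_add (σ : Z →L[ℝ] ℝ) (β γ : Z [⋀^Fin r]→L[ℝ] ℝ) :
    wedge σ (β + γ) = wedge σ β + wedge σ γ := by
  ext v
  simp only [wedge_apply, ContinuousAlternatingMap.add_apply, ← Finset.sum_add_distrib]
  exact Finset.sum_congr rfl fun i _ => by ring

theorem wedge_sum {ι : Type*} (s : Finset ι) (σ : Z →L[ℝ] ℝ) (β : ι → Z [⋀^Fin r]→L[ℝ] ℝ) :
    wedge σ (∑ i ∈ s, β i) = ∑ i ∈ s, wedge σ (β i) := by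
  classical
  induction s using Finset.induction_on with
  | empty => ext v; simp [wedge_apply]
  | insert a s ha ih => rw [Finset.sum_insert ha, Finset.sum_insert ha, wedge_add, ih]

theorem add_wedge (σ τ : Z →L[ℝ] ℝ) (β : Z [⋀^Fin r]→L[ℝ] ℝ) :
    wedge (σ + τ) β = wedge σ β + wedge τ β := by
  ext v
  simp only [wedge_apply, ContinuousAlternatingMap.add_apply, ← Finset.sum_add_distrib]
  exact Finset.sum_congr rfl fun i _ => by simp; ring

theorem smul_wedge (a : ℝ) (σ : Z →L[ℝ] ℝ) (β : Z [⋀^Fin r]→L[ℝ] ℝ) :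
    wedge (a • σ) β = a • wedge σ β := by
  ext v
  simp only [wedge_apply, ContinuousAlternatingMap.smul_apply, smul_eq_mul, Finset.mul_sum]
  exact Finset.sum_congr rfl fun i _ => by simp; ring

theorem sum_wedge {ι : Type*} (s : Finset ι) (σ : ι → Z →L[ℝ] ℝ) (β : Z [⋀^Fin r]→L[ℝ] ℝ) :
    wedge (∑ i ∈ s, σ i) β = ∑ i ∈ s, wedge (σ i) β := by
  classical
  induction s using Finset.induction_on with
  | empty => ext v; simp [wedge_apply]
  | insert a s ha ih => rw [Finset.sum_insert ha, Finset.sum_insert ha, add_wedge, ih]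

theorem curryLeft_sum {ι : Type*} (s : Finset ι) (β : ι → Z [⋀^Fin (r + 1)]→L[ℝ] ℝ) (Y : Z) :
    (∑ i ∈ s, β i).curryLeft Y = ∑ i ∈ s, (β i).curryLeft Y := by
  ext v; simp [ContinuousAlternatingMap.sum_apply]

theorem removeNth_succ_vecCons {α : Type*} {r : ℕ} (a : α) (v : Fin (r + 1) → α)
    (i : Fin (r + 1)) :
    i.succ.removeNth (Matrix.vecCons a v : Fin (r + 2) → α) =
      Matrix.vecCons a (i.removeNth v) := by
  ext j
  refine Fin.cases ?_ (fun j => ?_) j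
  · simp [Fin.removeNth]
  · simp [Fin.removeNth]

/-- The summand with index 0 evaluates σ on Y. In all the others Y is the first argument of β, and
the shift of the index by one produces the minus sign. -/
theorem curryLeft_wedge (σ : Z →L[ℝ] ℝ) (β : Z [⋀^Fin (r + 1)]→L[ℝ] ℝ) (Y : Z) :
    (wedge σ β).curryLeft Y = σ Y • β - wedge σ (β.curryLeft Y) := by
  ext v
  rw [ContinuousAlternatingMap.curryLeft_apply_apply, wedge_apply, Fin.sum_univ_succ,
    ContinuousAlternatingMap.sub_apply, ContinuousAlternatingMap.smul_apply, wedge_apply,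
    sub_eq_add_neg, ← Finset.sum_neg_distrib]
  simp only [removeNth_succ_vecCons, ContinuousAlternatingMap.curryLeft_apply_apply]
  congr 1
  · simp
  · refine Finset.sum_congr rfl fun i _ => ?_
    simp [pow_succ]

/-- For m = 1 the forms d^{m-1}x_μ have degree 0 and cannot be contracted. The hypothesis is
therefore put on the values of β, and it is empty in degree 0. -/
theorem curryLeft_wedge_of_vanish (σ : Z →L[ℝ] ℝ) (β : Z [⋀^Fin r]→L[ℝ] ℝ) (Y : Z)
    (h : ∀ w, (∃ i, w i = Y) → β w = 0) : (wedge σ β).curryLeft Y = σ Y • β := by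
  cases r with
  | zero =>
    ext v
    rw [ContinuousAlternatingMap.curryLeft_apply_apply, wedge_apply]
    simp
  | succ r =>
    rw [curryLeft_wedge, sub_eq_self]
    have : β.curryLeft Y = 0 := by ext w; exact h _ ⟨0, rfl⟩
    ext w; simp [this, wedge_apply]

end Wedge

/-! ### Alternating forms on ℝ^m in degrees m-1, m and m+1. -/

section StdVol

variable {k : ℕ}

theorem stdVol_apply (v : Fin (k + 1) → XX k) :
    stdVol k v = Matrix.det (Matrix.of fun i j => v i j) := rfl

theorem stdVol_stdX : stdVol k stdX = 1 := by
  rw [stdVol_apply, ← Matrix.det_one (n := Fin (k + 1)) (R := ℝ)]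
  congr 1
  ext i j
  simp [stdX, Matrix.one_apply, eq_comm]

theorem vecCons_succAbove_eq {α : Type*} (μ : Fin (k + 1)) (w : Fin (k + 1) → α) (a : α) :
    μ.insertNth a (fun i => w (μ.succAbove i)) = Function.update w μ a := by
  ext j
  refine Fin.succAboveCases μ ?_ (fun i => ?_) j
  · simp
  · simp

/-- Inserting `a` into the slot `μ` of `w`, or in front of the other entries, up to sign. -/
theorem map_vecCons_succAbove {Z : Type*} [NormedAddCommGroup Z] [NormedSpace ℝ Z]
    (β : Z [⋀^Fin (k + 1)]→L[ℝ] ℝ) (μ : Fin (k + 1)) (w : Fin (k + 1) → Z) (a : Z) :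
    β (Matrix.vecCons a fun i => w (μ.succAbove i)) =
      (-1) ^ (μ : ℕ) * β (Function.update w μ a) := by
  rw [← β.neg_one_pow_smul_map_insertNth μ, vecCons_succAbove_eq]
  rw [zsmul_eq_mul]
  push_cast
  rfl

theorem stdVol_curryLeft_succAbove (μ ν : Fin (k + 1)) :
    (stdVol k).curryLeft (stdX μ) (fun i => stdX (ν.succAbove i)) =
      if μ = ν then (-1) ^ (ν : ℕ) else 0 := by
  rw [ContinuousAlternatingMap.curryLeft_apply_apply, map_vecCons_succAbove]
  split_ifs with h
  · rw [h, Function.update_eq_self, stdVol_stdX, mul_one]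
  · rw [(stdVol k).map_eq_zero_of_eq _ (i := μ) (j := ν) _ h, mul_zero]
    simp [Function.update_of_ne h]

/-- The coordinate basis of `ℝ^m`. -/
def basisX (k : ℕ) : Module.Basis (Fin (k + 1)) ℝ (XX k) :=
  (EuclideanSpace.basisFun (Fin (k + 1)) ℝ).toBasis

theorem basisX_apply (μ : Fin (k + 1)) : basisX k μ = stdX μ := by
  simp [basisX, stdX]

theorem sum_smul_stdX (x : XX k) : ∑ μ, x μ • stdX μ = x := by
  ext i
  simp [stdX, Pi.single_apply]

/-- Forms of top degree on `ℝ^m` that agree on the coordinate frame agree. -/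
theorem ext_top {α β : XX k [⋀^Fin (k + 1)]→L[ℝ] ℝ} (h : α stdX = β stdX) : α = β := by
  apply ContinuousAlternatingMap.toAlternatingMap_injective
  refine Module.Basis.ext_alternating (basisX k) fun v hv => ?_
  have hb : Function.Bijective v := Finite.injective_iff_bijective.1 hv
  have e : (fun i => basisX k (v i)) = stdX ∘ (Equiv.ofBijective v hb) := by
    funext i; simp [basisX_apply]
  rw [e]
  rw [AlternatingMap.map_perm, AlternatingMap.map_perm]
  congr 1

/-- Forms of degree `m - 1` on `ℝ^m` are determined by their values on the coordinate frames with
one vector omitted. -/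
theorem ext_pred_top {α β : XX k [⋀^Fin k]→L[ℝ] ℝ}
    (h : ∀ μ : Fin (k + 1), α (fun i => stdX (μ.succAbove i)) = β (fun i => stdX (μ.succAbove i))) :
    α = β := by
  apply ContinuousAlternatingMap.toAlternatingMap_injective
  refine Module.Basis.ext_alternating (basisX k) fun v hv => ?_
  -- Only m-1 indices occur, so some μ is missed, and v is a permutation of the indices other than
  -- μ.
  obtain ⟨μ, hμ⟩ : ∃ μ, ∀ i, v i ≠ μ := by
    by_contra! hc
    have : Function.Surjective v := fun μ => hc μ
    have := Fintype.card_le_of_surjective v this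
    simp at this
  choose g hg using fun i => Fin.exists_succAbove_eq (hμ i)
  have hgi : Function.Injective g := fun i j hij => hv (by rw [← hg i, ← hg j, hij])
  have hb : Function.Bijective g := Finite.injective_iff_bijective.1 hgi
  have e : (fun i => basisX k (v i)) =
      (fun i => stdX (μ.succAbove i)) ∘ (Equiv.ofBijective g hb) := by
    funext i; simp [basisX_apply, hg]
  rw [e]
  rw [AlternatingMap.map_perm, AlternatingMap.map_perm]
  congr 1
  exact h μ

/-- Forms of degree `m + 1` on `ℝ^m` vanish. -/
theorem eq_zero_of_degree_succ (α : XX k [⋀^Fin (k + 2)]→L[ℝ] ℝ) : α = 0 := by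
  apply ContinuousAlternatingMap.toAlternatingMap_injective
  refine Module.Basis.ext_alternating (basisX k) fun v hv => ?_
  have := Fintype.card_le_of_injective v hv
  simp at this

end StdVol

/-! ### The canonical form: exterior derivative and contractions with vertical vectors. -/

section Canonical

variable {Z : Type*} [NormedAddCommGroup Z] [NormedSpace ℝ Z] {k n : ℕ}
  (q : Z →L[ℝ] XX k × YY n × SS k)

/-- `ds^μ`. -/
def ds (μ : Fin (k + 1)) : Z →L[ℝ] ℝ :=
  (ContinuousLinearMap.proj μ).comp
    ((ContinuousLinearMap.snd ℝ _ _).comp ((ContinuousLinearMap.snd ℝ _ _).comp q))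

/-- The component `(A, μ)` of a linear map into the arrays. -/
def entry (P' : Z →L[ℝ] VV k n) (A : Fin n) (μ : Fin (k + 1)) : Z →L[ℝ] ℝ :=
  (ContinuousLinearMap.proj μ).comp ((ContinuousLinearMap.proj A).comp P')

@[simp] theorem dX_apply (z : Z) : dX q z = (q z).1 := rfl
@[simp] theorem dx_apply (μ : Fin (k + 1)) (z : Z) : dx q μ z = (q z).1 μ := rfl
@[simp] theorem dy_apply (A : Fin n) (z : Z) : dy q A z = (q z).2.1 A := rfl
@[simp] theorem ds_apply (μ : Fin (k + 1)) (z : Z) : ds q μ z = (q z).2.2 μ := rfl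
@[simp] theorem entry_apply (P' : Z →L[ℝ] VV k n) (A : Fin n) (μ : Fin (k + 1)) (z : Z) :
    entry P' A μ z = P' z A μ := rfl

variable {q}

theorem dmx_eq_zero {w : Fin (k + 1) → Z} {Y : Z} (hY : dX q Y = 0) (h : ∃ i, w i = Y) :
    dmx q w = 0 := by
  obtain ⟨i, rfl⟩ := h
  exact (stdVol k).map_coord_zero i hY

theorem dm1x_eq_zero {w : Fin k → Z} {Y : Z} (hY : dX q Y = 0) (h : ∃ i, w i = Y)
    (μ : Fin (k + 1)) : dm1x q μ w = 0 := by
  obtain ⟨i, rfl⟩ := h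
  exact ((stdVol k).curryLeft (stdX μ)).map_coord_zero i hY

theorem curryLeft_wedge_dm1x {Y : Z} (hY : dX q Y = 0) (σ : Z →L[ℝ] ℝ) (μ : Fin (k + 1)) :
    (wedge σ (dm1x q μ)).curryLeft Y = σ Y • dm1x q μ :=
  curryLeft_wedge_of_vanish _ _ _ fun _ h => dm1x_eq_zero hY h μ

theorem curryLeft_wedge_dmx {Y : Z} (hY : dX q Y = 0) (σ : Z →L[ℝ] ℝ) :
    (wedge σ (dmx q)).curryLeft Y = σ Y • dmx q :=
  curryLeft_wedge_of_vanish _ _ _ fun _ h => dmx_eq_zero hY h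

theorem curryLeft_dmx {Y : Z} (hY : dX q Y = 0) : (dmx q).curryLeft Y = 0 := by
  ext w; exact dmx_eq_zero hY ⟨0, rfl⟩

theorem dmx_frame {T : Fin (k + 1) → Z} (hT : ∀ μ, dX q (T μ) = stdX μ) : dmx q T = 1 := by
  rw [← stdVol_stdX]
  exact congrArg (stdVol k) (funext hT)

theorem dm1x_frame {T : Fin (k + 1) → Z} (hT : ∀ μ, dX q (T μ) = stdX μ) (μ ν : Fin (k + 1)) :
    dm1x q μ (fun i => T (ν.succAbove i)) = if μ = ν then (-1) ^ (ν : ℕ) else 0 := by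
  rw [← stdVol_curryLeft_succAbove]
  exact congrArg ((stdVol k).curryLeft (stdX μ)) (funext fun i => hT _)

/-- Only the summand that feeds T μ to σ survives; its sign and the sign of d^{m-1}x_μ on the
remaining vectors are both (-1)^μ and cancel. -/
theorem wedge_dm1x_frame {T : Fin (k + 1) → Z} (hT : ∀ μ, dX q (T μ) = stdX μ) (σ : Z →L[ℝ] ℝ)
    (μ : Fin (k + 1)) : wedge σ (dm1x q μ) T = σ (T μ) := by
  rw [wedge_apply, Finset.sum_eq_single μ]
  · have := dm1x_frame hT μ μ
    rw [if_pos rfl] at this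
    change _ * (_ * dm1x q μ (fun i => T (μ.succAbove i))) = _
    rw [this, mul_comm (σ (T μ)), ← mul_assoc, ← pow_add, Even.neg_one_pow ⟨_, rfl⟩, one_mul]
  · intro ν _ h
    have := dm1x_frame hT μ ν
    rw [if_neg h.symm] at this
    change _ * (_ * dm1x q μ (fun i => T (ν.succAbove i))) = _
    rw [this, mul_zero, mul_zero]
  · simp

/-- The forms `d^{m-1}x_μ` are linearly independent. -/
theorem eq_zero_of_sum_dm1x {T : Fin (k + 1) → Z} (hT : ∀ μ, dX q (T μ) = stdX μ)
    {c : Fin (k + 1) → ℝ} (h : ∑ μ, c μ • dm1x q μ = 0) (ν : Fin (k + 1)) : c ν = 0 := by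
  have := congrArg (fun β : Z [⋀^Fin k]→L[ℝ] ℝ => β (fun i => T (ν.succAbove i))) h
  simp only [ContinuousAlternatingMap.sum_apply, ContinuousAlternatingMap.smul_apply,
    dm1x_frame hT, ContinuousAlternatingMap.coe_zero, Pi.zero_apply, smul_eq_mul] at this
  simpa using this

theorem wedge_comp {X : Type*} [NormedAddCommGroup X] [NormedSpace ℝ X] {r : ℕ}
    (σ : X →L[ℝ] ℝ) (β : X [⋀^Fin r]→L[ℝ] ℝ) (f : Z →L[ℝ] X) :
    wedge (σ.comp f) (β.compContinuousLinearMap f) = (wedge σ β).compContinuousLinearMap f := by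
  ext v
  rw [wedge_apply, ContinuousAlternatingMap.compContinuousLinearMap_apply, wedge_apply]
  rfl

theorem wedge_dx_dm1x (ν μ : Fin (k + 1)) :
    wedge (dx q ν) (dm1x q μ) = if ν = μ then dmx q else 0 := by
  have : wedge (EuclideanSpace.proj ν : XX k →L[ℝ] ℝ) ((stdVol k).curryLeft (stdX μ)) =
      if ν = μ then stdVol k else 0 := by
    apply ext_top
    -- The identity is checked on ℝ^m itself, viewed as a coordinate space without y (n = 0) and
    -- with s = 0, and then pulled back along `dX q`.
    have h := wedge_dm1x_frame (n := 0) (q := (ContinuousLinearMap.inl ℝ (XX k) (YY 0 × SS k)))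
      (T := stdX) (fun _ => rfl) (EuclideanSpace.proj ν) μ
    refine Eq.trans h ?_
    split_ifs with hh
    · subst hh; simp [stdX, stdVol_stdX]
    · simp [stdX, hh]
  rw [show dx q ν = (EuclideanSpace.proj ν : XX k →L[ℝ] ℝ).comp (dX q) from rfl, dm1x, wedge_comp,
    this]
  split_ifs
  · rfl
  · ext v; simp

variable (q)

theorem hasFDerivAt_actionForm (z : Z) :
    HasFDerivAt (actionForm q) (∑ μ, (ds q μ).smulRight (dm1x q μ)) z := by
  unfold actionForm
  refine HasFDerivAt.fun_sum fun μ _ => ?_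
  exact ((ds q μ).hasFDerivAt (x := z)).smul_const (dm1x q μ)

theorem alternatizeUncurryFin_sum {ι : Type*} {r : ℕ} (s : Finset ι)
    (f : ι → Z →L[ℝ] Z [⋀^Fin r]→L[ℝ] ℝ) :
    ContinuousAlternatingMap.alternatizeUncurryFin (∑ i ∈ s, f i) =
      ∑ i ∈ s, ContinuousAlternatingMap.alternatizeUncurryFin (f i) :=
  map_sum (ContinuousAlternatingMap.alternatizeUncurryFinCLM ℝ Z ℝ) f s

theorem extDeriv_actionForm (z : Z) :
    extDeriv (actionForm q) z = ∑ μ, wedge (ds q μ) (dm1x q μ) := by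
  rw [extDeriv, (hasFDerivAt_actionForm q z).fderiv, alternatizeUncurryFin_sum]
  rfl

theorem canonicalForm_eq (P : Z → VV k n) (p : Z → ℝ) (z : Z) :
    canonicalForm q P p z =
      -((∑ A, ∑ μ, P z A μ • wedge (dy q A) (dm1x q μ)) + p z • dmx q) +
        ∑ μ, wedge (ds q μ) (dm1x q μ) := by
  rw [canonicalForm, extDeriv_actionForm, liouville]

variable {q} {P : Z → VV k n} {p : Z → ℝ} {P' : Z →L[ℝ] VV k n} {p' : Z →L[ℝ] ℝ} {z : Z}

/-- All the forms that occur are constant in the coordinates, so only the coefficients P and p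
contribute, and d(dS) drops out. -/
theorem extDeriv_canonicalForm (hP : HasFDerivAt P P' z) (hp : HasFDerivAt p p' z) :
    extDeriv (canonicalForm q P p) z =
      -((∑ A, ∑ μ, wedge (entry P' A μ) (wedge (dy q A) (dm1x q μ))) + wedge p' (dmx q)) := by
  have h : HasFDerivAt (canonicalForm q P p)
      (-((∑ A, ∑ μ, (entry P' A μ).smulRight (wedge (dy q A) (dm1x q μ))) +
        p'.smulRight (dmx q))) z := by
    rw [funext (canonicalForm_eq q P p)]
    refine HasFDerivAt.add_const _ (HasFDerivAt.neg (HasFDerivAt.add ?_ (hp.smul_const (dmx q))))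
    refine HasFDerivAt.fun_sum fun A _ => HasFDerivAt.fun_sum fun μ _ => ?_
    exact HasFDerivAt.smul_const ((entry (ContinuousLinearMap.id ℝ _) A μ).hasFDerivAt.comp z hP)
      (wedge (dy q A) (dm1x q μ))
  rw [extDeriv, h.fderiv, ← ContinuousAlternatingMap.alternatizeUncurryFinCLM_apply]
  simp only [map_neg, map_add, map_sum]
  rfl

theorem curryLeft_neg {r : ℕ} (β : Z [⋀^Fin (r + 1)]→L[ℝ] ℝ) (Y : Z) :
    (-β).curryLeft Y = -β.curryLeft Y := by
  ext; simp

/-- A vector with dx(Y) = 0 annihilates every d^{m-1}x_μ and d^m x, so it pairs only with the dy and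
ds factors. -/
theorem curryLeft_canonicalForm {Y : Z} (hY : dX q Y = 0) :
    (canonicalForm q P p z).curryLeft Y =
      ∑ μ, ((q Y).2.2 μ - ∑ A, P z A μ * (q Y).2.1 A) • dm1x q μ := by
  rw [canonicalForm_eq]
  simp only [ContinuousAlternatingMap.curryLeft_add, add_apply, curryLeft_neg,
    curryLeft_sum, ContinuousAlternatingMap.curryLeft_smul, smul_apply,
    curryLeft_wedge_dm1x hY, curryLeft_dmx hY, ds_apply, dy_apply, smul_zero, add_zero, smul_smul]
  rw [Finset.sum_comm, neg_add_eq_sub]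
  ext v
  simp only [ContinuousAlternatingMap.sub_apply, ContinuousAlternatingMap.sum_apply,
    ContinuousAlternatingMap.smul_apply, smul_eq_mul, sub_mul, Finset.sum_sub_distrib,
    Finset.sum_mul]

theorem curryLeft_extDeriv_canonicalForm (hP : HasFDerivAt P P' z) (hp : HasFDerivAt p p' z)
    {Y : Z} (hY : dX q Y = 0) :
    (extDeriv (canonicalForm q P p) z).curryLeft Y =
      -((∑ A, ∑ μ, (P' Y A μ • wedge (dy q A) (dm1x q μ) -
        (q Y).2.1 A • wedge (entry P' A μ) (dm1x q μ))) + p' Y • dmx q) := by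
  rw [extDeriv_canonicalForm hP hp]
  simp only [ContinuousAlternatingMap.curryLeft_add, add_apply, curryLeft_neg,
    curryLeft_sum, curryLeft_wedge, curryLeft_wedge_dm1x hY, curryLeft_wedge_dmx hY, dy_apply,
    entry_apply, wedge_smul]

theorem curryLeft_curryLeft_extDeriv_canonicalForm (hP : HasFDerivAt P P' z)
    (hp : HasFDerivAt p p' z) {Y X : Z} (hY : dX q Y = 0) (hX : dX q X = 0) :
    ((extDeriv (canonicalForm q P p) z).curryLeft Y).curryLeft X =
      ∑ μ, (-∑ A, (P' Y A μ * (q X).2.1 A - (q Y).2.1 A * P' X A μ)) • dm1x q μ := by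
  rw [curryLeft_extDeriv_canonicalForm hP hp hY]
  simp only [ContinuousAlternatingMap.curryLeft_add, add_apply, curryLeft_neg,
    curryLeft_sum, curryLeft_wedge_dm1x hX, curryLeft_dmx hX, dy_apply, sub_eq_add_neg,
    entry_apply, ContinuousAlternatingMap.curryLeft_smul, smul_apply, smul_zero,
    add_zero, smul_smul]
  rw [Finset.sum_comm]
  ext v
  simp only [ContinuousAlternatingMap.neg_apply, ContinuousAlternatingMap.sum_apply,
    ContinuousAlternatingMap.smul_apply, ContinuousAlternatingMap.add_apply, smul_eq_mul, add_mul,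
    neg_mul, Finset.sum_mul, Finset.sum_neg_distrib]

end Canonical

/-! ### Reeb vectors, dissipation form and field equations of a canonical form. -/

section FieldEquations

variable {Z : Type*} [NormedAddCommGroup Z] [NormedSpace ℝ Z] {k n : ℕ}
  {q : Z →L[ℝ] XX k × YY n × SS k} {P : Z → VV k n} {p : Z → ℝ} {P' : Z →L[ℝ] VV k n}
  {p' : Z →L[ℝ] ℝ} {z : Z}

theorem curryLeft_dmx_eq_sum (R : Z) :
    (dmx q).curryLeft R = ∑ μ, (q R).1 μ • dm1x q μ := by
  have h : (stdVol k).curryLeft (dX q R) = ∑ μ, (q R).1 μ • (stdVol k).curryLeft (stdX μ) := by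
    conv_lhs => rw [dX_apply, ← sum_smul_stdX (q R).1]
    simp [map_sum]
  ext w
  have := congrArg (fun β : XX k [⋀^Fin k]→L[ℝ] ℝ => β (fun i => dX q (w i))) h
  simp only [ContinuousAlternatingMap.sum_apply, ContinuousAlternatingMap.smul_apply] at this ⊢
  refine Eq.trans ?_ this
  refine congrArg (stdVol k) (funext fun i => ?_)
  refine Fin.cases ?_ (fun i => ?_) i <;> rfl

theorem exists_frame (hq : Function.Surjective q) :
    ∃ T : Fin (k + 1) → Z, ∀ μ, dX q (T μ) = stdX μ := by
  choose T hT using fun μ : Fin (k + 1) => hq (stdX μ, 0, 0)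
  exact ⟨T, fun μ => by rw [dX_apply, hT]⟩

/-- Of the volume form only its kernel matters, so any nonzero coefficient `a` gives the same Reeb
vectors; charts with ω = d^m x are not needed. -/
theorem curryLeft_smul_dmx_eq_zero_iff (hq : Function.Surjective q) {a : ℝ} (ha : a ≠ 0) {R : Z} :
    (a • dmx q).curryLeft R = 0 ↔ dX q R = 0 := by
  rw [ContinuousAlternatingMap.curryLeft_smul, smul_apply]
  constructor
  · intro h
    have h0 := (smul_eq_zero.1 h).resolve_left ha
    rw [curryLeft_dmx_eq_sum] at h0
    obtain ⟨T, hT⟩ := exists_frame hq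
    ext μ
    exact eq_zero_of_sum_dm1x hT h0 μ
  · intro h
    rw [curryLeft_dmx h, smul_zero]

/-- On ker dx, the double contraction of dΘ is the pairing of dP with dy. Testing R against vectors
with q X = 0 and arbitrary dP(X) gives dy(R) = 0, and then testing against ∂/∂y^A gives dP(R) = 0.
-/
theorem mem_reeb_iff (hP : HasFDerivAt P P' z) (hp : HasFDerivAt p p' z)
    (hq : Function.Surjective q) (hv : ∀ V : VV k n, ∃ Y, q Y = 0 ∧ P' Y = V)
    {a : ℝ} (ha : a ≠ 0) {R : Z} :
    R ∈ reeb (extDeriv (canonicalForm q P p) z) (a • dmx q) ↔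
      dX q R = 0 ∧ (q R).2.1 = 0 ∧ P' R = 0 := by
  simp only [reeb, Set.mem_ofPred_eq, curryLeft_smul_dmx_eq_zero_iff hq ha]
  refine and_congr_right fun hR => ?_
  obtain ⟨T, hT⟩ := exists_frame hq
  constructor
  · intro h
    have key : ∀ X, dX q X = 0 → ∀ μ,
        ∑ A, (P' R A μ * (q X).2.1 A - (q R).2.1 A * P' X A μ) = 0 := by
      intro X hX μ
      have := h X hX
      rw [curryLeft_curryLeft_extDeriv_canonicalForm hP hp hR hX] at this
      exact neg_eq_zero.1 (eq_zero_of_sum_dm1x hT this μ)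
    have hy : (q R).2.1 = 0 := by
      ext A
      obtain ⟨X, hX, hXV⟩ := hv (stdV A 0)
      have := key X (by rw [dX_apply, hX]; rfl) 0
      rw [hX, hXV] at this
      simpa [stdV, Pi.single_apply, ite_apply] using this
    refine ⟨hy, ?_⟩
    ext A μ
    obtain ⟨X, hX⟩ := hq (0, stdY A, 0)
    have := key X (by rw [dX_apply, hX]) μ
    rw [hX, hy] at this
    simpa [stdY, Pi.single_apply] using this
  · rintro ⟨hy, hP0⟩ X hX
    rw [curryLeft_curryLeft_extDeriv_canonicalForm hP hp hR hX, hy, hP0]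
    ext w; simp

section Data

variable {v : VV k n} {ℓ : Fin n → ℝ} {lam : Fin (k + 1) → ℝ}

/-- The hypothesis `hp'` reads dp = ℓ dy + λ ds - v dP modulo dx. On a Reeb vector this leaves i_RΘ
= ds^μ(R) d^{m-1}x_μ and i_R dΘ = -λ_μ ds^μ(R) d^m x. Since ds(R) is arbitrary, the condition on σ
is σ ∧ d^{m-1}x_μ = -λ_μ d^m x for each μ, which determines σ. -/
theorem isDissipation_iff (hP : HasFDerivAt P P' z) (hp : HasFDerivAt p p' z)
    (hq : Function.Surjective q) (hv : ∀ V : VV k n, ∃ Y, q Y = 0 ∧ P' Y = V)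
    (hp' : ∀ Y, dX q Y = 0 → p' Y = ∑ A, ℓ A * (q Y).2.1 A + ∑ μ, lam μ * (q Y).2.2 μ -
      ∑ A, ∑ μ, v A μ * P' Y A μ)
    {a : ℝ} (ha : a ≠ 0) {σ : Z →L[ℝ] ℝ} :
    IsDissipation (canonicalForm q P p z) (extDeriv (canonicalForm q P p) z) (a • dmx q) σ ↔
      σ = ∑ μ, -lam μ • dx q μ := by
  obtain ⟨T, hT⟩ := exists_frame hq
  have hR1 : ∀ R, dX q R = 0 → (q R).2.1 = 0 →
      (canonicalForm q P p z).curryLeft R = ∑ μ, (q R).2.2 μ • dm1x q μ := by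
    intro R hR hy
    rw [curryLeft_canonicalForm hR]
    simp [hy]
  have hR2 : ∀ R, dX q R = 0 → (q R).2.1 = 0 → P' R = 0 →
      (extDeriv (canonicalForm q P p) z).curryLeft R =
        -((∑ μ, lam μ * (q R).2.2 μ) • dmx q) := by
    intro R hR hy hPR
    rw [curryLeft_extDeriv_canonicalForm hP hp hR, hp' R hR]
    ext w
    simp [hy, hPR]
  unfold IsDissipation
  simp only [mem_reeb_iff hP hp hq hv ha]
  constructor
  · intro h
    have key : ∀ μ, wedge σ (dm1x q μ) = -lam μ • dmx q := by
      intro μ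
      -- A Reeb vector over ∂/∂s^μ: a lift of it is corrected inside ker q so that dP vanishes on
      -- it.
      obtain ⟨R₀, hR₀⟩ := hq (0, 0, Pi.single μ 1)
      obtain ⟨X, hX, hXV⟩ := hv (P' R₀)
      have hqR : q (R₀ - X) = (0, 0, Pi.single μ 1) := by rw [map_sub, hX, hR₀, sub_zero]
      have hPR : P' (R₀ - X) = 0 := by rw [map_sub, hXV, sub_self]
      have hd : dX q (R₀ - X) = 0 := by rw [dX_apply, hqR]
      have hy : (q (R₀ - X)).2.1 = 0 := by rw [hqR]
      have := h (R₀ - X) ⟨hd, hy, hPR⟩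
      rw [hR1 _ hd hy, hR2 _ hd hy hPR, hqR] at this
      ext w
      have := congrArg (fun β => β w) this
      simpa [Pi.single_apply, ite_smul] using this
    -- Contraction of the identity for μ = 0 with X leaves σ(X) d^{m-1}x_0 = 0, and d^{m-1}x_0 is
    -- not zero.
    have hvert : ∀ X, dX q X = 0 → σ X = 0 := by
      intro X hX
      have := congrArg (fun β => ContinuousAlternatingMap.curryLeft β X) (key 0)
      simp only [curryLeft_wedge_dm1x hX, ContinuousAlternatingMap.curryLeft_smul, smul_apply,
        curryLeft_dmx hX, smul_zero] at this
      refine (smul_eq_zero.1 this).resolve_right fun h0 => ?_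
      have := dm1x_frame hT (0 : Fin (k + 1)) 0
      rw [h0] at this
      simp at this
    have hTσ : ∀ μ, σ (T μ) = -lam μ := by
      intro μ
      have := congrArg (fun β => β T) (key μ)
      simpa [wedge_dm1x_frame hT, dmx_frame hT] using this
    ext X
    -- Every vector is a combination of the frame T plus a vector killed by dx, and σ is now known
    -- on both.
    have h0 := hvert (X - ∑ μ, (q X).1 μ • T μ) (by
      simp only [map_sub, map_sum, map_smul, hT]
      rw [sum_smul_stdX, dX_apply, sub_self])
    rw [map_sub, sub_eq_zero] at h0
    rw [h0]
    simp [hTσ, mul_comm]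
  · rintro rfl R ⟨hd, hy, hPR⟩
    rw [hR1 _ hd hy, hR2 _ hd hy hPR]
    simp only [wedge_sum, wedge_smul, sum_wedge, smul_wedge, wedge_dx_dm1x]
    ext w
    simp [ContinuousAlternatingMap.sum_apply, apply_ite, Finset.sum_mul]
    exact Finset.sum_congr rfl fun μ _ => by ring

theorem dissipation_eq (hP : HasFDerivAt P P' z) (hp : HasFDerivAt p p' z)
    (hq : Function.Surjective q) (hv : ∀ V : VV k n, ∃ Y, q Y = 0 ∧ P' Y = V)
    (hp' : ∀ Y, dX q Y = 0 → p' Y = ∑ A, ℓ A * (q Y).2.1 A + ∑ μ, lam μ * (q Y).2.2 μ -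
      ∑ A, ∑ μ, v A μ * P' Y A μ)
    {a : ℝ} (ha : a ≠ 0) :
    dissipation (canonicalForm q P p z) (extDeriv (canonicalForm q P p) z) (a • dmx q) =
      ∑ μ, -lam μ • dx q μ := by
  have h : ∃! σ, IsDissipation (canonicalForm q P p z) (extDeriv (canonicalForm q P p) z)
      (a • dmx q) σ :=
    ⟨_, (isDissipation_iff hP hp hq hv hp' ha).2 rfl,
      fun σ hσ => (isDissipation_iff hP hp hq hv hp' ha).1 hσ⟩
  rw [dissipation, dif_pos h]
  exact (isDissipation_iff hP hp hq hv hp' ha).1 h.choose_spec.1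

theorem canonicalForm_frame {T : Fin (k + 1) → Z} (hT : ∀ μ, dX q (T μ) = stdX μ) :
    canonicalForm q P p z T =
      -((∑ A, ∑ μ, P z A μ * (q (T μ)).2.1 A) + p z) + ∑ μ, (q (T μ)).2.2 μ := by
  rw [canonicalForm_eq]
  simp [ContinuousAlternatingMap.sum_apply, wedge_dm1x_frame hT, dmx_frame hT]

/-- The dissipation term serves to cancel the λ_μ ds^μ(Y) coming from dp; what it leaves is -λ_μ
P^μ_A dy^A(Y). The result depends on Y only through dP(Y) and dy(Y), so the field equations split
into the second order condition and the Euler–Lagrange equations. -/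
theorem curryLeft_barD_frame (hP : HasFDerivAt P P' z) (hp : HasFDerivAt p p' z)
    (hq : Function.Surjective q) (hv : ∀ V : VV k n, ∃ Y, q Y = 0 ∧ P' Y = V)
    (hp' : ∀ Y, dX q Y = 0 → p' Y = ∑ A, ℓ A * (q Y).2.1 A + ∑ μ, lam μ * (q Y).2.2 μ -
      ∑ A, ∑ μ, v A μ * P' Y A μ)
    {vol : Z → Z [⋀^Fin (k + 1)]→L[ℝ] ℝ} {a : ℝ} (ha : a ≠ 0) (hvol : vol z = a • dmx q)
    {T : Fin (k + 1) → Z} (hT : ∀ μ, dX q (T μ) = stdX μ) {Y : Z} (hY : dX q Y = 0) :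
    (barD (canonicalForm q P p) vol z).curryLeft Y T =
      (∑ A, ∑ μ, P' Y A μ * (v A μ - (q (T μ)).2.1 A)) +
        ∑ A, (q Y).2.1 A * ((∑ μ, P' (T μ) A μ) - ℓ A - ∑ μ, lam μ * P z A μ) := by
  rw [barD, hvol, dissipation_eq hP hp hq hv hp' ha, ContinuousAlternatingMap.curryLeft_add,
    add_apply, curryLeft_wedge, curryLeft_canonicalForm hY,
    curryLeft_extDeriv_canonicalForm hP hp hY, hp' Y hY]
  have h1 : ∀ μ, (q Y).1 μ = 0 := fun μ => by rw [← dX_apply, hY]; rfl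
  have h2 : ∀ μ ν, (q (T μ)).1 ν = if μ = ν then 1 else 0 := fun μ ν => by
    rw [← dX_apply, hT]; simp [stdX, eq_comm]
  simp only [ContinuousAlternatingMap.add_apply, ContinuousAlternatingMap.neg_apply,
    ContinuousAlternatingMap.sub_apply, ContinuousAlternatingMap.sum_apply,
    ContinuousAlternatingMap.smul_apply, wedge_dm1x_frame hT, dmx_frame hT, wedge_sum, wedge_smul,
    sum_apply, smul_apply, dx_apply, dy_apply, entry_apply, smul_eq_mul, h1, h2]
  simp only [mul_zero, Finset.sum_const_zero, zero_mul, mul_ite, mul_one, Finset.sum_ite_eq,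
    Finset.mem_univ, if_true, zero_sub, mul_sub, sub_mul, Finset.sum_sub_distrib, mul_neg,
    Finset.sum_neg_distrib, Finset.mul_sum, Finset.sum_mul]
  have e1 : ∑ μ, ∑ A, P z A μ * (q Y).2.1 A * lam μ = ∑ A, ∑ μ, (q Y).2.1 A * (lam μ * P z A μ) := by
    rw [Finset.sum_comm]
    exact Finset.sum_congr rfl fun A _ => Finset.sum_congr rfl fun μ _ => by ring
  have e2 : ∑ μ, (q Y).2.2 μ * lam μ = ∑ μ, lam μ * (q Y).2.2 μ :=
    Finset.sum_congr rfl fun μ _ => mul_comm _ _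
  have e3 : ∑ A, ∑ μ, P' Y A μ * v A μ = ∑ A, ∑ μ, v A μ * P' Y A μ :=
    Finset.sum_congr rfl fun A _ => Finset.sum_congr rfl fun μ _ => mul_comm _ _
  have e4 : ∑ A, (q Y).2.1 A * ℓ A = ∑ A, ℓ A * (q Y).2.1 A :=
    Finset.sum_congr rfl fun μ _ => mul_comm _ _
  rw [e1, e2, e3, e4]
  ring

/-- The field equations of a canonical form in coordinates: the second order condition, the
Euler–Lagrange equations and the equation for the action variables. -/
theorem fieldEquationsAt_iff (hP : HasFDerivAt P P' z) (hp : HasFDerivAt p p' z)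
    (hq : Function.Surjective q) (hv : ∀ V : VV k n, ∃ Y, q Y = 0 ∧ P' Y = V)
    (hp' : ∀ Y, dX q Y = 0 → p' Y = ∑ A, ℓ A * (q Y).2.1 A + ∑ μ, lam μ * (q Y).2.2 μ -
      ∑ A, ∑ μ, v A μ * P' Y A μ)
    {vol : Z → Z [⋀^Fin (k + 1)]→L[ℝ] ℝ} {a : ℝ} (ha : a ≠ 0) (hvol : vol z = a • dmx q)
    {f : XX k → Z} {ξ : XX k} (hf : f ξ = z) (hF : ∀ x, dX q (fderiv ℝ f ξ x) = x) :
    FieldEquationsAt (canonicalForm q P p) vol f ξ ↔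
      (∑ μ, (q (fderiv ℝ f ξ (stdX μ))).2.2 μ =
        p z + ∑ A, ∑ μ, P z A μ * (q (fderiv ℝ f ξ (stdX μ))).2.1 A) ∧
      (∀ A μ, (q (fderiv ℝ f ξ (stdX μ))).2.1 A = v A μ) ∧
      ∀ A, ∑ μ, P' (fderiv ℝ f ξ (stdX μ)) A μ = ℓ A + ∑ μ, lam μ * P z A μ := by
  subst hf
  set F := fderiv ℝ f ξ
  have hT : ∀ μ, dX q (F (stdX μ)) = stdX μ := fun μ => hF _
  refine and_congr ?_ ?_
  -- The pull-back is a form of top degree on ℝ^m, so its value on the coordinate frame decides.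
  · have : pullback f (canonicalForm q P p) ξ = 0 ↔
        canonicalForm q P p (f ξ) (fun μ => F (stdX μ)) = 0 :=
      ⟨fun h => congrArg (fun β => β stdX) h, fun h => ext_top h⟩
    rw [this, canonicalForm_frame hT]
    constructor <;> intro h <;> linarith
  · have hpb : ∀ Y : Z → Z, pullback f (fun z => (barD (canonicalForm q P p) vol z).curryLeft (Y z)) ξ = 0 ↔
        (barD (canonicalForm q P p) vol (f ξ)).curryLeft (Y (f ξ)) (fun μ => F (stdX μ)) = 0 :=
      fun Y => ⟨fun h => congrArg (fun β => β stdX) h, fun h => ext_top h⟩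
    simp only [hpb]
    constructor
    · intro h
      have key : ∀ Y, dX q Y = 0 → _ = (0 : ℝ) := fun Y hY =>
        (curryLeft_barD_frame hP hp hq hv hp' ha hvol hT hY).symm.trans
          (h (fun _ => Y) contDiff_const)
      have hs : ∀ A μ, (q (F (stdX μ))).2.1 A = v A μ := by
        intro A μ
        -- Constant vector fields suffice as tests. This one has dy(Y) = 0 and dP(Y) elementary, so
        -- it isolates the single equation ∂_μ y^A = v^A_μ.
        obtain ⟨Y, hY, hYV⟩ := hv (stdV A μ)
        have := key Y (by rw [dX_apply, hY]; rfl)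
        rw [hY, hYV] at this
        simp [stdV, Pi.single_apply, ite_apply] at this
        linarith
      refine ⟨hs, fun A => ?_⟩
      obtain ⟨Y, hY⟩ := hq (0, stdY A, 0)
      have := key Y (by rw [dX_apply, hY])
      rw [hY] at this
      simp [stdY, hs] at this
      linarith
    · rintro ⟨hs, hel⟩ Y -
      set B := barD (canonicalForm q P p) vol (f ξ)
      set y := Y (f ξ)
      -- Only the part of Y vertical over M counts. The part tangent to the section contributes an
      -- (m+1)-form pulled back to ℝ^m, which is zero.
      have hsplit : y = (y - F (dX q y)) + F (dX q y) := by abel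
      rw [hsplit, map_add, ContinuousAlternatingMap.add_apply,
        curryLeft_barD_frame hP hp hq hv hp' ha hvol hT (by rw [map_sub, hF, sub_self])]
      have h0 : B.curryLeft (F (dX q y)) (fun μ => F (stdX μ)) = 0 := by
        have := congrArg (fun β => β (Matrix.vecCons (dX q y) stdX))
          (eq_zero_of_degree_succ (B.compContinuousLinearMap F))
        refine Eq.trans (congrArg B (funext fun i => ?_)) this
        refine Fin.cases ?_ (fun i => ?_) i <;> rfl
      rw [h0]
      simp [hs, hel]

end Data

end FieldEquations

/-! ### Covectors on ℝ^m × ℝ^n that vanish on two vertical vectors. -/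

section LiouvilleCovectors

variable {k n r : ℕ}

/-- `(x, y) ↦ (x, y, 0)`. -/
def qE (k n : ℕ) : XX k × YY n →L[ℝ] XX k × YY n × SS k :=
  (ContinuousLinearMap.id ℝ (XX k)).prodMap (ContinuousLinearMap.inl ℝ (YY n) (SS k))

@[simp] theorem qE_apply (w : XX k × YY n) : qE k n w = (w.1, w.2, 0) := rfl

theorem frame_dX (V : Fin (k + 1) → YY n) (μ : Fin (k + 1)) :
    dX (qE k n) (stdX μ, V μ) = stdX μ := rfl

/-- The covector `p^μ_A dy^A ∧ d^{m-1}x_μ + p d^m x`. -/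
def liouvilleCovector (P : VV k n) (p : ℝ) : (XX k × YY n) [⋀^Fin (k + 1)]→L[ℝ] ℝ :=
  (∑ A, ∑ μ, P A μ • wedge (dy (qE k n) A) (dm1x (qE k n) μ)) + p • dmx (qE k n)

theorem liouvilleCovector_frame (P : VV k n) (p : ℝ) (V : Fin (k + 1) → YY n) :
    liouvilleCovector P p (fun μ => (stdX μ, V μ)) = p + ∑ A, ∑ μ, P A μ * V μ A := by
  have hT := frame_dX (k := k) (n := n) V
  rw [liouvilleCovector]
  simp only [ContinuousAlternatingMap.add_apply, ContinuousAlternatingMap.sum_apply,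
    ContinuousAlternatingMap.smul_apply]
  rw [dmx_frame (q := qE k n) (T := fun μ => (stdX μ, V μ)) hT]
  simp only [wedge_dm1x_frame (q := qE k n) (T := fun μ => (stdX μ, V μ)) hT]
  simp [add_comm]

theorem liouvilleCovector_curryLeft (P : VV k n) (p : ℝ) (y : YY n) :
    (liouvilleCovector P p).curryLeft ((0 : XX k), y) =
      ∑ A, ∑ μ, (P A μ * y A) • dm1x (qE k n) μ := by
  have hY : dX (qE k n) ((0 : XX k), y) = 0 := rfl
  rw [liouvilleCovector]
  simp only [ContinuousAlternatingMap.curryLeft_add, add_apply,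
    curryLeft_sum, ContinuousAlternatingMap.curryLeft_smul, smul_apply,
    curryLeft_wedge_dm1x hY, curryLeft_dmx hY, dy_apply, smul_zero, add_zero, smul_smul]
  rfl

theorem liouvilleCovector_update (P : VV k n) (p : ℝ) (A : Fin n) (μ : Fin (k + 1)) :
    liouvilleCovector P p
      (Function.update (fun μ => ((stdX μ, 0) : XX k × YY n)) μ (0, stdY A)) = P A μ := by
  have h := map_vecCons_succAbove (liouvilleCovector P p) μ
    (fun μ => ((stdX μ, 0) : XX k × YY n)) (0, stdY A)
  rw [← ContinuousAlternatingMap.curryLeft_apply_apply, liouvilleCovector_curryLeft] at h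
  simp only [ContinuousAlternatingMap.sum_apply, ContinuousAlternatingMap.smul_apply] at h
  simp only [dm1x_frame (q := qE k n) (T := fun μ => (stdX μ, 0)) (frame_dX 0)] at h
  simp [stdY] at h
  rw [mul_comm] at h
  exact (mul_left_cancel₀ (pow_ne_zero _ (neg_ne_zero.2 one_ne_zero)) h).symm

theorem liouvilleCovector_vertical (P : VV k n) (p : ℝ) {v : Fin (k + 1) → XX k × YY n}
    {i j : Fin (k + 1)} (hij : i ≠ j) (hi : (v i).1 = 0) (hj : (v j).1 = 0) :
    liouvilleCovector P p v = 0 := by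
  rw [liouvilleCovector]
  simp only [ContinuousAlternatingMap.add_apply, ContinuousAlternatingMap.sum_apply,
    ContinuousAlternatingMap.smul_apply]
  rw [dmx_eq_zero (q := qE k n) hi ⟨i, rfl⟩, smul_zero, add_zero]
  refine Finset.sum_eq_zero fun A _ => Finset.sum_eq_zero fun μ _ => ?_
  rw [wedge_apply, Finset.sum_eq_zero, smul_zero]
  intro l _
  rcases eq_or_ne l i with rfl | h
  · obtain ⟨j', hj'⟩ := Fin.exists_succAbove_eq hij.symm
    rw [dm1x_eq_zero (q := qE k n) hj ⟨j', by rw [Fin.removeNth, hj']⟩, mul_zero, mul_zero]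
  · obtain ⟨i', hi'⟩ := Fin.exists_succAbove_eq h.symm
    rw [dm1x_eq_zero (q := qE k n) hi ⟨i', by rw [Fin.removeNth, hi']⟩, mul_zero, mul_zero]

/-- A semibasic form on `ℝ^m × ℝ^n` that vanishes on `ℝ^m` vanishes. -/
theorem eq_zero_of_semibasic {β : (XX k × YY n) [⋀^Fin r]→L[ℝ] ℝ}
    (h : ∀ v, (∃ i, (v i).1 = 0) → β v = 0)
    (h' : β.compContinuousLinearMap (ContinuousLinearMap.inl ℝ (XX k) (YY n)) = 0) : β = 0 := by
  apply ContinuousAlternatingMap.toAlternatingMap_injective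
  refine Module.Basis.ext_alternating
    ((basisX k).prod (EuclideanSpace.basisFun (Fin n) ℝ).toBasis) fun v _ => ?_
  by_cases hv : ∃ i A, v i = Sum.inr A
  · obtain ⟨i, A, hiA⟩ := hv
    exact h _ ⟨i, by simp [hiA]⟩
  · push Not at hv
    choose g hg using fun i => (Sum.exists (p := fun s => v i = s)).1 ⟨_, rfl⟩ |>.resolve_right
      (fun ⟨A, hA⟩ => hv i A hA)
    have := congrArg (fun γ : XX k [⋀^Fin r]→L[ℝ] ℝ => γ (fun i => basisX k (g i))) h'
    refine Eq.trans (congrArg β (funext fun i => ?_)) this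
    simp [hg]

/-- The contraction of α with a vertical vector is semibasic of degree m-1, and its coefficients
are, up to sign, those in `hP`. Once all these contractions vanish, α itself is semibasic and a
multiple of d^m x, with coefficient `hp`. -/
theorem eq_zero_of_coeffs_eq_zero {α : (XX k × YY n) [⋀^Fin (k + 1)]→L[ℝ] ℝ}
    (h : ∀ v : Fin (k + 1) → XX k × YY n, ∀ i j, i ≠ j → (v i).1 = 0 → (v j).1 = 0 → α v = 0)
    (hp : α (fun μ => (stdX μ, 0)) = 0)
    (hP : ∀ A μ, α (Function.update (fun μ => ((stdX μ, 0) : XX k × YY n)) μ (0, stdY A)) = 0) :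
    α = 0 := by
  have h1 : ∀ y : YY n, α.curryLeft ((0 : XX k), y) = 0 := by
    intro y
    apply eq_zero_of_semibasic
    · rintro v ⟨i, hi⟩
      exact h _ 0 i.succ (Fin.succ_ne_zero i).symm rfl hi
    · apply ext_pred_top
      intro μ
      have e : ((0 : XX k), y) = ∑ A, y A • ((0 : XX k), stdY A) := by
        refine Prod.ext (by simp [Prod.fst_sum]) ?_
        ext i
        simp [Prod.snd_sum, stdY, Pi.single_apply]
      rw [e, map_sum]
      simp only [map_smul]
      refine Eq.trans (b := ∑ A, y A • α.curryLeft ((0 : XX k), stdY A)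
        (fun i => ((stdX (μ.succAbove i), 0) : XX k × YY n))) ?_ ?_
      · simp only [ContinuousAlternatingMap.compContinuousLinearMap_apply,
          ContinuousAlternatingMap.sum_apply]
        rfl
      · refine Finset.sum_eq_zero fun A _ => ?_
        rw [ContinuousAlternatingMap.curryLeft_apply_apply,
          map_vecCons_succAbove α μ (fun μ => ((stdX μ, 0) : XX k × YY n)), hP, mul_zero, smul_zero]
  apply eq_zero_of_semibasic
  · rintro v ⟨i, hi⟩
    have : v = i.insertNth (v i) (i.removeNth v) := by simp
    rw [this, α.map_insertNth]
    have h2 := congrArg (fun β : (XX k × YY n) [⋀^Fin k]→L[ℝ] ℝ => β (i.removeNth v)) (h1 (v i).2)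
    have h3 : ((0 : XX k), (v i).2) = v i := by rw [← hi]
    simp only [h3] at h2
    rw [← ContinuousAlternatingMap.curryLeft_apply_apply, h2]
    simp
  · exact ext_top hp

/-- Covectors that vanish on two vertical vectors are determined by their coefficients. -/
theorem eq_liouvilleCovector {α : (XX k × YY n) [⋀^Fin (k + 1)]→L[ℝ] ℝ}
    (h : ∀ v : Fin (k + 1) → XX k × YY n, ∀ i j, i ≠ j → (v i).1 = 0 → (v j).1 = 0 → α v = 0) :
    α = liouvilleCovector
      (fun A μ => α (Function.update (fun μ => ((stdX μ, 0) : XX k × YY n)) μ (0, stdY A)))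
      (α (fun μ => (stdX μ, 0))) := by
  rw [← sub_eq_zero]
  apply eq_zero_of_coeffs_eq_zero
  · intro v i j hij hi hj
    rw [ContinuousAlternatingMap.sub_apply, h v i j hij hi hj,
      liouvilleCovector_vertical _ _ hij hi hj, sub_zero]
  · have := liouvilleCovector_frame (k := k) (n := n)
      (fun A μ => α (Function.update (fun μ => ((stdX μ, 0) : XX k × YY n)) μ (0, stdY A)))
      (α (fun μ => (stdX μ, 0))) 0
    simp only [Pi.zero_apply] at this
    rw [ContinuousAlternatingMap.sub_apply, this]
    simp
  · intro A μ
    rw [ContinuousAlternatingMap.sub_apply, liouvilleCovector_update, sub_self]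

end LiouvilleCovectors

/-! ### Tangent maps of adapted charts, and fibre coordinates of jets, actions and momenta. -/

section Charts

variable {k n : ℕ}
variable {M : Type*} [TopologicalSpace M] [ChartedSpace (XX k) M]
variable {E : Type*} [TopologicalSpace E] [ChartedSpace (XX k × YY n) E]

theorem mdifferentiable_of_mem_maximalAtlas {H : Type*} [NormedAddCommGroup H] [NormedSpace ℝ H]
    {N : Type*} [TopologicalSpace N] [ChartedSpace H N] [IsManifold 𝓘(ℝ, H) ∞ N]
    {e : OpenPartialHomeomorph N H} (he : e ∈ IsManifold.maximalAtlas 𝓘(ℝ, H) ∞ N) :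
    e.MDifferentiable 𝓘(ℝ, H) 𝓘(ℝ, H) :=
  ⟨(contMDiffOn_of_mem_maximalAtlas he).mdifferentiableOn (by simp),
    (contMDiffOn_symm_of_mem_maximalAtlas he).mdifferentiableOn (by simp)⟩

variable [IsManifold 𝓘(ℝ, XX k) ∞ M] [IsManifold 𝓘(ℝ, XX k × YY n) ∞ E]
variable {π : E → M}

namespace AdaptedChart

variable (c : AdaptedChart (k := k) (n := n) π)

/-- `T_x e` as an isomorphism. -/
def equivM {x : M} (hx : x ∈ c.e.source) : TM (k := k) x ≃L[ℝ] XX k :=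
  (mdifferentiable_of_mem_maximalAtlas c.e_mem).mfderiv hx

/-- `T_y u` as an isomorphism. -/
def equivE {y : E} (hy : y ∈ c.u.source) : TE (k := k) (n := n) y ≃L[ℝ] XX k × YY n :=
  (mdifferentiable_of_mem_maximalAtlas c.u_mem).mfderiv hy

theorem coe_equivM {x : M} (hx : x ∈ c.e.source) :
    (c.equivM hx : TM (k := k) x →L[ℝ] XX k) = mfderiv 𝓘(ℝ, XX k) 𝓘(ℝ, XX k) c.e x := rfl

theorem frameM_eq {x : M} (hx : x ∈ c.e.source) (μ : Fin (k + 1)) :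
    c.frameM x μ = (c.equivM hx).symm (stdX μ) := by
  have := ContinuousLinearMap.inverse_equiv (c.equivM hx)
  rw [coe_equivM] at this
  exact congrArg (fun f : XX k →L[ℝ] TM (k := k) x => f (stdX μ)) this

theorem inverse_du {y : E} (hy : y ∈ c.u.source) :
    (c.du y).inverse = (c.equivE hy).symm :=
  ContinuousLinearMap.inverse_equiv (c.equivE hy)

theorem frameX_eq {y : E} (hy : y ∈ c.u.source) (μ : Fin (k + 1)) :
    c.frameX y μ = (c.equivE hy).symm (stdX μ, 0) := by
  rw [frameX, inverse_du]; rfl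

theorem frameY_eq {y : E} (hy : y ∈ c.u.source) (A : Fin n) :
    c.frameY y A = (c.equivE hy).symm (0, stdY A) := by
  rw [frameY, inverse_du]; rfl

/-- In an adapted chart π is the first projection near y; differentiating `fst_eq` in two ways and
using uniqueness of the derivative gives the identity. -/
theorem equivE_fst (hπ : ContMDiff 𝓘(ℝ, XX k × YY n) 𝓘(ℝ, XX k) ∞ π) {y : E}
    (hy : y ∈ c.u.source) (w : TE (k := k) (n := n) y) :
    (c.equivE hy w).1 = c.equivM (c.mapsTo y hy) (dπ π y w) := by
  have h1 : HasMFDerivAt 𝓘(ℝ, XX k × YY n) 𝓘(ℝ, XX k × YY n) c.u y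
      (c.equivE hy : TE (k := k) (n := n) y →L[ℝ] XX k × YY n) :=
    ((mdifferentiable_of_mem_maximalAtlas c.u_mem).mdifferentiableAt hy).hasMFDerivAt
  have h1' : HasMFDerivAt 𝓘(ℝ, XX k × YY n) 𝓘(ℝ, XX k) (fun y => (c.u y).1) y
      ((ContinuousLinearMap.fst ℝ (XX k) (YY n)).comp
        (c.equivE hy : TE (k := k) (n := n) y →L[ℝ] XX k × YY n)) :=
    HasMFDerivAt.comp y (I' := 𝓘(ℝ, XX k × YY n)) (g := Prod.fst)
      ((ContinuousLinearMap.fst ℝ (XX k) (YY n)).hasFDerivAt.hasMFDerivAt) h1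
  have h2 : HasMFDerivAt 𝓘(ℝ, XX k × YY n) 𝓘(ℝ, XX k) (fun y => c.e (π y)) y
      ((c.equivM (c.mapsTo y hy) : TM (k := k) (π y) →L[ℝ] XX k).comp (dπ π y)) :=
    HasMFDerivAt.comp y
      (((mdifferentiable_of_mem_maximalAtlas c.e_mem).mdifferentiableAt
        (c.mapsTo y hy)).hasMFDerivAt) ((hπ.mdifferentiableAt (by simp)).hasMFDerivAt)
  have h3 : HasMFDerivAt 𝓘(ℝ, XX k × YY n) 𝓘(ℝ, XX k) (fun y => (c.u y).1) y
      ((c.equivM (c.mapsTo y hy) : TM (k := k) (π y) →L[ℝ] XX k).comp (dπ π y)) :=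
    h2.congr_of_eventuallyEq
      (Filter.eventuallyEq_of_mem (c.u.open_source.mem_nhds hy) fun z hz => c.fst_eq z hz)
  exact congrArg (fun f : TE (k := k) (n := n) y →L[ℝ] XX k => f w) (hasMFDerivAt_unique h1' h3)

theorem vertical_iff (hπ : ContMDiff 𝓘(ℝ, XX k × YY n) 𝓘(ℝ, XX k) ∞ π) {y : E}
    (hy : y ∈ c.u.source) (w : TE (k := k) (n := n) y) :
    dπ π y w = 0 ↔ (c.equivE hy w).1 = 0 := by
  rw [c.equivE_fst hπ hy]
  exact (map_eq_zero_iff _ (c.equivM _).injective).symm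

/-! ### Jets -/

/-- The linear map `x ↦ (y^A_μ x^μ)_A`. -/
def arrayMap (V : VV k n) : XX k →L[ℝ] YY n :=
  LinearMap.toContinuousLinearMap
    { toFun := fun x => WithLp.toLp 2 fun A => ∑ μ, V A μ * x μ
      map_add' := fun x y => by
        ext A; simp [mul_add, Finset.sum_add_distrib]
      map_smul' := fun a x => by
        ext A; simp only [PiLp.smul_apply, smul_eq_mul, Finset.mul_sum, RingHom.id_apply]
        exact Finset.sum_congr rfl fun μ _ => by ring }

@[simp] theorem arrayMap_apply (V : VV k n) (x : XX k) (A : Fin n) :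
    arrayMap V x A = ∑ μ, V A μ * x μ := rfl

/-- The first component is forced by the section property of the jet; the second is linear, hence
determined by the coordinate frame. -/
theorem equivE_lin (hπ : ContMDiff 𝓘(ℝ, XX k × YY n) 𝓘(ℝ, XX k) ∞ π) {y : E}
    (hy : y ∈ c.u.source) (j : JetAt (k := k) (n := n) π y) (x : TM (k := k) (π y)) :
    c.equivE hy (j.lin x) =
      (c.equivM (c.mapsTo y hy) x, arrayMap (c.jetCoord j) (c.equivM (c.mapsTo y hy) x)) := by
  set ε := c.equivM (c.mapsTo y hy)
  refine Prod.ext ?_ ?_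
  · rw [c.equivE_fst hπ hy]
    exact congrArg (fun f : TM (k := k) (π y) →L[ℝ] TM (k := k) (π y) => ε (f x)) j.isSec
  · have hx : x = ∑ μ, (ε x) μ • c.frameM (π y) μ := by
      apply ε.injective
      rw [map_sum]
      simp only [map_smul, c.frameM_eq (c.mapsTo y hy)]
      conv_lhs => rw [← sum_smul_stdX (ε x)]
      exact Finset.sum_congr rfl fun μ _ => by rw [ContinuousLinearEquiv.apply_symm_apply]
    ext A
    conv_lhs => rw [hx]
    simp only [map_sum, map_smul, Prod.snd_sum, Prod.smul_snd, arrayMap_apply]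
    rw [WithLp.ofLp_sum, Finset.sum_apply]
    exact Finset.sum_congr rfl fun μ _ => mul_comm _ _

theorem jetCoord_injective (hπ : ContMDiff 𝓘(ℝ, XX k × YY n) 𝓘(ℝ, XX k) ∞ π) {y : E}
    (hy : y ∈ c.u.source) {j j' : JetAt (k := k) (n := n) π y}
    (h : c.jetCoord j = c.jetCoord j') : j = j' := by
  ext x
  apply (c.equivE hy).injective
  rw [c.equivE_lin hπ hy, c.equivE_lin hπ hy, h]

theorem exists_jetCoord (hπ : ContMDiff 𝓘(ℝ, XX k × YY n) 𝓘(ℝ, XX k) ∞ π) {y : E}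
    (hy : y ∈ c.u.source) (V : VV k n) :
    ∃ j : JetAt (k := k) (n := n) π y, c.jetCoord j = V := by
  set ε := c.equivM (c.mapsTo y hy)
  -- The jet with array V is the graph map x ↦ (x, V x) transported through the charts.
  refine ⟨⟨((c.equivE hy).symm : XX k × YY n →L[ℝ] TE (k := k) (n := n) y).comp
    (((ContinuousLinearMap.id ℝ (XX k)).prod (arrayMap V)).comp
      (ε : TM (k := k) (π y) →L[ℝ] XX k)), ?_⟩, ?_⟩
  · ext x
    apply ε.injective
    refine (c.equivE_fst hπ hy _).symm.trans ?_
    simp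
  · ext A μ
    have : c.du y ((c.equivE hy).symm (ε (c.frameM (π y) μ), arrayMap V (ε (c.frameM (π y) μ)))) =
      (ε (c.frameM (π y) μ), arrayMap V (ε (c.frameM (π y) μ))) :=
      (c.equivE hy).apply_symm_apply _
    refine (congrArg (fun w : XX k × YY n => w.2 A) this).trans ?_
    simp only [c.frameM_eq (c.mapsTo y hy), ε, ContinuousLinearEquiv.apply_symm_apply]
    simp [stdX]

theorem jetCoord_line {y : E} (j j' : JetAt (k := k) (n := n) π y) (t : ℝ) :
    c.jetCoord (j.line j' t) = c.jetCoord j + t • (c.jetCoord j' - c.jetCoord j) := by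
  ext A μ
  simp [jetCoord, JetAt.line]

/-! ### Actions -/

theorem actCoord_injective {x : M} (hx : x ∈ c.e.source)
    {β β' : TM (k := k) x [⋀^Fin k]→L[ℝ] ℝ} (h : c.actCoord β = c.actCoord β') : β = β' := by
  have h1 : β.compContinuousLinearMap ((c.equivM hx).symm : XX k →L[ℝ] TM (k := k) x) =
      β'.compContinuousLinearMap ((c.equivM hx).symm : XX k →L[ℝ] TM (k := k) x) := by
    apply ext_pred_top
    intro μ
    have := congrFun h μ
    simp only [actCoord] at this
    have := mul_left_cancel₀ (pow_ne_zero _ (neg_ne_zero.2 one_ne_zero)) this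
    simp only [c.frameM_eq hx] at this
    exact this
  ext v
  have := congrArg (fun γ : XX k [⋀^Fin k]→L[ℝ] ℝ => γ (fun i => c.equivM hx (v i))) h1
  simpa [Function.comp_def] using this

theorem exists_actCoord {x : M} (hx : x ∈ c.e.source) (s : SS k) :
    ∃ β : TM (k := k) x [⋀^Fin k]→L[ℝ] ℝ, c.actCoord β = s := by
  refine ⟨(∑ μ, s μ • (stdVol k).curryLeft (stdX μ)).compContinuousLinearMap
    (c.equivM hx : TM (k := k) x →L[ℝ] XX k), ?_⟩
  ext ν
  simp only [actCoord, c.frameM_eq hx, ContinuousAlternatingMap.compContinuousLinearMap_apply]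
  refine Eq.trans (b := (-1) ^ (ν : ℕ) * (∑ μ, s μ • (stdVol k).curryLeft (stdX μ))
    (fun i => stdX (ν.succAbove i))) ?_ ?_
  · congr 2
    funext i
    simp
  · simp only [ContinuousAlternatingMap.sum_apply, ContinuousAlternatingMap.smul_apply,
      stdVol_curryLeft_succAbove]
    simp
    rw [mul_left_comm, ← pow_add, Even.neg_one_pow ⟨_, rfl⟩, mul_one]

/-! ### Momenta -/

/-- The coordinate expression of a momentum. -/
theorem mom_comp (hπ : ContMDiff 𝓘(ℝ, XX k × YY n) 𝓘(ℝ, XX k) ∞ π) {y : E}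
    (hy : y ∈ c.u.source) (α : Mom (k := k) (n := n) π y) :
    α.1.compContinuousLinearMap ((c.equivE hy).symm : XX k × YY n →L[ℝ] TE (k := k) (n := n) y) =
      liouvilleCovector (c.momCoord α) (c.pCoord α) := by
  have := eq_liouvilleCovector (α := α.1.compContinuousLinearMap
    ((c.equivE hy).symm : XX k × YY n →L[ℝ] TE (k := k) (n := n) y)) (by
      intro v i j hij hi hj
      refine α.2 _ i j hij ((c.vertical_iff hπ hy _).2 ?_) ((c.vertical_iff hπ hy _).2 ?_)
      · simpa using hi
      · simpa using hj)
  refine this.trans ?_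
  congr 1
  · ext A μ
    refine congrArg α.1 (funext fun i => ?_)
    rcases eq_or_ne i μ with rfl | h
    · simp [c.frameY_eq hy]
    · simp [Function.update_of_ne h, c.frameX_eq hy]
  · refine congrArg α.1 (funext fun i => ?_)
    simp [c.frameX_eq hy]

theorem mom_apply (hπ : ContMDiff 𝓘(ℝ, XX k × YY n) 𝓘(ℝ, XX k) ∞ π) {y : E}
    (hy : y ∈ c.u.source) (α : Mom (k := k) (n := n) π y)
    (v : Fin (k + 1) → TE (k := k) (n := n) y) :
    α.1 v = liouvilleCovector (c.momCoord α) (c.pCoord α) (fun i => c.equivE hy (v i)) := by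
  rw [← c.mom_comp hπ hy]
  refine congrArg α.1 (funext fun i => ?_)
  simp

theorem mom_injective (hπ : ContMDiff 𝓘(ℝ, XX k × YY n) 𝓘(ℝ, XX k) ∞ π) {y : E}
    (hy : y ∈ c.u.source) {α α' : Mom (k := k) (n := n) π y}
    (h : c.momCoord α = c.momCoord α') (h' : c.pCoord α = c.pCoord α') : α = α' := by
  apply Subtype.ext
  ext v
  rw [c.mom_apply hπ hy, c.mom_apply hπ hy, h, h']

theorem exists_mom (hπ : ContMDiff 𝓘(ℝ, XX k × YY n) 𝓘(ℝ, XX k) ∞ π) {y : E}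
    (hy : y ∈ c.u.source) (P : VV k n) (p : ℝ) :
    ∃ α : Mom (k := k) (n := n) π y, c.momCoord α = P ∧ c.pCoord α = p := by
  refine ⟨⟨(liouvilleCovector P p).compContinuousLinearMap
    (c.equivE hy : TE (k := k) (n := n) y →L[ℝ] XX k × YY n), ?_⟩, ?_, ?_⟩
  · intro v i j hij hi hj
    exact liouvilleCovector_vertical P p hij ((c.vertical_iff hπ hy _).1 hi)
      ((c.vertical_iff hπ hy _).1 hj)
  · ext A μ
    rw [← liouvilleCovector_update P p A μ]
    refine congrArg (liouvilleCovector P p) (funext fun i => ?_)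
    rcases eq_or_ne i μ with rfl | h
    · simp [c.frameY_eq hy]
    · simp [Function.update_of_ne h, c.frameX_eq hy]
  · have := liouvilleCovector_frame P p 0
    simp only [Pi.zero_apply] at this
    refine Eq.trans ?_ (this.trans (by simp))
    refine congrArg (liouvilleCovector P p) (funext fun i => ?_)
    simp [c.frameX_eq hy]

/-- Since d^m x vanishes as soon as one argument is vertical, the quotient forgets exactly the
coordinate p. Hence `momCoord` of any representative is a coordinate on J^{1*}π. -/
theorem basicSetoid_iff (hπ : ContMDiff 𝓘(ℝ, XX k × YY n) 𝓘(ℝ, XX k) ∞ π) {y : E}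
    (hy : y ∈ c.u.source) {α α' : Mom (k := k) (n := n) π y} :
    (basicSetoid π y).r α α' ↔ c.momCoord α = c.momCoord α' := by
  constructor
  · intro h
    ext A μ
    have := h (Function.update (c.frameX y) μ (c.frameY y A)) μ (by
      rw [c.vertical_iff hπ hy, Function.update_self, c.frameY_eq hy]
      simp)
    exact sub_eq_zero.1 this
  · intro h v i hi
    rw [c.mom_apply hπ hy, c.mom_apply hπ hy, h]
    have h0 : dmx (qE k n) (fun i => c.equivE hy (v i)) = 0 :=
      dmx_eq_zero (Y := c.equivE hy (v i)) ((c.vertical_iff hπ hy _).1 hi) ⟨i, rfl⟩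
    simp [liouvilleCovector, h0]

theorem mk_eq_mk_iff (hπ : ContMDiff 𝓘(ℝ, XX k × YY n) 𝓘(ℝ, XX k) ∞ π) {y : E}
    (hy : y ∈ c.u.source) {α α' : Mom (k := k) (n := n) π y} :
    (Quotient.mk _ α : RMom (k := k) (n := n) π y) = Quotient.mk _ α' ↔
      c.momCoord α = c.momCoord α' :=
  Quotient.eq.trans (c.basicSetoid_iff hπ hy)

theorem momCoord_rep_mk (hπ : ContMDiff 𝓘(ℝ, XX k × YY n) 𝓘(ℝ, XX k) ∞ π) {y : E}
    (hy : y ∈ c.u.source) (α : Mom (k := k) (n := n) π y) :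
    c.momCoord (rep (Quotient.mk _ α : RMom (k := k) (n := n) π y)) = c.momCoord α :=
  (c.mk_eq_mk_iff hπ hy).1 (Quotient.out_eq _)

/-- The jet sends ∂/∂x^μ to ∂/∂x^μ + y^A_μ ∂/∂y^A; evaluating the covector on these vectors gives p
+ p^μ_A y^A_μ. -/
theorem coupling_frame (hπ : ContMDiff 𝓘(ℝ, XX k × YY n) 𝓘(ℝ, XX k) ∞ π) {y : E}
    (hy : y ∈ c.u.source) (j : JetAt (k := k) (n := n) π y) (α : Mom (k := k) (n := n) π y) :
    coupling j α (c.frameM (π y)) =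
      c.pCoord α + ∑ A, ∑ μ, c.momCoord α A μ * c.jetCoord j A μ := by
  rw [coupling, ContinuousAlternatingMap.compContinuousLinearMap_apply, c.mom_apply hπ hy]
  have h : (fun i => c.equivE hy ((j.lin ∘ c.frameM (π y)) i)) =
      fun μ => (stdX μ, WithLp.toLp 2 fun A => c.jetCoord j A μ) := by
    funext μ
    rw [Function.comp_apply, c.equivE_lin hπ hy, c.frameM_eq (c.mapsTo y hy),
      ContinuousLinearEquiv.apply_symm_apply]
    refine Prod.ext rfl ?_
    ext A
    simp [stdX]
  rw [h, liouvilleCovector_frame]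

theorem ext_frameM {x : M} (hx : x ∈ c.e.source) {β β' : TM (k := k) x [⋀^Fin (k + 1)]→L[ℝ] ℝ}
    (h : β (c.frameM x) = β' (c.frameM x)) : β = β' := by
  have h1 : β.compContinuousLinearMap ((c.equivM hx).symm : XX k →L[ℝ] TM (k := k) x) =
      β'.compContinuousLinearMap ((c.equivM hx).symm : XX k →L[ℝ] TM (k := k) x) := by
    apply ext_top
    have e : c.frameM x = fun μ => (c.equivM hx).symm (stdX μ) :=
      funext fun μ => c.frameM_eq hx μ
    rw [e] at h
    exact h
  ext v
  have := congrArg (fun γ : XX k [⋀^Fin (k + 1)]→L[ℝ] ℝ => γ (fun i => c.equivM hx (v i))) h1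
  simpa [Function.comp_def] using this

end AdaptedChart

end Charts

/-! ### Natural coordinates on the bundles; the Legendre map and W_∘ in coordinates. -/

section Coordinates

variable {k n : ℕ}
variable {M : Type*} [TopologicalSpace M] [ChartedSpace (XX k) M]
variable {E : Type*} [TopologicalSpace E] [ChartedSpace (XX k × YY n) E]
variable [IsManifold 𝓘(ℝ, XX k) ∞ M] [IsManifold 𝓘(ℝ, XX k × YY n) ∞ E]
variable {π : E → M}

namespace AdaptedChart

variable (c : AdaptedChart (k := k) (n := n) π)

theorem coordP_inj (hπ : ContMDiff 𝓘(ℝ, XX k × YY n) 𝓘(ℝ, XX k) ∞ π)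
    {a b : P (k := k) (n := n) π} (ha : a.pt ∈ c.u.source) (hb : b.pt ∈ c.u.source)
    (h : c.coordP a = c.coordP b) : a = b := by
  obtain ⟨y, j, β⟩ := a
  obtain ⟨y', j', β'⟩ := b
  simp only [coordP, Prod.mk.injEq] at h
  obtain rfl : y = y' := c.u.injOn ha hb (Prod.ext h.1 h.2.1)
  obtain rfl : j = j' := c.jetCoord_injective hπ ha h.2.2.1
  obtain rfl : β = β' := c.actCoord_injective (c.mapsTo _ ha) h.2.2.2
  rfl

theorem exists_coordP (hπ : ContMDiff 𝓘(ℝ, XX k × YY n) 𝓘(ℝ, XX k) ∞ π) {z : ZP k n}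
    (hz : z ∈ c.targetP) : ∃ a : P (k := k) (n := n) π, a.pt ∈ c.u.source ∧ c.coordP a = z := by
  obtain ⟨x, y, v, s⟩ := z
  have hy := c.u.map_target hz
  obtain ⟨j, hj⟩ := c.exists_jetCoord hπ hy v
  obtain ⟨β, hβ⟩ := c.exists_actCoord (c.mapsTo _ hy) s
  refine ⟨⟨_, j, β⟩, hy, ?_⟩
  simp only [coordP, hj, hβ, c.u.right_inv hz]

theorem coordP_mem {a : P (k := k) (n := n) π} (ha : a.pt ∈ c.u.source) :
    c.coordP a ∈ c.targetP := c.u.map_source ha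

theorem coordPStar_inj (hπ : ContMDiff 𝓘(ℝ, XX k × YY n) 𝓘(ℝ, XX k) ∞ π)
    {a b : PStar (k := k) (n := n) π} (ha : a.pt ∈ c.u.source) (hb : b.pt ∈ c.u.source)
    (h : c.coordPStar a = c.coordPStar b) : a = b := by
  obtain ⟨y, m, β⟩ := a
  obtain ⟨y', m', β'⟩ := b
  simp only [coordPStar, Prod.mk.injEq] at h
  obtain rfl : y = y' := c.u.injOn ha hb (Prod.ext h.1 h.2.1)
  obtain rfl : m = m' := by
    exact (Quotient.out_eq (s := basicSetoid π y) m).symm.trans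
      (((c.mk_eq_mk_iff hπ ha).2 h.2.2.1).trans (Quotient.out_eq (s := basicSetoid π y) m'))
  obtain rfl : β = β' := c.actCoord_injective (c.mapsTo _ ha) h.2.2.2
  rfl

theorem coordW_inj (hπ : ContMDiff 𝓘(ℝ, XX k × YY n) 𝓘(ℝ, XX k) ∞ π)
    {a b : W (k := k) (n := n) π} (ha : a.pt ∈ c.u.source) (hb : b.pt ∈ c.u.source)
    (h : c.coordW a = c.coordW b) (h' : c.pCoord a.mom = c.pCoord b.mom) : a = b := by
  obtain ⟨y, j, m, β⟩ := a
  obtain ⟨y', j', m', β'⟩ := b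
  simp only [coordW, Prod.mk.injEq] at h
  obtain rfl : y = y' := c.u.injOn ha hb (Prod.ext h.1 h.2.1)
  obtain rfl : j = j' := c.jetCoord_injective hπ ha h.2.2.1
  obtain rfl : m = m' := c.mom_injective hπ ha h.2.2.2.1 h'
  obtain rfl : β = β' := c.actCoord_injective (c.mapsTo _ ha) h.2.2.2.2
  rfl

/-- `expr` is built with `Function.extend`, so it recovers f only because the coordinates separate
the points of the chart domain. This is the purpose of the injectivity lemmas above. -/
theorem expr_coord {B : Type*} {pt : B → E} {Z : Type*} {coord : B → Z} {f : B → ℝ}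
    (hinj : ∀ a b, pt a ∈ c.u.source → pt b ∈ c.u.source → coord a = coord b → a = b) {b : B}
    (hb : pt b ∈ c.u.source) : c.expr pt coord f (coord b) = f b := by
  have : Function.Injective (fun b : {b : B // pt b ∈ c.u.source} => coord b) :=
    fun a b h => Subtype.ext (hinj _ _ a.2 b.2 h)
  exact this.extend_apply (fun b : {b : B // pt b ∈ c.u.source} => f b) 0 ⟨b, hb⟩

theorem isOpen_targetP : IsOpen c.targetP :=
  c.u.open_target.preimage (by fun_prop : Continuous fun z : ZP k n => (z.1, z.2.1))

theorem fst_mem_target {z : ZP k n} (hz : z ∈ c.targetP) : z.1 ∈ c.e.target := by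
  have h1 := c.u.map_target hz
  have h2 := c.fst_eq _ h1
  rw [c.u.right_inv hz] at h2
  change z.1 = _ at h2
  rw [h2]
  exact c.e.map_source (c.mapsTo _ h1)

theorem symm_fst {y : E} (hy : y ∈ c.u.source) : c.e.symm (c.u y).1 = π y := by
  rw [c.fst_eq y hy, c.e.left_inv (c.mapsTo y hy)]

variable {vol : ∀ x : M, TM (k := k) x [⋀^Fin (k + 1)]→L[ℝ] ℝ} {L : P (k := k) (n := n) π → ℝ}

theorem volCoeff_ne_zero (hvol : IsVolumeForm vol) {ξ : XX k} (hξ : ξ ∈ c.e.target) :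
    c.volCoeff vol ξ ≠ 0 := by
  intro h
  exact hvol.ne_zero _ (c.ext_frameM (c.e.map_target hξ) h)

theorem volCoeff_contDiffOn (hvol : IsVolumeForm vol) :
    ContDiffOn ℝ ∞ (c.volCoeff vol) c.e.target := hvol.smooth c.e c.e_mem

theorem lag_coordP (hπ : ContMDiff 𝓘(ℝ, XX k × YY n) 𝓘(ℝ, XX k) ∞ π)
    {a : P (k := k) (n := n) π} (ha : a.pt ∈ c.u.source) :
    c.lag vol L (c.coordP a) = L a * vol (π a.pt) (c.frameM (π a.pt)) :=
  c.expr_coord (fun _ _ => c.coordP_inj hπ) ha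

/-- This is what makes Λ smooth: smoothness is assumed for L and for the volume coefficient
separately. -/
theorem lag_eqOn (hπ : ContMDiff 𝓘(ℝ, XX k × YY n) 𝓘(ℝ, XX k) ∞ π) :
    Set.EqOn (c.lag vol L) (fun z => c.expr P.pt c.coordP L z * c.volCoeff vol z.1)
      c.targetP := by
  intro z hz
  obtain ⟨a, ha, rfl⟩ := c.exists_coordP hπ hz
  dsimp only
  rw [c.lag_coordP hπ ha, c.expr_coord (fun _ _ => c.coordP_inj hπ) ha, volCoeff]
  change _ = _ * vol (c.e.symm (c.u a.pt).1) (c.frameM (c.e.symm (c.u a.pt).1))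
  rw [c.symm_fst ha]

theorem lag_contDiffOn (hπ : ContMDiff 𝓘(ℝ, XX k × YY n) 𝓘(ℝ, XX k) ∞ π)
    (hvol : IsVolumeForm vol) (hL : IsSmoothLagrangian L) :
    ContDiffOn ℝ ∞ (c.lag vol L) c.targetP := by
  refine ContDiffOn.congr ((hL c).mul ?_) (c.lag_eqOn hπ)
  exact (c.volCoeff_contDiffOn hvol).comp contDiff_fst.contDiffOn fun z hz => c.fst_mem_target hz

theorem lagV_contDiffOn (hπ : ContMDiff 𝓘(ℝ, XX k × YY n) 𝓘(ℝ, XX k) ∞ π)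
    (hvol : IsVolumeForm vol) (hL : IsSmoothLagrangian L) :
    ContDiffOn ℝ ∞ (c.lagV vol L) c.targetP := by
  have h := (c.lag_contDiffOn hπ hvol hL).fderiv_of_isOpen c.isOpen_targetP (m := ∞) (by simp)
  rw [contDiffOn_pi]
  intro A
  rw [contDiffOn_pi]
  intro μ
  exact h.clm_apply contDiffOn_const

theorem lag_hasFDerivAt (hπ : ContMDiff 𝓘(ℝ, XX k × YY n) 𝓘(ℝ, XX k) ∞ π)
    (hvol : IsVolumeForm vol) (hL : IsSmoothLagrangian L) {z : ZP k n} (hz : z ∈ c.targetP) :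
    HasFDerivAt (c.lag vol L) (fderiv ℝ (c.lag vol L) z) z :=
  (((c.lag_contDiffOn hπ hvol hL).contDiffAt (c.isOpen_targetP.mem_nhds hz)).differentiableAt
    (by simp)).hasFDerivAt

theorem lagV_contDiffAt (hπ : ContMDiff 𝓘(ℝ, XX k × YY n) 𝓘(ℝ, XX k) ∞ π)
    (hvol : IsVolumeForm vol) (hL : IsSmoothLagrangian L) {z : ZP k n} (hz : z ∈ c.targetP) :
    ContDiffAt ℝ ∞ (c.lagV vol L) z :=
  (c.lagV_contDiffOn hπ hvol hL).contDiffAt (c.isOpen_targetP.mem_nhds hz)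

theorem lagV_hasFDerivAt (hπ : ContMDiff 𝓘(ℝ, XX k × YY n) 𝓘(ℝ, XX k) ∞ π)
    (hvol : IsVolumeForm vol) (hL : IsSmoothLagrangian L) {z : ZP k n} (hz : z ∈ c.targetP) :
    HasFDerivAt (c.lagV vol L) (fderiv ℝ (c.lagV vol L) z) z :=
  ((c.lagV_contDiffAt hπ hvol hL hz).differentiableAt (by simp)).hasFDerivAt

theorem sum_smul_stdV (V : VV k n) : ∑ A, ∑ μ, V A μ • stdV A μ = V := by
  ext A μ
  simp [stdV, Finset.sum_apply, Pi.single_apply, ite_apply]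

theorem fderiv_lag_vertical (z : ZP k n) (V : VV k n) :
    fderiv ℝ (c.lag vol L) z (0, 0, V, 0) = ∑ A, ∑ μ, V A μ * c.lagV vol L z A μ := by
  set D := (fderiv ℝ (c.lag vol L) z).comp ((ContinuousLinearMap.inr ℝ (XX k) _).comp
    ((ContinuousLinearMap.inr ℝ (YY n) _).comp (ContinuousLinearMap.inl ℝ (VV k n) (SS k))))
  change D V = _
  conv_lhs => rw [← sum_smul_stdV V]
  simp only [map_sum, map_smul, smul_eq_mul]
  rfl

/-- The derivative of the Lagrangian density along a line of jets. -/
theorem deriv_line (hπ : ContMDiff 𝓘(ℝ, XX k × YY n) 𝓘(ℝ, XX k) ∞ π)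
    (hvol : IsVolumeForm vol) (hL : IsSmoothLagrangian L)
    {a : P (k := k) (n := n) π} (ha : a.pt ∈ c.u.source) (j' : JetAt (k := k) (n := n) π a.pt) :
    deriv (fun t : ℝ => L ⟨a.pt, a.jet.line j' t, a.act⟩) 0 *
        vol (π a.pt) (c.frameM (π a.pt)) =
      ∑ A, ∑ μ, (c.jetCoord j' A μ - c.jetCoord a.jet A μ) * c.lagV vol L (c.coordP a) A μ := by
  set V := c.jetCoord j' - c.jetCoord a.jet
  set w := vol (π a.pt) (c.frameM (π a.pt))
  have hw : w ≠ 0 := by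
    have := c.volCoeff_ne_zero hvol (c.e.map_source (c.mapsTo _ ha))
    rwa [volCoeff, c.e.left_inv (c.mapsTo _ ha)] at this
  have h1 : HasDerivAt (fun t : ℝ => c.coordP a + t • ((0, 0, V, 0) : ZP k n))
      ((0, 0, V, 0) : ZP k n) 0 := by
    simpa using ((hasDerivAt_id (0 : ℝ)).smul_const ((0, 0, V, 0) : ZP k n)).const_add (c.coordP a)
  have h2 : HasDerivAt (fun t : ℝ => c.lag vol L (c.coordP a + t • ((0, 0, V, 0) : ZP k n)))
      (fderiv ℝ (c.lag vol L) (c.coordP a) (0, 0, V, 0)) 0 :=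
    HasFDerivAt.comp_hasDerivAt_of_eq (0 : ℝ)
      (c.lag_hasFDerivAt hπ hvol hL (c.coordP_mem ha)) h1 (by simp)
  -- The line of jets is an affine line in coordinates, and along it Λ is L times the constant w,
  -- because the base point does not move.
  have h3 : (fun t : ℝ => L ⟨a.pt, a.jet.line j' t, a.act⟩) =
      fun t => c.lag vol L (c.coordP a + t • ((0, 0, V, 0) : ZP k n)) / w := by
    funext t
    have : c.coordP a + t • ((0, 0, V, 0) : ZP k n) = c.coordP ⟨a.pt, a.jet.line j' t, a.act⟩ := by
      simp [coordP, jetCoord_line, V]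
    rw [this, c.lag_coordP hπ (a := ⟨a.pt, a.jet.line j' t, a.act⟩) ha]
    exact (mul_div_cancel_right₀ _ hw).symm
  rw [h3, (h2.div_const w).deriv, div_mul_cancel₀ _ hw, fderiv_lag_vertical]
  rfl

/-- Both sides of the Legendre condition are affine functions of the jet coordinates, so comparing
them for all jets is comparing coefficients. -/
theorem isLegendre_iff (hπ : ContMDiff 𝓘(ℝ, XX k × YY n) 𝓘(ℝ, XX k) ∞ π)
    (hvol : IsVolumeForm vol) (hL : IsSmoothLagrangian L)
    {a : P (k := k) (n := n) π} (ha : a.pt ∈ c.u.source) (α : Mom (k := k) (n := n) π a.pt) :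
    IsLegendre vol L a α ↔ c.momCoord α = c.lagV vol L (c.coordP a) ∧
      c.pCoord α = c.lag vol L (c.coordP a) -
        ∑ A, ∑ μ, c.lagV vol L (c.coordP a) A μ * c.jetCoord a.jet A μ := by
  have key : ∀ j' : JetAt (k := k) (n := n) π a.pt,
      coupling j' α = (L a + deriv (fun t : ℝ => L ⟨a.pt, a.jet.line j' t, a.act⟩) 0) •
        vol (π a.pt) ↔
      c.pCoord α + ∑ A, ∑ μ, c.momCoord α A μ * c.jetCoord j' A μ =
        c.lag vol L (c.coordP a) + ∑ A, ∑ μ,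
          (c.jetCoord j' A μ - c.jetCoord a.jet A μ) * c.lagV vol L (c.coordP a) A μ := by
    intro j'
    rw [← c.coupling_frame hπ ha, ← c.deriv_line hπ hvol hL ha, c.lag_coordP hπ ha, ← add_mul]
    exact ⟨fun h => by rw [h]; rfl, fun h => c.ext_frameM (c.mapsTo _ ha) h⟩
  unfold IsLegendre
  simp only [key]
  constructor
  · intro h
    have h0 := h a.jet
    simp only [sub_self, zero_mul, Finset.sum_const_zero, add_zero] at h0
    have hP : c.momCoord α = c.lagV vol L (c.coordP a) := by
      ext A μ
      -- Moving the jet by an elementary array isolates one slope; the constant term was obtained at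
      -- the jet itself.
      obtain ⟨j', hj'⟩ := c.exists_jetCoord hπ ha (c.jetCoord a.jet + stdV A μ)
      have := h j'
      rw [hj', ← h0] at this
      simp only [Pi.add_apply, mul_add, Finset.sum_add_distrib, ← add_assoc, add_sub_cancel_left]
        at this
      simpa [stdV, Pi.single_apply, ite_apply] using this
    refine ⟨hP, ?_⟩
    rw [← hP, ← h0, add_sub_cancel_right]
  · rintro ⟨h1, h2⟩ j'
    rw [h1, h2]
    simp only [sub_mul, Finset.sum_sub_distrib, mul_comm (c.lagV vol L _ _ _)]
    ring

theorem exists_isLegendre (hπ : ContMDiff 𝓘(ℝ, XX k × YY n) 𝓘(ℝ, XX k) ∞ π)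
    (hvol : IsVolumeForm vol) (hL : IsSmoothLagrangian L)
    {a : P (k := k) (n := n) π} (ha : a.pt ∈ c.u.source) :
    ∃ α : Mom (k := k) (n := n) π a.pt, IsLegendre vol L a α := by
  obtain ⟨α, h⟩ := c.exists_mom hπ ha (c.lagV vol L (c.coordP a)) (c.lag vol L (c.coordP a) -
        ∑ A, ∑ μ, c.lagV vol L (c.coordP a) A μ * c.jetCoord a.jet A μ)
  exact ⟨α, (c.isLegendre_iff hπ hvol hL ha α).2 h⟩

/-- The default value 0 in `FLExt` is never taken, because a momentum with the required coordinates
exists in any adapted chart. -/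
theorem isLegendre_FLExt (hπ : ContMDiff 𝓘(ℝ, XX k × YY n) 𝓘(ℝ, XX k) ∞ π)
    (hvol : IsVolumeForm vol) (hL : IsSmoothLagrangian L)
    {a : P (k := k) (n := n) π} (ha : a.pt ∈ c.u.source) :
    IsLegendre vol L a (FLExt vol L a).mom := by
  have h := c.exists_isLegendre hπ hvol hL ha
  have : (FLExt vol L a).mom = h.choose := dif_pos h
  rw [this]
  exact h.choose_spec

/-- The coordinate expression `(x, y, v, s) ↦ (x, y, ∂Λ/∂v, s)` of the Legendre map. -/
def legendreMap (vol : ∀ x : M, TM (k := k) x [⋀^Fin (k + 1)]→L[ℝ] ℝ)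
    (L : P (k := k) (n := n) π → ℝ) (z : ZP k n) : ZP k n :=
  (z.1, z.2.1, c.lagV vol L z, z.2.2.2)

/-- The coordinate expression `Λ - y^A_μ ∂Λ/∂y^A_μ` of the coordinate `p` of the extended Legendre
map. -/
def negEnergy (vol : ∀ x : M, TM (k := k) x [⋀^Fin (k + 1)]→L[ℝ] ℝ)
    (L : P (k := k) (n := n) π → ℝ) (z : ZP k n) : ℝ :=
  c.lag vol L z - ∑ A, ∑ μ, c.lagV vol L z A μ * z.2.2.1 A μ

theorem coordPStar_FL (hπ : ContMDiff 𝓘(ℝ, XX k × YY n) 𝓘(ℝ, XX k) ∞ π)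
    (hvol : IsVolumeForm vol) (hL : IsSmoothLagrangian L)
    {a : P (k := k) (n := n) π} (ha : a.pt ∈ c.u.source) :
    c.coordPStar (FL vol L a) = c.legendreMap vol L (c.coordP a) := by
  have h := ((c.isLegendre_iff hπ hvol hL ha _).1 (c.isLegendre_FLExt hπ hvol hL ha)).1
  exact Prod.ext rfl (Prod.ext rfl (Prod.ext
    ((c.momCoord_rep_mk hπ (y := a.pt) ha (FLExt vol L a).mom).trans h) rfl))

theorem pCoord_FLExt (hπ : ContMDiff 𝓘(ℝ, XX k × YY n) 𝓘(ℝ, XX k) ∞ π)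
    (hvol : IsVolumeForm vol) (hL : IsSmoothLagrangian L)
    {a : P (k := k) (n := n) π} (ha : a.pt ∈ c.u.source) :
    c.pCoord (FLExt vol L a).mom = c.negEnergy vol L (c.coordP a) :=
  ((c.isLegendre_iff hπ hvol hL ha _).1 (c.isLegendre_FLExt hπ hvol hL ha)).2

/-- Equality of the two top degree forms is tested on the frame, where it can be solved for p. Thus
W_∘ is a graph over the remaining coordinates, which are coordinates on it. -/
theorem mem_W0_iff (hπ : ContMDiff 𝓘(ℝ, XX k × YY n) 𝓘(ℝ, XX k) ∞ π)
    {w : W (k := k) (n := n) π} (hw : w.pt ∈ c.u.source) :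
    w ∈ W0 vol L ↔ c.pCoord w.mom = c.lag vol L (c.coordP w.toP) -
      ∑ A, ∑ μ, c.momCoord w.mom A μ * c.jetCoord w.jet A μ := by
  have h1 : w ∈ W0 vol L ↔ density vol L w.toP (c.frameM (π w.pt)) =
      coupling w.jet w.mom (c.frameM (π w.pt)) :=
    ⟨fun h => congrArg (fun β => β (c.frameM (π w.pt))) h,
      fun h => c.ext_frameM (c.mapsTo _ hw) h⟩
  rw [h1, c.coupling_frame hπ hw, c.lag_coordP hπ (a := w.toP) hw, eq_sub_iff_add_eq, eq_comm]
  rfl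

theorem coordW0_inj (hπ : ContMDiff 𝓘(ℝ, XX k × YY n) 𝓘(ℝ, XX k) ∞ π)
    (a b : W0 vol L) (ha : a.1.pt ∈ c.u.source) (hb : b.1.pt ∈ c.u.source)
    (h : c.coordW a.1 = c.coordW b.1) : a = b := by
  apply Subtype.ext
  refine c.coordW_inj hπ ha hb h ?_
  rw [(c.mem_W0_iff hπ ha).1 a.2, (c.mem_W0_iff hπ hb).1 b.2]
  simp only [coordW, Prod.mk.injEq] at h
  simp only [coordP, W.toP]
  rw [h.1, h.2.1, h.2.2.1, h.2.2.2.1, h.2.2.2.2]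

/-- `(x, y, v, p, s) ↦ (x, y, v, s)`. -/
def projP (k n : ℕ) : ZW k n →L[ℝ] ZP k n :=
  (ContinuousLinearMap.id ℝ (XX k)).prodMap ((ContinuousLinearMap.id ℝ (YY n)).prodMap
    ((ContinuousLinearMap.id ℝ (VV k n)).prodMap (ContinuousLinearMap.snd ℝ (VV k n) (SS k))))

@[simp] theorem projP_apply (z : ZW k n) :
    projP k n z = (z.1, z.2.1, z.2.2.1, z.2.2.2.2) := rfl

theorem coordP_toP (w : W (k := k) (n := n) π) : c.coordP w.toP = projP k n (c.coordW w) := rfl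

/-- The coordinate expression of the function `p` on `W_∘`. -/
theorem expr_pCoord_W0 (hπ : ContMDiff 𝓘(ℝ, XX k × YY n) 𝓘(ℝ, XX k) ∞ π) {z : ZW k n}
    (hz : projP k n z ∈ c.targetP) :
    c.expr (fun w : W0 vol L => w.1.pt) (fun w => c.coordW w.1) (fun w => c.pCoord w.1.mom) z =
      c.lag vol L (projP k n z) - ∑ A, ∑ μ, z.2.2.2.1 A μ * z.2.2.1 A μ := by
  obtain ⟨a, ha, haz⟩ := c.exists_coordP hπ hz
  obtain ⟨α, hα, hp⟩ := c.exists_mom hπ ha z.2.2.2.1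
    (c.lag vol L (projP k n z) - ∑ A, ∑ μ, z.2.2.2.1 A μ * z.2.2.1 A μ)
  simp only [coordP, projP_apply, Prod.mk.injEq] at haz
  let w : W (k := k) (n := n) π := ⟨a.pt, a.jet, α, a.act⟩
  have hwz : c.coordW w = z := by
    simp only [coordW, w, haz, hα]
  have hw : w ∈ W0 vol L := by
    rw [c.mem_W0_iff hπ (w := w) ha, coordP_toP, hwz]
    simp only [w, hα, hp, haz]
  have := c.expr_coord (pt := fun w : W0 vol L => w.1.pt) (coord := fun w => c.coordW w.1)
    (f := fun w => c.pCoord w.1.mom) (c.coordW0_inj hπ) (b := ⟨w, hw⟩) ha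
  simp only [hwz] at this
  rw [this]
  exact hp

end AdaptedChart

end Coordinates

/-! ### Existence of adapted charts. -/

section Existence

variable {k n : ℕ}
variable {M : Type*} [TopologicalSpace M] [ChartedSpace (XX k) M]
variable {E : Type*} [TopologicalSpace E] [ChartedSpace (XX k × YY n) E]
variable [IsManifold 𝓘(ℝ, XX k) ∞ M] [IsManifold 𝓘(ℝ, XX k × YY n) ∞ E]
variable {π : E → M}

/-- Charts followed by a linear isomorphism are charts. -/
theorem transHomeomorph_mem_maximalAtlas {H : Type*} [NormedAddCommGroup H] [NormedSpace ℝ H]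
    {N : Type*} [TopologicalSpace N] [ChartedSpace H N] [IsManifold 𝓘(ℝ, H) ∞ N]
    {d : OpenPartialHomeomorph N H} (hd : d ∈ IsManifold.maximalAtlas 𝓘(ℝ, H) ∞ N)
    (G : H ≃L[ℝ] H) :
    d.transHomeomorph G.toHomeomorph ∈ IsManifold.maximalAtlas 𝓘(ℝ, H) ∞ N := by
  apply OpenPartialHomeomorph.mem_maximalAtlas_of_contMDiffOn
  · exact (G.contDiff.contMDiff (n := ∞)).comp_contMDiffOn (contMDiffOn_of_mem_maximalAtlas hd)
  · exact (contMDiffOn_symm_of_mem_maximalAtlas hd).comp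
      (G.symm.contDiff.contMDiff (n := ∞)).contMDiffOn fun _ hz => hz

/-- A submersion admits adapted charts around every point. -/
theorem exists_adaptedChart (hπ : Manifold.IsSubmersion 𝓘(ℝ, XX k × YY n) 𝓘(ℝ, XX k) ∞ π)
    (y : E) : ∃ c : AdaptedChart (k := k) (n := n) π, y ∈ c.u.source := by
  obtain ⟨F, _, _, h⟩ := hπ.isSubmersionAt y
  have hfin : FiniteDimensional ℝ F := by
    have : FiniteDimensional ℝ (XX k × F) :=
      LinearEquiv.finiteDimensional h.equiv.toLinearEquiv
    exact FiniteDimensional.of_surjective (LinearMap.snd ℝ (XX k) F) LinearMap.snd_surjective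
  -- The normal form of a submersion provides a projection ℝ^m × F → ℝ^m with an unspecified
  -- complement F; a dimension count identifies F with ℝ^n.
  have hrank : Module.finrank ℝ F = Module.finrank ℝ (YY n) := by
    have := h.equiv.toLinearEquiv.finrank_eq
    rw [Module.finrank_prod, Module.finrank_prod] at this
    omega
  let G : (XX k × YY n) ≃L[ℝ] (XX k × YY n) := h.equiv.trans
    ((ContinuousLinearEquiv.refl ℝ (XX k)).prodCongr (ContinuousLinearEquiv.ofFinrankEq hrank))
  refine ⟨⟨h.codChart, h.codChart_mem_maximalAtlas, h.domChart.transHomeomorph G.toHomeomorph,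
    transHomeomorph_mem_maximalAtlas h.domChart_mem_maximalAtlas G,
    fun z hz => h.source_subset_preimage_source hz, fun z hz => ?_⟩, h.mem_domChart_source⟩
  change z ∈ h.domChart.source at hz
  have hz' : h.domChart z ∈ (h.domChart.extend 𝓘(ℝ, XX k × YY n)).target := by
    simpa using h.domChart.map_source hz
  have h1 := h.writtenInCharts hz'
  simp only [Function.comp_apply, mfld_simps, h.domChart.left_inv hz] at h1
  exact h1.symm

end Existence

/-! ### The Herglotz–Euler–Lagrange equations, from Θ_ℒ and from Θ_∘. -/

section HerglotzEulerLagrange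

variable {k n : ℕ}
variable {M : Type*} [TopologicalSpace M] [ChartedSpace (XX k) M]
variable {E : Type*} [TopologicalSpace E] [ChartedSpace (XX k × YY n) E]
variable [IsManifold 𝓘(ℝ, XX k) ∞ M] [IsManifold 𝓘(ℝ, XX k × YY n) ∞ E]
variable {π : E → M}

@[simp] theorem qP_apply (z : ZP k n) : qP k n z = (z.1, z.2.1, z.2.2.2) := rfl

@[simp] theorem qW_apply (z : ZW k n) : qW k n z = (z.1, z.2.1, z.2.2.2.2) := rfl

theorem qP_surjective : Function.Surjective (qP k n) := fun w => ⟨(w.1, w.2.1, 0, w.2.2), rfl⟩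

theorem qW_surjective : Function.Surjective (qW k n) := fun w => ⟨(w.1, w.2.1, 0, 0, w.2.2), rfl⟩

namespace AdaptedChart

variable (c : AdaptedChart (k := k) (n := n) π)

/-- `∂Λ/∂y^A`. -/
def lagY (vol : ∀ x : M, TM (k := k) x [⋀^Fin (k + 1)]→L[ℝ] ℝ)
    (L : P (k := k) (n := n) π → ℝ) (z : ZP k n) (A : Fin n) : ℝ :=
  fderiv ℝ (c.lag vol L) z (0, stdY A, 0, 0)

/-- `∂Λ/∂s^μ`. -/
def lagS (vol : ∀ x : M, TM (k := k) x [⋀^Fin (k + 1)]→L[ℝ] ℝ)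
    (L : P (k := k) (n := n) π → ℝ) (z : ZP k n) (μ : Fin (k + 1)) : ℝ :=
  fderiv ℝ (c.lag vol L) z (0, 0, 0, Pi.single μ 1)

/-- The Herglotz–Euler–Lagrange equations in coordinates, together with the second order
condition. -/
def HerglotzEulerLagrange (vol : ∀ x : M, TM (k := k) x [⋀^Fin (k + 1)]→L[ℝ] ℝ)
    (L : P (k := k) (n := n) π → ℝ) (z : ZP k n) (F : XX k →L[ℝ] ZP k n) : Prop :=
  (∑ μ, (F (stdX μ)).2.2.2 μ =
    c.negEnergy vol L z + ∑ A, ∑ μ, c.lagV vol L z A μ * (F (stdX μ)).2.1 A) ∧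
  (∀ A μ, (F (stdX μ)).2.1 A = z.2.2.1 A μ) ∧
  ∀ A, ∑ μ, fderiv ℝ (c.lagV vol L) z (F (stdX μ)) A μ =
    c.lagY vol L z A + ∑ μ, c.lagS vol L z μ * c.lagV vol L z A μ

variable {vol : ∀ x : M, TM (k := k) x [⋀^Fin (k + 1)]→L[ℝ] ℝ} {L : P (k := k) (n := n) π → ℝ}

theorem fderiv_lag_apply (z : ZP k n) {Y : ZP k n} (hY : Y.1 = 0) :
    fderiv ℝ (c.lag vol L) z Y = ∑ A, c.lagY vol L z A * Y.2.1 A +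
      ∑ μ, c.lagS vol L z μ * Y.2.2.2 μ + ∑ A, ∑ μ, c.lagV vol L z A μ * Y.2.2.1 A μ := by
  obtain ⟨x, y, v, s⟩ := Y
  obtain rfl : x = 0 := hY
  have e : ((0, y, v, s) : ZP k n) = (0, y, 0, 0) + (0, 0, 0, s) + (0, 0, v, 0) := by simp
  have ey : fderiv ℝ (c.lag vol L) z (0, y, 0, 0) = ∑ A, c.lagY vol L z A * y A := by
    set D := (fderiv ℝ (c.lag vol L) z).comp ((ContinuousLinearMap.inr ℝ (XX k) _).comp
      (ContinuousLinearMap.inl ℝ (YY n) (VV k n × SS k)))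
    change D y = _
    have : y = ∑ A, y A • stdY A := by
      ext i; simp [stdY, Pi.single_apply]
    conv_lhs => rw [this]
    simp only [map_sum, map_smul, smul_eq_mul, mul_comm (c.lagY vol L z _)]
    rfl
  have es : fderiv ℝ (c.lag vol L) z (0, 0, 0, s) = ∑ μ, c.lagS vol L z μ * s μ := by
    set D := (fderiv ℝ (c.lag vol L) z).comp ((ContinuousLinearMap.inr ℝ (XX k) _).comp
      ((ContinuousLinearMap.inr ℝ (YY n) _).comp (ContinuousLinearMap.inr ℝ (VV k n) (SS k))))
    change D s = _
    have : s = ∑ μ, s μ • Pi.single μ (1 : ℝ) := by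
      ext i; simp [Finset.sum_apply, Pi.single_apply]
    conv_lhs => rw [this]
    simp only [map_sum, map_smul, smul_eq_mul, mul_comm (c.lagS vol L z _)]
    rfl
  refine (congrArg _ e).trans ?_
  rw [map_add, map_add, ey, es, c.fderiv_lag_vertical]
  simp only [mul_comm (v _ _)]

theorem hasFDerivAt_sum_mul {Z : Type*} [NormedAddCommGroup Z] [NormedSpace ℝ Z]
    {a b : Z → VV k n} {a' b' : Z →L[ℝ] VV k n} {z : Z} (ha : HasFDerivAt a a' z)
    (hb : HasFDerivAt b b' z) :
    HasFDerivAt (fun z => ∑ A, ∑ μ, a z A μ * b z A μ)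
      (∑ A, ∑ μ, (a z A μ • entry b' A μ + b z A μ • entry a' A μ)) z := by
  refine HasFDerivAt.fun_sum fun A _ => HasFDerivAt.fun_sum fun μ _ => ?_
  exact HasFDerivAt.mul ((entry (ContinuousLinearMap.id ℝ _) A μ).hasFDerivAt.comp z ha)
    ((entry (ContinuousLinearMap.id ℝ _) A μ).hasFDerivAt.comp z hb)

/-- The Legendre transform cancellation: in d(Λ - v·∂Λ/∂v) the terms ∂Λ/∂v · dv cancel, and only -v
· d(∂Λ/∂v) remains besides the y and s derivatives. This is the shape of dp that the field equation
lemmas require. -/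
theorem exists_hasFDerivAt_negEnergy (hπ : ContMDiff 𝓘(ℝ, XX k × YY n) 𝓘(ℝ, XX k) ∞ π)
    (hvol : IsVolumeForm vol) (hL : IsSmoothLagrangian L) {z : ZP k n} (hz : z ∈ c.targetP) :
    ∃ p' : ZP k n →L[ℝ] ℝ, HasFDerivAt (c.negEnergy vol L) p' z ∧ ∀ Y : ZP k n, Y.1 = 0 →
      p' Y = ∑ A, c.lagY vol L z A * Y.2.1 A + ∑ μ, c.lagS vol L z μ * Y.2.2.2 μ -
        ∑ A, ∑ μ, z.2.2.1 A μ * fderiv ℝ (c.lagV vol L) z Y A μ := by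
  have hv : HasFDerivAt (fun z : ZP k n => z.2.2.1) ((ContinuousLinearMap.fst ℝ (VV k n) (SS k)).comp
      ((ContinuousLinearMap.snd ℝ (YY n) _).comp (ContinuousLinearMap.snd ℝ (XX k) _))) z :=
    ContinuousLinearMap.hasFDerivAt (𝕜 := ℝ) ((ContinuousLinearMap.fst ℝ (VV k n) (SS k)).comp
      ((ContinuousLinearMap.snd ℝ (YY n) _).comp (ContinuousLinearMap.snd ℝ (XX k) _)))
  refine ⟨_, (c.lag_hasFDerivAt hπ hvol hL hz).sub
    (hasFDerivAt_sum_mul (c.lagV_hasFDerivAt hπ hvol hL hz) hv), fun Y hY => ?_⟩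
  rw [sub_apply, c.fderiv_lag_apply z hY]
  simp [sum_apply, Finset.sum_add_distrib]
  ring

/-- The Hessian is the matrix of this endomorphism acting on row vectors, so its nonzero determinant
gives injectivity, and finite dimension gives the rest. -/
theorem bijective_fderiv_lagV (hreg : IsRegular vol L)
    (hπ : ContMDiff 𝓘(ℝ, XX k × YY n) 𝓘(ℝ, XX k) ∞ π)
    (hvol : IsVolumeForm vol) (hL : IsSmoothLagrangian L) {z : ZP k n} (hz : z ∈ c.targetP) :
    Function.Bijective fun h : VV k n => fderiv ℝ (c.lagV vol L) z (0, 0, h, 0) := by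
  have hdet := hreg c z hz
  set D := (fderiv ℝ (c.lagV vol L) z).comp ((ContinuousLinearMap.inr ℝ (XX k) _).comp
    ((ContinuousLinearMap.inr ℝ (YY n) _).comp (ContinuousLinearMap.inl ℝ (VV k n) (SS k))))
  have hent : ∀ i j : Fin n × Fin (k + 1),
      c.hessian vol L z i j = D (stdV i.1 i.2) j.1 j.2 := by
    intro i j
    have h1 : HasFDerivAt (fun z' => c.lagV vol L z' j.1 j.2)
        (entry (fderiv ℝ (c.lagV vol L) z) j.1 j.2) z :=
      (entry (ContinuousLinearMap.id ℝ _) j.1 j.2).hasFDerivAt.comp z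
        (c.lagV_hasFDerivAt hπ hvol hL hz)
    rw [hessian, Matrix.of_apply, h1.fderiv]
    rfl
  have hinj : Function.Injective D := by
    rw [injective_iff_map_eq_zero]
    intro h hh
    have h0 : Matrix.vecMul (fun i : Fin n × Fin (k + 1) => h i.1 i.2) (c.hessian vol L z) = 0 := by
      ext j
      have h1 := congrFun (congrFun hh j.1) j.2
      rw [← sum_smul_stdV h] at h1
      simp only [map_sum, map_smul, Finset.sum_apply, Pi.smul_apply, smul_eq_mul] at h1
      rw [Matrix.vecMul, dotProduct, Fintype.sum_prod_type]
      simp only [hent]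
      exact h1
    have := Matrix.eq_zero_of_vecMul_eq_zero hdet h0
    ext A μ
    exact congrFun this (A, μ)
  exact ⟨hinj, LinearMap.injective_iff_surjective (f := (D : VV k n →ₗ[ℝ] VV k n)).1 hinj⟩

/-- The field equations of a canonical form on `Z` for a section `Φ ∘ f`, where `Φ` pulls the
coordinates and momenta of `Z` back to the coordinates and Lagrangian momenta on `P`. -/
theorem fieldEquationsAt_iff_herglotz {Z : Type*} [NormedAddCommGroup Z] [NormedSpace ℝ Z]
    {q : Z →L[ℝ] XX k × YY n × SS k} {P : Z → VV k n} {p : Z → ℝ} {P' : Z →L[ℝ] VV k n}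
    {p' : Z →L[ℝ] ℝ} {Φ : ZP k n → Z} {Φ' : ZP k n →L[ℝ] Z} {Ω : Z → Z [⋀^Fin (k + 1)]→L[ℝ] ℝ}
    {f : XX k → ZP k n} {g : XX k → Z} {ξ : XX k} {F : XX k →L[ℝ] ZP k n} {a : ℝ} (ha : a ≠ 0)
    (hF : HasFDerivAt f F ξ) (hF1 : ∀ x, (F x).1 = x)
    (hΦ : HasFDerivAt Φ Φ' (f ξ)) (hg : g =ᶠ[𝓝 ξ] Φ ∘ f)
    (hqΦ : ∀ Y, q (Φ' Y) = qP k n Y)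
    (hP : HasFDerivAt P P' (Φ (f ξ))) (hp : HasFDerivAt p p' (Φ (f ξ)))
    (hPΦ : P (Φ (f ξ)) = c.lagV vol L (f ξ)) (hpΦ : p (Φ (f ξ)) = c.negEnergy vol L (f ξ))
    (hPΦ' : ∀ Y, P' (Φ' Y) = fderiv ℝ (c.lagV vol L) (f ξ) Y)
    (hq : Function.Surjective q) (hv : ∀ V : VV k n, ∃ Y, q Y = 0 ∧ P' Y = V)
    (hp' : ∀ Y, dX q Y = 0 → p' Y = ∑ A, c.lagY vol L (f ξ) A * (q Y).2.1 A +
      ∑ μ, c.lagS vol L (f ξ) μ * (q Y).2.2 μ - ∑ A, ∑ μ, (f ξ).2.2.1 A μ * P' Y A μ)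
    (hΩ : Ω (Φ (f ξ)) = a • dmx q) :
    FieldEquationsAt (canonicalForm q P p) Ω g ξ ↔ c.HerglotzEulerLagrange vol L (f ξ) F := by
  -- Chain rule: q and dP of the derivative of g equal those of F by `hqΦ` and `hPΦ'`, so the
  -- equations on Z can be read on P.
  have hG : fderiv ℝ g ξ = Φ'.comp F := by
    rw [hg.fderiv_eq, (hΦ.comp ξ hF).fderiv]
  rw [fieldEquationsAt_iff hP hp hq hv hp' ha hΩ (f := g) (ξ := ξ) hg.self_of_nhds
    (fun x => by rw [hG, dX_apply, ContinuousLinearMap.comp_apply, hqΦ]; exact hF1 x), hG]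
  simp only [ContinuousLinearMap.comp_apply, hqΦ, hPΦ', hPΦ, hpΦ, qP_apply]
  rfl

/-! ### The Lagrangian form -/

/-- Since dx^ν ∧ d^{m-1}x_μ = δ^ν_μ d^m x, the contact part -y^A_ν dx^ν of the canonical
endomorphism contributes only a multiple of d^m x, which combines with -ℒ into the energy term. -/
theorem thetaL_eq : c.thetaL vol L = canonicalForm (qP k n) (c.lagV vol L) (c.negEnergy vol L) := by
  have hw : ∀ z : ZP k n, ∀ A μ, wedge (dy (qP k n) A - ∑ ν, z.2.2.1 A ν • dx (qP k n) ν)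
      (dm1x (qP k n) μ) = wedge (dy (qP k n) A) (dm1x (qP k n) μ) - z.2.2.1 A μ • dmx (qP k n) := by
    intro z A μ
    rw [sub_eq_add_neg, ← neg_one_smul ℝ (∑ ν, _), add_wedge, smul_wedge, sum_wedge]
    simp only [smul_wedge, wedge_dx_dm1x]
    ext w
    simp [apply_ite]
    ring
  funext z
  rw [thetaL, canonicalForm, liouville, iJdL, negEnergy]
  congr 1
  simp only [hw]
  ext w
  simp [ContinuousAlternatingMap.sum_apply, mul_sub, sub_mul, Finset.sum_mul, mul_assoc]
  ring

theorem fieldEquationsAt_thetaL_iff (hreg : IsRegular vol L)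
    (hπ : ContMDiff 𝓘(ℝ, XX k × YY n) 𝓘(ℝ, XX k) ∞ π)
    (hvol : IsVolumeForm vol) (hL : IsSmoothLagrangian L)
    {f : XX k → ZP k n} {ξ : XX k} {F : XX k →L[ℝ] ZP k n}
    (hF : HasFDerivAt f F ξ) (hF1 : ∀ x, (F x).1 = x) (hz : f ξ ∈ c.targetP) :
    FieldEquationsAt (c.thetaL vol L) (c.omegaP vol) f ξ ↔
      c.HerglotzEulerLagrange vol L (f ξ) F := by
  obtain ⟨p', hp, hp'⟩ := c.exists_hasFDerivAt_negEnergy hπ hvol hL hz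
  rw [thetaL_eq]
  refine c.fieldEquationsAt_iff_herglotz (Φ := id) (Φ' := ContinuousLinearMap.id ℝ _)
    (c.volCoeff_ne_zero hvol (c.fst_mem_target hz)) hF hF1 (hasFDerivAt_id _)
    Filter.EventuallyEq.rfl (fun _ => rfl) (c.lagV_hasFDerivAt hπ hvol hL hz) hp rfl rfl
    (fun _ => rfl) qP_surjective ?_ hp' rfl
  intro V
  -- Regularity is used here: the Lagrangian momenta can be varied arbitrarily by moving the
  -- velocities alone.
  obtain ⟨h, hh⟩ := (c.bijective_fderiv_lagV hreg hπ hvol hL hz).2 V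
  exact ⟨(0, 0, h, 0), rfl, hh⟩

/-! ### The form on `W_∘` -/

/-- `(x, y, v, s) ↦ (x, y, v, ∂Λ/∂v, s)`. -/
def liftW (vol : ∀ x : M, TM (k := k) x [⋀^Fin (k + 1)]→L[ℝ] ℝ)
    (L : P (k := k) (n := n) π → ℝ) (z : ZP k n) : ZW k n :=
  (z.1, z.2.1, z.2.2.1, c.lagV vol L z, z.2.2.2)

theorem eventuallyEq_expr_W0 (hπ : ContMDiff 𝓘(ℝ, XX k × YY n) 𝓘(ℝ, XX k) ∞ π) {z : ZW k n}
    (hz : projP k n z ∈ c.targetP) :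
    c.expr (fun w : W0 vol L => w.1.pt) (fun w => c.coordW w.1) (fun w => c.pCoord w.1.mom)
      =ᶠ[𝓝 z] fun z => c.lag vol L (projP k n z) - ∑ A, ∑ μ, z.2.2.2.1 A μ * z.2.2.1 A μ :=
  Filter.eventuallyEq_of_mem
    ((c.isOpen_targetP.preimage (projP k n).continuous).mem_nhds hz)
    fun _ hz' => c.expr_pCoord_W0 hπ hz'

/-- `(x, y, v, p, s) ↦ p`. -/
def momW (k n : ℕ) : ZW k n →L[ℝ] VV k n :=
  (ContinuousLinearMap.fst ℝ (VV k n) (SS k)).comp ((ContinuousLinearMap.snd ℝ (VV k n) _).comp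
    ((ContinuousLinearMap.snd ℝ (YY n) _).comp (ContinuousLinearMap.snd ℝ (XX k) _)))

/-- `(x, y, v, p, s) ↦ v`. -/
def velW (k n : ℕ) : ZW k n →L[ℝ] VV k n :=
  (ContinuousLinearMap.fst ℝ (VV k n) _).comp
    ((ContinuousLinearMap.snd ℝ (YY n) _).comp (ContinuousLinearMap.snd ℝ (XX k) _))

/-- On W_∘ the differential of p has the additional term (∂Λ/∂v - P) · dv. It vanishes on W_1, and
only there does dp have the shape needed for the dissipation form. -/
theorem hasFDerivAt_expr_W0 (hπ : ContMDiff 𝓘(ℝ, XX k × YY n) 𝓘(ℝ, XX k) ∞ π)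
    (hvol : IsVolumeForm vol) (hL : IsSmoothLagrangian L) {z : ZW k n}
    (hz : projP k n z ∈ c.targetP) :
    ∃ p' : ZW k n →L[ℝ] ℝ, HasFDerivAt (c.expr (fun w : W0 vol L => w.1.pt)
      (fun w => c.coordW w.1) (fun w => c.pCoord w.1.mom)) p' z ∧ ∀ Y : ZW k n, Y.1 = 0 →
      p' Y = ∑ A, c.lagY vol L (projP k n z) A * Y.2.1 A +
        ∑ μ, c.lagS vol L (projP k n z) μ * Y.2.2.2.2 μ +
        ∑ A, ∑ μ, (c.lagV vol L (projP k n z) A μ - z.2.2.2.1 A μ) * Y.2.2.1 A μ -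
        ∑ A, ∑ μ, z.2.2.1 A μ * Y.2.2.2.1 A μ := by
  have h1 : HasFDerivAt (fun z => c.lag vol L (projP k n z)) _ z :=
    HasFDerivAt.comp z (c.lag_hasFDerivAt hπ hvol hL hz) (projP k n).hasFDerivAt
  refine ⟨_, (h1.sub (hasFDerivAt_sum_mul (momW k n).hasFDerivAt
    (velW k n).hasFDerivAt)).congr_of_eventuallyEq (c.eventuallyEq_expr_W0 hπ hz), fun Y hY => ?_⟩
  rw [sub_apply, ContinuousLinearMap.comp_apply, c.fderiv_lag_apply _ (Y := projP k n Y) hY]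
  simp [sum_apply, Finset.sum_add_distrib, momW, velW, sub_mul]
  ring

theorem liftW_hasFDerivAt (hπ : ContMDiff 𝓘(ℝ, XX k × YY n) 𝓘(ℝ, XX k) ∞ π)
    (hvol : IsVolumeForm vol) (hL : IsSmoothLagrangian L) {z : ZP k n} (hz : z ∈ c.targetP) :
    ∃ Φ' : ZP k n →L[ℝ] ZW k n, HasFDerivAt (c.liftW vol L) Φ' z ∧
      ∀ Y, Φ' Y = (Y.1, Y.2.1, Y.2.2.1, fderiv ℝ (c.lagV vol L) z Y, Y.2.2.2) := by
  have h0 := hasFDerivAt_id (𝕜 := ℝ) z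
  exact ⟨_, h0.fst.prodMk (h0.snd.fst.prodMk (h0.snd.snd.fst.prodMk
    ((c.lagV_hasFDerivAt hπ hvol hL hz).prodMk h0.snd.snd.snd))), fun _ => rfl⟩

theorem fieldEquationsAt_theta0_iff (hπ : ContMDiff 𝓘(ℝ, XX k × YY n) 𝓘(ℝ, XX k) ∞ π)
    (hvol : IsVolumeForm vol) (hL : IsSmoothLagrangian L)
    {f : XX k → ZP k n} {g : XX k → ZW k n} {ξ : XX k} {F : XX k →L[ℝ] ZP k n}
    (hF : HasFDerivAt f F ξ) (hF1 : ∀ x, (F x).1 = x) (hz : f ξ ∈ c.targetP)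
    (hg : g =ᶠ[𝓝 ξ] c.liftW vol L ∘ f) :
    FieldEquationsAt (c.theta0 vol L) (c.omegaW vol) g ξ ↔
      c.HerglotzEulerLagrange vol L (f ξ) F := by
  have hz' : projP k n (c.liftW vol L (f ξ)) ∈ c.targetP := hz
  obtain ⟨p', hp, hp'⟩ := c.hasFDerivAt_expr_W0 hπ hvol hL hz'
  obtain ⟨Φ', hΦ, hΦ'⟩ := c.liftW_hasFDerivAt hπ hvol hL hz
  refine c.fieldEquationsAt_iff_herglotz (c.volCoeff_ne_zero hvol (c.fst_mem_target hz)) hF hF1 hΦ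
    hg (fun Y => by rw [hΦ']; rfl) (momW k n).hasFDerivAt hp rfl
    (c.expr_pCoord_W0 hπ hz') (fun Y => by rw [hΦ']; rfl) qW_surjective
    (fun V => ⟨(0, 0, 0, V, 0), rfl, rfl⟩) (fun Y hY => ?_) rfl
  rw [hp' Y hY]
  -- The lift lies on W_1, so the additional dv term is zero.
  have : ∀ A μ, c.lagV vol L (projP k n (c.liftW vol L (f ξ))) A μ -
      (c.liftW vol L (f ξ)).2.2.2.1 A μ = 0 := fun A μ => sub_self _
  simp only [this, zero_mul, Finset.sum_const_zero, add_zero]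
  rfl

/-- The contraction of `dΘ_∘` with a vertical vector. -/
theorem curryLeft_extDeriv_theta0 (hπ : ContMDiff 𝓘(ℝ, XX k × YY n) 𝓘(ℝ, XX k) ∞ π)
    (hvol : IsVolumeForm vol) (hL : IsSmoothLagrangian L) {z : ZW k n}
    (hz : projP k n z ∈ c.targetP) (h : VV k n) :
    (extDeriv (c.theta0 vol L) z).curryLeft (0, 0, h, 0, 0) =
      (∑ A, ∑ μ, (z.2.2.2.1 A μ - c.lagV vol L (projP k n z) A μ) * h A μ) • dmx (qW k n) := by
  obtain ⟨p', hp, hp'⟩ := c.hasFDerivAt_expr_W0 hπ hvol hL hz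
  refine (curryLeft_extDeriv_canonicalForm (momW k n).hasFDerivAt hp
    (Y := (0, 0, h, 0, 0)) rfl).trans ?_
  rw [hp' _ rfl]
  ext w
  simp [momW, sub_mul]

/-- Elementary arrays h pick out the components of P - ∂Λ/∂v in the contraction, so W_1 is cut out
by the Legendre relation. -/
theorem theta0_vertical_iff (hπ : ContMDiff 𝓘(ℝ, XX k × YY n) 𝓘(ℝ, XX k) ∞ π)
    (hvol : IsVolumeForm vol) (hL : IsSmoothLagrangian L) {z : ZW k n}
    (hz : projP k n z ∈ c.targetP) :
    (∀ h : VV k n, (extDeriv (c.theta0 vol L) z).curryLeft (0, 0, h, 0, 0) = 0) ↔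
      z.2.2.2.1 = c.lagV vol L (projP k n z) := by
  simp only [c.curryLeft_extDeriv_theta0 hπ hvol hL hz]
  constructor
  · intro h
    ext A μ
    have h1 := h (stdV A μ)
    obtain ⟨T, hT⟩ := exists_frame (qW_surjective (k := k) (n := n))
    have h2 := congrArg (fun β => β T) h1
    simp [dmx_frame hT, stdV, Pi.single_apply, ite_apply] at h2
    exact sub_eq_zero.1 h2
  · intro h V
    ext w
    simp [h]

end AdaptedChart

end HerglotzEulerLagrange

/-! ### Local invertibility of the Legendre map and the Hamiltonian form. -/

section Hamiltonian

variable {k n : ℕ}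
variable {M : Type*} [TopologicalSpace M] [ChartedSpace (XX k) M]
variable {E : Type*} [TopologicalSpace E] [ChartedSpace (XX k × YY n) E]
variable [IsManifold 𝓘(ℝ, XX k) ∞ M] [IsManifold 𝓘(ℝ, XX k × YY n) ∞ E]
variable {π : E → M}
variable {vol : ∀ x : M, TM (k := k) x [⋀^Fin (k + 1)]→L[ℝ] ℝ} {L : P (k := k) (n := n) π → ℝ}

/-- Injectivity on U makes the chosen preimage equal to `a`. -/
theorem hamSection_FL {U : Set (P (k := k) (n := n) π)} (hU : Set.InjOn (FL vol L) U)
    {a : P (k := k) (n := n) π} (ha : a ∈ U) : hamSection vol L U (FL vol L a) = FLExt vol L a := by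
  have h : ∃ a' ∈ U, FL vol L a' = FL vol L a := ⟨a, ha, rfl⟩
  rw [hamSection, dif_pos h]
  exact congrArg _ (hU h.choose_spec.1 ha h.choose_spec.2)

namespace AdaptedChart

variable (c : AdaptedChart (k := k) (n := n) π)

/-- For regular Lagrangians the Legendre map is a local diffeomorphism. -/
theorem exists_hasStrictFDerivAt_legendreMap (hreg : IsRegular vol L)
    (hπ : ContMDiff 𝓘(ℝ, XX k × YY n) 𝓘(ℝ, XX k) ∞ π)
    (hvol : IsVolumeForm vol) (hL : IsSmoothLagrangian L) {z : ZP k n} (hz : z ∈ c.targetP) :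
    ∃ Φ' : ZP k n ≃L[ℝ] ZP k n,
      HasStrictFDerivAt (c.legendreMap vol L) (Φ' : ZP k n →L[ℝ] ZP k n) z ∧
      ∀ Y, Φ' Y = (Y.1, Y.2.1, fderiv ℝ (c.lagV vol L) z Y, Y.2.2.2) := by
  have h0 := hasStrictFDerivAt_id (𝕜 := ℝ) z
  have hV : HasStrictFDerivAt (c.lagV vol L) (fderiv ℝ (c.lagV vol L) z) z :=
    (c.lagV_contDiffAt hπ hvol hL hz).hasStrictFDerivAt (by simp)
  obtain ⟨D, hD, hD'⟩ : ∃ D : ZP k n →L[ℝ] ZP k n, HasStrictFDerivAt (c.legendreMap vol L) D z ∧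
      ∀ Y, D Y = (Y.1, Y.2.1, fderiv ℝ (c.lagV vol L) z Y, Y.2.2.2) :=
    ⟨_, h0.fst.prodMk (h0.snd.fst.prodMk (hV.prodMk h0.snd.snd.snd)), fun _ => rfl⟩
  -- The x, y and s components are preserved, so a kernel vector is purely in the v direction, where
  -- the Hessian is invertible.
  have hinj : Function.Injective (D : ZP k n →ₗ[ℝ] ZP k n) := by
    rw [injective_iff_map_eq_zero]
    rintro ⟨x, y, v, s⟩ h
    have h' := (hD' _).symm.trans h
    simp only [Prod.mk_eq_zero] at h'
    obtain ⟨rfl, rfl, hv, rfl⟩ := h'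
    have : v = 0 := (c.bijective_fderiv_lagV hreg hπ hvol hL hz).1 (by
      refine hv.trans ?_
      exact (map_zero (fderiv ℝ (c.lagV vol L) z)).symm)
    rw [this]
    rfl
  refine ⟨(LinearEquiv.ofInjectiveEndo (D : ZP k n →ₗ[ℝ] ZP k n) hinj).toContinuousLinearEquiv,
    ?_, hD'⟩
  convert hD using 1
  exact ContinuousLinearMap.ext fun _ => rfl

/-- The function `p` of the Hamiltonian section, in coordinates. -/
theorem expr_hamSection (hπ : ContMDiff 𝓘(ℝ, XX k × YY n) 𝓘(ℝ, XX k) ∞ π)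
    (hvol : IsVolumeForm vol) (hL : IsSmoothLagrangian L) {U : Set (P (k := k) (n := n) π)}
    (hU : Set.InjOn (FL vol L) U) {z : ZP k n}
    (hz : z ∈ c.coordP '' {a | a ∈ U ∧ a.pt ∈ c.u.source}) :
    c.expr PStar.pt c.coordPStar (fun b => c.pCoord (hamSection vol L U b).mom)
      (c.legendreMap vol L z) = c.negEnergy vol L z := by
  obtain ⟨a, ⟨haU, ha⟩, rfl⟩ := hz
  rw [← c.coordPStar_FL hπ hvol hL ha, ← c.pCoord_FLExt hπ hvol hL ha]
  rw [c.expr_coord (fun _ _ => c.coordPStar_inj hπ) (b := FL vol L a) ha]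
  rw [hamSection_FL hU haU]

/-- Near the Legendre image p is the function Λ - v·∂Λ/∂v composed with the local inverse G. Writing
vectors as Φ' X turns dp into the differential computed on P and the momentum coordinates into
d(∂Λ/∂v)(X), so dp has the same shape as for Θ_ℒ. -/
theorem fieldEquationsAt_thetaH_iff (hreg : IsRegular vol L)
    (hπ : ContMDiff 𝓘(ℝ, XX k × YY n) 𝓘(ℝ, XX k) ∞ π)
    (hvol : IsVolumeForm vol) (hL : IsSmoothLagrangian L) {U : Set (P (k := k) (n := n) π)}
    (hU : IsLegendreDomain vol L c U)
    {f g : XX k → ZP k n} {ξ : XX k} {F : XX k →L[ℝ] ZP k n}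
    (hF : HasFDerivAt f F ξ) (hF1 : ∀ x, (F x).1 = x)
    (hfU : f ξ ∈ c.coordP '' {a | a ∈ U ∧ a.pt ∈ c.u.source})
    (hg : g =ᶠ[𝓝 ξ] c.legendreMap vol L ∘ f) :
    FieldEquationsAt (c.thetaH vol L U) (c.omegaP vol) g ξ ↔
      c.HerglotzEulerLagrange vol L (f ξ) F := by
  have hz : f ξ ∈ c.targetP := by
    obtain ⟨a, ha, h⟩ := hfU
    rw [← h]
    exact c.coordP_mem ha.2
  obtain ⟨Φ', hΦ, hΦ'⟩ := c.exists_hasStrictFDerivAt_legendreMap hreg hπ hvol hL hz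
  obtain ⟨p', hp, hp'⟩ := c.exists_hasFDerivAt_negEnergy hπ hvol hL hz
  set G := hΦ.localInverse
  have hG : HasFDerivAt G (Φ'.symm : ZP k n →L[ℝ] ZP k n) (c.legendreMap vol L (f ξ)) :=
    hΦ.to_localInverse.hasFDerivAt
  have hGf : G (c.legendreMap vol L (f ξ)) = f ξ := hΦ.localInverse_apply_image
  -- Openness of U is used here: G stays in U near the point, so the section built from the inverse
  -- on U agrees there with the one built from G.
  have hGU : ∀ᶠ z in 𝓝 (c.legendreMap vol L (f ξ)),
      G z ∈ c.coordP '' {a | a ∈ U ∧ a.pt ∈ c.u.source} := by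
    apply hG.continuousAt.eventually
    rw [hGf]
    exact hU.2.mem_nhds hfU
  have hK : c.expr PStar.pt c.coordPStar (fun b => c.pCoord (hamSection vol L U b).mom)
      =ᶠ[𝓝 (c.legendreMap vol L (f ξ))] c.negEnergy vol L ∘ G := by
    filter_upwards [hGU, hΦ.eventually_right_inverse] with z h1 h2
    rw [Function.comp_apply, ← c.expr_hamSection hπ hvol hL hU.1 h1]
    exact congrArg _ h2.symm
  have hpG : HasFDerivAt (c.negEnergy vol L) p' (G (c.legendreMap vol L (f ξ))) := by
    rw [hGf]; exact hp
  have hKd := (hpG.comp _ hG).congr_of_eventuallyEq hK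
  let vel : ZP k n →L[ℝ] VV k n := (ContinuousLinearMap.fst ℝ (VV k n) (SS k)).comp
    ((ContinuousLinearMap.snd ℝ (YY n) _).comp (ContinuousLinearMap.snd ℝ (XX k) _))
  refine c.fieldEquationsAt_iff_herglotz (c.volCoeff_ne_zero hvol (c.fst_mem_target hz)) hF hF1
    hΦ.hasFDerivAt hg (fun Y => ?_) vel.hasFDerivAt hKd rfl
    (c.expr_hamSection hπ hvol hL hU.1 hfU) (fun Y => ?_) qP_surjective
    (fun V => ⟨(0, 0, V, 0), rfl, rfl⟩) (fun Y hY => ?_) rfl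
  · rw [ContinuousLinearEquiv.coe_coe, hΦ' Y]
    rfl
  · rw [ContinuousLinearEquiv.coe_coe, hΦ' Y]
    rfl
  · obtain ⟨X, rfl⟩ := Φ'.surjective Y
    rw [ContinuousLinearMap.comp_apply, ContinuousLinearEquiv.coe_coe,
      ContinuousLinearEquiv.symm_apply_apply]
    have hX : X.1 = 0 := by
      rw [hΦ' X] at hY
      exact hY
    rw [hp' X hX, hΦ' X]
    rfl

/-- Legendre domains exist around every point. -/
theorem exists_isLegendreDomain (hreg : IsRegular vol L)
    (hπ : ContMDiff 𝓘(ℝ, XX k × YY n) 𝓘(ℝ, XX k) ∞ π)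
    (hvol : IsVolumeForm vol) (hL : IsSmoothLagrangian L) {a : P (k := k) (n := n) π}
    (ha : a.pt ∈ c.u.source) : ∃ U, IsLegendreDomain vol L c U ∧ a ∈ U := by
  obtain ⟨Φ', hΦ, -⟩ := c.exists_hasStrictFDerivAt_legendreMap hreg hπ hvol hL (c.coordP_mem ha)
  set e := hΦ.toOpenPartialHomeomorph
  -- U is the part of the chart domain on which the inverse function theorem makes the Legendre map
  -- injective.
  refine ⟨{b | b.pt ∈ c.u.source ∧ c.coordP b ∈ e.source}, ⟨?_, ?_⟩, ha,
    hΦ.mem_toOpenPartialHomeomorph_source⟩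
  · intro b hb b' hb' h
    have h1 := congrArg c.coordPStar h
    rw [c.coordPStar_FL hπ hvol hL hb.1, c.coordPStar_FL hπ hvol hL hb'.1] at h1
    exact c.coordP_inj hπ hb.1 hb'.1 (e.injOn hb.2 hb'.2 h1)
  · have : c.coordP '' {b | b ∈ {b : P (k := k) (n := n) π | b.pt ∈ c.u.source ∧
        c.coordP b ∈ e.source} ∧ b.pt ∈ c.u.source} = c.targetP ∩ e.source := by
      ext z
      constructor
      · rintro ⟨b, ⟨⟨hb, hb'⟩, -⟩, rfl⟩
        exact ⟨c.coordP_mem hb, hb'⟩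
      · rintro ⟨hz, hz'⟩
        obtain ⟨b, hb, rfl⟩ := c.exists_coordP hπ hz
        exact ⟨b, ⟨⟨hb, hz'⟩, hb⟩, rfl⟩
    rw [this]
    exact c.isOpen_targetP.inter e.open_source

theorem isLegendreDomain_univ (hπ : ContMDiff 𝓘(ℝ, XX k × YY n) 𝓘(ℝ, XX k) ∞ π)
    (hinj : Function.Injective (FL vol L)) : IsLegendreDomain vol L c Set.univ := by
  refine ⟨hinj.injOn, ?_⟩
  have : c.coordP '' {b | b ∈ (Set.univ : Set (P (k := k) (n := n) π)) ∧ b.pt ∈ c.u.source} =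
      c.targetP := by
    ext z
    constructor
    · rintro ⟨b, ⟨-, hb⟩, rfl⟩
      exact c.coordP_mem hb
    · intro hz
      obtain ⟨b, hb, rfl⟩ := c.exists_coordP hπ hz
      exact ⟨b, ⟨trivial, hb⟩, rfl⟩
  rw [this]
  exact c.isOpen_targetP

end AdaptedChart

end Hamiltonian

/-! ### Sections: smoothness, holonomy and transfer of the field equations. -/

section Sections

variable {k n : ℕ}
variable {M : Type*} [TopologicalSpace M] [ChartedSpace (XX k) M]
variable {E : Type*} [TopologicalSpace E] [ChartedSpace (XX k × YY n) E]
variable [IsManifold 𝓘(ℝ, XX k) ∞ M] [IsManifold 𝓘(ℝ, XX k × YY n) ∞ E]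
variable {π : E → M}
variable {vol : ∀ x : M, TM (k := k) x [⋀^Fin (k + 1)]→L[ℝ] ℝ} {L : P (k := k) (n := n) π → ℝ}

namespace AdaptedChart

variable (c : AdaptedChart (k := k) (n := n) π)

theorem isOpen_dom {φ : M → E} (hφ : Continuous φ) : IsOpen (c.dom φ) :=
  (hφ.comp_continuousOn c.e.continuousOn_symm).isOpen_inter_preimage c.e.open_target
    c.u.open_source

theorem sec_fst {φ : M → E} (hφ : ∀ x, π (φ x) = x) {ξ : XX k} (hξ : ξ ∈ c.dom φ) :
    (c.u (φ (c.e.symm ξ))).1 = ξ := by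
  rw [c.fst_eq _ hξ.2, hφ, c.e.right_inv hξ.1]

theorem mem_dom {φ : M → E} (hφ : ∀ x, π (φ x) = x) {x : M} (hx : φ x ∈ c.u.source) :
    x ∈ c.e.source ∧ c.e x ∈ c.dom φ := by
  have h1 : x ∈ c.e.source := by
    have := c.mapsTo _ hx
    rwa [hφ] at this
  exact ⟨h1, c.e.map_source h1, by rwa [c.e.left_inv h1]⟩

variable {ψ : M → P (k := k) (n := n) π}

theorem sec_hasFDerivAt (hψ : IsSectionP ψ) {ξ : XX k} (hξ : ξ ∈ c.dom (fun x => (ψ x).pt)) :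
    HasFDerivAt (c.sec c.coordP ψ) (fderiv ℝ (c.sec c.coordP ψ) ξ) ξ :=
  (((hψ.smooth c).contDiffAt ((c.isOpen_dom hψ.smooth_pt.continuous).mem_nhds hξ)).differentiableAt
    (by simp)).hasFDerivAt

/-- A section of P over M reads ξ ↦ (ξ, …) in adapted coordinates, because π ∘ φ is the identity. -/
theorem fderiv_sec_fst (hψ : IsSectionP ψ) {ξ : XX k} (hξ : ξ ∈ c.dom (fun x => (ψ x).pt))
    (x : XX k) : (fderiv ℝ (c.sec c.coordP ψ) ξ x).1 = x := by
  have h1 := (c.sec_hasFDerivAt hψ hξ).fst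
  have h2 : HasFDerivAt (fun ξ => (c.sec c.coordP ψ ξ).1) (ContinuousLinearMap.id ℝ (XX k)) ξ :=
    (hasFDerivAt_id ξ).congr_of_eventuallyEq (Filter.eventuallyEq_of_mem
      ((c.isOpen_dom hψ.smooth_pt.continuous).mem_nhds hξ) fun η hη => c.sec_fst hψ.proj hη)
  exact congrArg (fun D : XX k →L[ℝ] XX k => D x) (h1.unique h2)

theorem sec_mem_targetP {ξ : XX k} (hξ : ξ ∈ c.dom (fun x => (ψ x).pt)) :
    c.sec c.coordP ψ ξ ∈ c.targetP := c.coordP_mem hξ.2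

/-- The Lagrangian equations in coordinates. -/
theorem fieldEquationsAt_sec_iff (hreg : IsRegular vol L)
    (hπ : ContMDiff 𝓘(ℝ, XX k × YY n) 𝓘(ℝ, XX k) ∞ π)
    (hvol : IsVolumeForm vol) (hL : IsSmoothLagrangian L) (hψ : IsSectionP ψ) {ξ : XX k}
    (hξ : ξ ∈ c.dom (fun x => (ψ x).pt)) :
    FieldEquationsAt (c.thetaL vol L) (c.omegaP vol) (c.sec c.coordP ψ) ξ ↔
      c.HerglotzEulerLagrange vol L (c.sec c.coordP ψ ξ) (fderiv ℝ (c.sec c.coordP ψ) ξ) :=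
  c.fieldEquationsAt_thetaL_iff hreg hπ hvol hL (c.sec_hasFDerivAt hψ hξ)
    (c.fderiv_sec_fst hψ hξ) (c.sec_mem_targetP hξ)

end AdaptedChart

theorem momCoord_eq_of_mem_W1 (hπ : ContMDiff 𝓘(ℝ, XX k × YY n) 𝓘(ℝ, XX k) ∞ π)
    (hvol : IsVolumeForm vol) (hL : IsSmoothLagrangian L) {w : W0 vol L} (hw : w ∈ W1 vol L)
    (c : AdaptedChart (k := k) (n := n) π) (hc : w.1.pt ∈ c.u.source) :
    c.momCoord w.1.mom = c.lagV vol L (c.coordP w.1.toP) :=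
  (c.theta0_vertical_iff hπ hvol hL (z := c.coordW w.1)
    (c.coordP_mem (a := w.1.toP) hc)).1 (hw c hc)

theorem coordW_eq_liftW (hπ : ContMDiff 𝓘(ℝ, XX k × YY n) 𝓘(ℝ, XX k) ∞ π)
    (hvol : IsVolumeForm vol) (hL : IsSmoothLagrangian L) {w : W0 vol L} (hw : w ∈ W1 vol L)
    (c : AdaptedChart (k := k) (n := n) π) (hc : w.1.pt ∈ c.u.source) :
    c.coordW w.1 = c.liftW vol L (c.coordP (pr0 w)) :=
  Prod.ext rfl (Prod.ext rfl (Prod.ext rfl (Prod.ext (momCoord_eq_of_mem_W1 hπ hvol hL hw c hc)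
    rfl)))

/-- Both points have the same x, y and s coordinates, and their momenta agree by the equation of
W_1; the class modulo basic forms discards p. -/
theorem FL_pr0_eq_prBar0 (hπ : Manifold.IsSubmersion 𝓘(ℝ, XX k × YY n) 𝓘(ℝ, XX k) ∞ π)
    (hvol : IsVolumeForm vol) (hL : IsSmoothLagrangian L) {w : W0 vol L} (hw : w ∈ W1 vol L) :
    FL vol L (pr0 w) = prBar0 w := by
  obtain ⟨c, hc⟩ := exists_adaptedChart hπ w.1.pt
  refine c.coordPStar_inj hπ.contMDiff hc hc ?_
  rw [c.coordPStar_FL hπ.contMDiff hvol hL (a := pr0 w) hc]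
  refine Prod.ext rfl (Prod.ext rfl (Prod.ext ?_ rfl))
  exact (momCoord_eq_of_mem_W1 hπ.contMDiff hvol hL hw c hc).symm.trans
    (c.momCoord_rep_mk hπ.contMDiff hc w.1.mom).symm

theorem isSectionP_pr0 {ψ : M → W0 vol L} (hψ : IsSectionW0 ψ) :
    IsSectionP (fun x => pr0 (ψ x)) where
  proj := hψ.proj
  smooth_pt := hψ.smooth_pt
  smooth c := (AdaptedChart.projP k n).contDiff.comp_contDiffOn (hψ.smooth c)

theorem isSectionPStar_FL (hπ : ContMDiff 𝓘(ℝ, XX k × YY n) 𝓘(ℝ, XX k) ∞ π)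
    (hvol : IsVolumeForm vol) (hL : IsSmoothLagrangian L) {ψ : M → P (k := k) (n := n) π}
    (hψ : IsSectionP ψ) : IsSectionPStar (fun x => FL vol L (ψ x)) where
  proj := hψ.proj
  smooth_pt := hψ.smooth_pt
  smooth c := by
    have h := hψ.smooth c
    have hV := (c.lagV_contDiffOn hπ hvol hL).comp h fun ξ hξ => c.sec_mem_targetP hξ
    refine ContDiffOn.congr (f := c.legendreMap vol L ∘ c.sec c.coordP ψ)
      (h.fst.prodMk (h.snd.fst.prodMk (hV.prodMk h.snd.snd.snd))) fun ξ hξ => ?_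
    exact c.coordPStar_FL hπ hvol hL (a := ψ (c.e.symm ξ)) hξ.2

theorem isSectionW0_of_pr0 (hπ : ContMDiff 𝓘(ℝ, XX k × YY n) 𝓘(ℝ, XX k) ∞ π)
    (hvol : IsVolumeForm vol) (hL : IsSmoothLagrangian L) {ψ : M → W0 vol L}
    (hψ1 : ∀ x, ψ x ∈ W1 vol L) (hψ : IsSectionP (fun x => pr0 (ψ x))) : IsSectionW0 ψ where
  proj := hψ.proj
  smooth_pt := hψ.smooth_pt
  smooth c := by
    have h := hψ.smooth c
    have hV := (c.lagV_contDiffOn hπ hvol hL).comp h fun ξ hξ => c.sec_mem_targetP hξ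
    refine ContDiffOn.congr (f := c.liftW vol L ∘ c.sec c.coordP (fun x => pr0 (ψ x)))
      (h.fst.prodMk (h.snd.fst.prodMk (h.snd.snd.fst.prodMk (hV.prodMk h.snd.snd.snd))))
      fun ξ hξ => ?_
    exact coordW_eq_liftW hπ hvol hL (hψ1 (c.e.symm ξ)) c hξ.2

/-- The unified equations for sections of `W_1` are the Lagrangian equations for their
projections. -/
theorem solvesUnified_iff (hreg : IsRegular vol L)
    (hπ : ContMDiff 𝓘(ℝ, XX k × YY n) 𝓘(ℝ, XX k) ∞ π)
    (hvol : IsVolumeForm vol) (hL : IsSmoothLagrangian L) {ψ : M → W0 vol L}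
    (hψ1 : ∀ x, ψ x ∈ W1 vol L) (hψ : IsSectionP (fun x => pr0 (ψ x))) :
    SolvesUnified vol L ψ ↔ SolvesLagrangian vol L (fun x => pr0 (ψ x)) := by
  refine forall_congr' fun c => forall_congr' fun ξ => forall_congr' fun hξ => ?_
  rw [c.fieldEquationsAt_sec_iff hreg hπ hvol hL hψ hξ]
  exact c.fieldEquationsAt_theta0_iff hπ hvol hL (c.sec_hasFDerivAt hψ hξ)
    (c.fderiv_sec_fst hψ hξ) (c.sec_mem_targetP (ψ := fun x => pr0 (ψ x)) hξ)
    (Filter.eventuallyEq_of_mem ((c.isOpen_dom hψ.smooth_pt.continuous).mem_nhds hξ)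
      fun η hη => coordW_eq_liftW hπ hvol hL (hψ1 (c.e.symm η)) c hη.2)

/-- The derivative of u ∘ φ is computed once through Tφ and once from the coordinate expression of
ψ. The equation ∂_μ y^A = y^A_μ identifies the latter with the coordinate expression of the jet. -/
theorem SolvesLagrangian.isCanonicalLift (hreg : IsRegular vol L)
    (hπ : Manifold.IsSubmersion 𝓘(ℝ, XX k × YY n) 𝓘(ℝ, XX k) ∞ π)
    (hvol : IsVolumeForm vol) (hL : IsSmoothLagrangian L) {ψ : M → P (k := k) (n := n) π}
    (hψ : IsSectionP ψ) (h : SolvesLagrangian vol L ψ) :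
    IsCanonicalLift (fun x => (ψ x).pt) ψ := by
  intro x
  refine ⟨rfl, fun v => ?_⟩
  obtain ⟨c, hc⟩ := exists_adaptedChart hπ (ψ x).pt
  obtain ⟨hx, hξ⟩ := c.mem_dom (φ := fun x => (ψ x).pt) hψ.proj hc
  have hel := (c.fieldEquationsAt_sec_iff hreg hπ.contMDiff hvol hL hψ hξ).1 (h c _ hξ)
  set f := c.sec c.coordP ψ
  set F := fderiv ℝ f (c.e x)
  have hF := c.sec_hasFDerivAt hψ hξ
  have h1 : HasMFDerivAt 𝓘(ℝ, XX k) 𝓘(ℝ, XX k × YY n) (fun x => c.u (ψ x).pt) x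
      ((c.equivE hc : TE (k := k) (n := n) (ψ x).pt →L[ℝ] XX k × YY n).comp
        (mfderiv 𝓘(ℝ, XX k) 𝓘(ℝ, XX k × YY n) (fun x => (ψ x).pt) x)) :=
    HasMFDerivAt.comp x
      (((mdifferentiable_of_mem_maximalAtlas c.u_mem).mdifferentiableAt hc).hasMFDerivAt)
      ((hψ.smooth_pt.mdifferentiableAt (by simp)).hasMFDerivAt)
  have h2 : HasMFDerivAt 𝓘(ℝ, XX k) 𝓘(ℝ, XX k × YY n) (fun x => c.u (ψ x).pt) x
      ((((ContinuousLinearMap.fst ℝ (XX k) _).comp F).prod ((ContinuousLinearMap.fst ℝ (YY n) _).comp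
        ((ContinuousLinearMap.snd ℝ (XX k) _).comp F))).comp (c.equivM hx : TM (k := k) x →L[ℝ] XX k)) := by
    refine HasMFDerivAt.congr_of_eventuallyEq (f := fun x => ((f (c.e x)).1, (f (c.e x)).2.1)) ?_ ?_
    · exact HasMFDerivAt.comp x (g := fun ξ => ((f ξ).1, (f ξ).2.1))
        (hF.fst.prodMk hF.snd.fst).hasMFDerivAt
        (((mdifferentiable_of_mem_maximalAtlas c.e_mem).mdifferentiableAt hx).hasMFDerivAt)
    · filter_upwards [c.e.open_source.mem_nhds hx] with x' hx'
      simp only [f, AdaptedChart.sec, c.e.left_inv hx']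
      rfl
  have h3 := congrArg (fun D : TM (k := k) x →L[ℝ] XX k × YY n => D v) (hasMFDerivAt_unique h1 h2)
  -- The jet lives over π(φ(x)) and Tφ over x; the two base points agree only through `hψ.proj`.
  have he : (c.equivM (c.mapsTo _ hc) v : XX k) = c.equivM hx v :=
    congrArg (fun x => (mfderiv 𝓘(ℝ, XX k) 𝓘(ℝ, XX k) c.e x : XX k →L[ℝ] XX k) v) (hψ.proj x)
  set w : XX k := c.equivM hx v
  have hfx : f (c.e x) = c.coordP (ψ x) := by
    simp only [f, AdaptedChart.sec, c.e.left_inv hx]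
  apply (c.equivE hc).injective
  refine ((c.equivE_lin hπ.contMDiff hc (ψ x).jet v).trans ?_).trans h3.symm
  refine Prod.ext (he.trans (c.fderiv_sec_fst hψ hξ w).symm) ?_
  refine (congrArg (AdaptedChart.arrayMap (c.jetCoord (ψ x).jet)) he).trans ?_
  change AdaptedChart.arrayMap (c.jetCoord (ψ x).jet) w = (F w).2.1
  ext A
  have hs : ∀ μ, (F (stdX μ)).2.1 A = c.jetCoord (ψ x).jet A μ := fun μ => by
    rw [hel.2.1 A μ, hfx]
    rfl
  conv_rhs => rw [← sum_smul_stdX w]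
  simp only [map_sum, map_smul, Prod.snd_sum, Prod.fst_sum, Prod.smul_snd, Prod.smul_fst]
  rw [WithLp.ofLp_sum, Finset.sum_apply, AdaptedChart.arrayMap_apply]
  exact Finset.sum_congr rfl fun μ _ => by rw [← hs μ, mul_comm]; rfl

theorem SolvesLagrangian.hamiltonianAt (hreg : IsRegular vol L)
    (hπ : ContMDiff 𝓘(ℝ, XX k × YY n) 𝓘(ℝ, XX k) ∞ π)
    (hvol : IsVolumeForm vol) (hL : IsSmoothLagrangian L) {ψ : M → P (k := k) (n := n) π}
    (hψ : IsSectionP ψ) (h : SolvesLagrangian vol L ψ) (c : AdaptedChart (k := k) (n := n) π)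
    {ξ : XX k} (hξ : ξ ∈ c.dom (fun x => (ψ x).pt)) {U : Set (P (k := k) (n := n) π)}
    (hU : IsLegendreDomain vol L c U) (hψU : ψ (c.e.symm ξ) ∈ U) :
    SolvesHamiltonianAt vol L U c (fun x => FL vol L (ψ x)) ξ :=
  (c.fieldEquationsAt_thetaH_iff hreg hπ hvol hL hU (c.sec_hasFDerivAt hψ hξ)
    (c.fderiv_sec_fst hψ hξ) ⟨_, ⟨hψU, hξ.2⟩, rfl⟩
    (Filter.eventuallyEq_of_mem ((c.isOpen_dom hψ.smooth_pt.continuous).mem_nhds hξ)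
      fun η hη => c.coordPStar_FL hπ hvol hL (a := ψ (c.e.symm η)) hη.2)).2
    ((c.fieldEquationsAt_sec_iff hreg hπ hvol hL hψ hξ).1 (h c ξ hξ))

theorem SolvesLagrangian.hamiltonianLocally (hreg : IsRegular vol L)
    (hπ : ContMDiff 𝓘(ℝ, XX k × YY n) 𝓘(ℝ, XX k) ∞ π)
    (hvol : IsVolumeForm vol) (hL : IsSmoothLagrangian L) {ψ : M → P (k := k) (n := n) π}
    (hψ : IsSectionP ψ) (h : SolvesLagrangian vol L ψ) : SolvesHamiltonianLocally vol L ψ :=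
  fun c _ hξ => ⟨c.exists_isLegendreDomain hreg hπ hvol hL hξ.2,
    fun _ hU hψU => h.hamiltonianAt hreg hπ hvol hL hψ c hξ hU hψU⟩

/-- W_1 is the graph of the extended Legendre map: a point of it has P = ∂Λ/∂v, and membership in
W_∘ fixes p. -/
theorem bijective_pr1 (hπ : Manifold.IsSubmersion 𝓘(ℝ, XX k × YY n) 𝓘(ℝ, XX k) ∞ π)
    (hvol : IsVolumeForm vol) (hL : IsSmoothLagrangian L) :
    Function.Bijective (pr1 : W1 vol L → P (k := k) (n := n) π) := by
  constructor
  · intro w w' h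
    apply Subtype.ext
    obtain ⟨c, hc⟩ := exists_adaptedChart hπ w.1.1.pt
    have hpt : w.1.1.pt = w'.1.1.pt := congrArg P.pt h
    have hc' : w'.1.1.pt ∈ c.u.source := hpt ▸ hc
    refine c.coordW0_inj hπ.contMDiff _ _ hc hc' ?_
    rw [coordW_eq_liftW hπ.contMDiff hvol hL w.2 c hc,
      coordW_eq_liftW hπ.contMDiff hvol hL w'.2 c hc']
    exact congrArg (fun a => c.liftW vol L (c.coordP a)) h
  · intro a
    -- The preimage carries the extended Legendre momentum, whose p = Λ - v·∂Λ/∂v is the equation of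
    -- W_∘ at P = ∂Λ/∂v.
    let w : W (k := k) (n := n) π := ⟨a.pt, a.jet, (FLExt vol L a).mom, a.act⟩
    have key : ∀ c : AdaptedChart (k := k) (n := n) π, a.pt ∈ c.u.source →
        c.momCoord w.mom = c.lagV vol L (c.coordP a) ∧ c.pCoord w.mom = c.lag vol L (c.coordP a) -
          ∑ A, ∑ μ, c.lagV vol L (c.coordP a) A μ * c.jetCoord a.jet A μ := fun c hc =>
      (c.isLegendre_iff hπ.contMDiff hvol hL hc _).1
        (c.isLegendre_FLExt hπ.contMDiff hvol hL hc)
    have hw : w ∈ W0 vol L := by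
      obtain ⟨c, hc⟩ := exists_adaptedChart hπ a.pt
      rw [c.mem_W0_iff hπ.contMDiff (w := w) hc, (key c hc).1]
      exact (key c hc).2
    refine ⟨⟨⟨w, hw⟩, fun c hc => ?_⟩, rfl⟩
    exact (c.theta0_vertical_iff hπ.contMDiff hvol hL (z := c.coordW w)
      (c.coordP_mem (a := w.toP) hc)).2 (key c hc).1

end Sections

end Multicontact

end

/-! ### The equivalence theorem. -/

open Multicontact in
theorem theorem1 {k n : ℕ}
    {M : Type*} [TopologicalSpace M] [T2Space M] [SecondCountableTopology M]
    [ChartedSpace (XX k) M] [IsManifold 𝓘(ℝ, XX k) ∞ M]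
    {E : Type*} [TopologicalSpace E] [T2Space E] [SecondCountableTopology E]
    [ChartedSpace (XX k × YY n) E] [IsManifold 𝓘(ℝ, XX k × YY n) ∞ E]
    (π : E → M) (hπ : Manifold.IsSubmersion 𝓘(ℝ, XX k × YY n) 𝓘(ℝ, XX k) ∞ π)
    (hπs : Function.Surjective π)
    (vol : ∀ x : M, TM (k := k) x [⋀^Fin (k + 1)]→L[ℝ] ℝ) (hvol : IsVolumeForm vol)
    (L : P (k := k) (n := n) π → ℝ) (hL : IsSmoothLagrangian L) (hreg : IsRegular vol L) :
    (∀ ψ : M → W0 vol L, IsSectionW0 ψ → (∀ x, ψ x ∈ W1 vol L) → SolvesUnified vol L ψ →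
      IsSectionP (fun x => pr0 (ψ x)) ∧
      IsSectionPStar (fun x => FL vol L (pr0 (ψ x))) ∧
      (∀ x, FL vol L (pr0 (ψ x)) = prBar0 (ψ x)) ∧
      IsCanonicalLift (fun x => (pr0 (ψ x)).pt) (fun x => pr0 (ψ x)) ∧
      IsHolonomic (fun x => pr0 (ψ x)) ∧
      SolvesLagrangian vol L (fun x => pr0 (ψ x)) ∧
      SolvesHamiltonianLocally vol L (fun x => pr0 (ψ x)) ∧
      (IsHyperregular vol L → SolvesHamiltonian vol L (fun x => FL vol L (pr0 (ψ x))))) ∧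
    ∃ h : Function.Bijective (pr1 : W1 vol L → P (k := k) (n := n) π),
      ∀ ψL : M → P (k := k) (n := n) π, IsSectionP ψL → SolvesLagrangian vol L ψL →
        IsSectionW0 (fun x => ((Equiv.ofBijective pr1 h).symm (ψL x)).1) ∧
        (∀ x, ((Equiv.ofBijective pr1 h).symm (ψL x)).1 ∈ W1 vol L) ∧
        SolvesUnified vol L (fun x => ((Equiv.ofBijective pr1 h).symm (ψL x)).1) := by
  have hπ' := hπ.contMDiff
  refine ⟨fun ψ hψ hψ1 hU => ?_, bijective_pr1 hπ hvol hL, fun ψL hψL hLag => ?_⟩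
  · have hP := isSectionP_pr0 hψ
    have hLag := (solvesUnified_iff hreg hπ' hvol hL hψ1 hP).1 hU
    have hlift := hLag.isCanonicalLift hreg hπ hvol hL hP
    exact ⟨hP, isSectionPStar_FL hπ' hvol hL hP, fun x => FL_pr0_eq_prBar0 hπ hvol hL (hψ1 x),
      hlift, ⟨_, hP.proj, hP.smooth_pt, hlift⟩, hLag, hLag.hamiltonianLocally hreg hπ' hvol hL hP,
      fun hyp c ξ hξ => hLag.hamiltonianAt hreg hπ' hvol hL hP c hξ
        (c.isLegendreDomain_univ hπ' hyp.2.1) trivial⟩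
  · set e := Equiv.ofBijective pr1 (bijective_pr1 hπ hvol hL)
    -- The section built from pr_1⁻¹ projects back to ψ_ℒ, so the equivalence for sections of W_1
    -- applies in the converse direction.
    have hpr : (fun x => pr0 (e.symm (ψL x)).1) = ψL := funext fun x => e.apply_symm_apply (ψL x)
    have h1 : ∀ x, (e.symm (ψL x)).1 ∈ W1 vol L := fun x => (e.symm (ψL x)).2
    have hP : IsSectionP (fun x => pr0 (e.symm (ψL x)).1) := by rw [hpr]; exact hψL
    refine ⟨isSectionW0_of_pr0 hπ' hvol hL h1 hP, h1, ?_⟩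
    rw [solvesUnified_iff hreg hπ' hvol hL h1 hP, hpr]
    exact hLag
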